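/- **Setting.** Let $d\in\{2,3\}$, $L,T>0$, $\Omega=[0,L]^d$ with periodic boundary conditions, and let $K,B,C,c,B_0,\kappa_1,\kappa_2>0$ and $A,a,b,q\in\mathbb R$, with $A<B^2/(27C)$ if $d=3$ and $A<0$ if $d=2$. Put $s_+=\frac{B+\sqrt{B^2-24AC}}{4C}$ if $d=3$, $s_+=\sqrt{-2A/C}$ if $d=2$; $\beta=B$ if $d=3$, $\beta=0$ if $d=2$; $\mathbf M=\mathbf Q/s_++\mathbf I/d$ for a symmetric traceless $d\times d$ matrix field $\mathbf Q$; and $$E_1(\mathbf Q,u)=\int_\Omega 2B_0q^2\,D^2u:\mathbf Mu+B_0q^4|\mathbf Mu|^2+\tfrac A2\operatorname{tr}\mathbf Q^2-\tfrac \beta3\operatorname{tr}\mathbf Q^3+\tfrac C4(\operatorname{tr}\mathbf Q^2)^2+\tfrac a2u^2+\tfrac b3u^3+\tfrac c4u^4\,dx ,$$ $$\mathbf H=A\mathbf Q-\beta\big(\mathbf Q^2-\tfrac{\operatorname{tr}\mathbf Q^2}{d}\mathbf I\big)+C\operatorname{tr}(\mathbf Q^2)\mathbf Q+\tfrac{2B_0q^2}{s_+}\big(u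 D^2u-\tfrac{\operatorname{tr}(uD^2u)}{d}\mathbf I\big)+\tfrac{2B_0q^4}{s_+^2}u^2\mathbf Q,$$ $$\mu=au+bu^2+cu^3+2B_0q^2\,\mathbf M:D^2u+2B_0q^2\,\nabla\cdot(\nabla\cdot(\mathbf Mu))+2B_0q^4|\mathbf M|^2u,\qquad g=e^{s}/e^{E_1(\mathbf Q,u)},$$ $$\mathbf N=-g\mathbf H+g\kappa_1\mathbf Q,\qquad \mathcal N=-g\mu+g\kappa_2u .$$ Let $(\mathbf Q,u,s)$ be a spatially periodic solution on $[0,T]$ of $$\partial_t\mathbf Q-K\Delta\mathbf Q=-g\mathbf H,\quad \partial_tu+2B_0\Delta^2u=-g\mu,\quad s'=g\Big(\int_\Omega\mathbf H:\partial_t\mathbf Q\,dx+\int_\Omega\mu\,\partial_tu\,dx\Big),\quad s=E_1(\mathbf Q,u),$$ with $\mathbf Q(t),u(t)$ of class $C^4$ in space and all space derivatives up to order $4$ bounded on $[0,T]\times\Omega$. **Discretization.** For an integer $J\ge1$ let $h=L/J$ and consider periodic functions on the uniform grid with $J^d$ nodes, $\langle U,V\rangle_h=h^d\sum_pU_pV_p$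 (sum over one period), forward, backward and central differences $D_k^\pm,D_k^c$, $\nabla_hU=(D_k^+U)_k$, $\Delta_h=\sum_kD_k^+D_k^-$, and norms $\|U\|_h^2=\langle U,U\rangle_h$, $\|U\|_{H^1_h}^2=\|U\|_h^2+\|\nabla_hU\|_h^2$, $\|U\|_{H_h^2}^2=\|U\|_{H^1_h}^2+\|\Delta_hU\|_h^2$ (for matrix-valued functions: sum of the squares over the components). Let $E_{1h}$, $\mathbf H_h$, $\mu_h$ be obtained from $E_1,\mathbf H,\mu$ by replacing $\int_\Omega\cdot\,dx$ by $h^d\sum_p$, $D^2u$ by $D_h^2u=(D_k^cD_l^cu)_{kl}$ and $\nabla\cdot(\nabla\cdot(\mathbf Mu))$ by $\sum_{k,l}D_k^cD_l^c(\mathbf M^{kl}u)$. For a time step $\tau>0$ and $\eta_0\in[0,1]$ let $(\mathbf Q_h^n,u_h^n,s^n)_{n\ge0}$ (with $\mathbf Q_h^n$ symmetric and traceless) be a solution of the relaxed generalized SAV exponential integrator scheme: with $g^n=e^{s^n}/e^{E_{1h}(\mathbf Q_h^n,u_h^n)}$, $\mathcal L_h=-K\Delta_h+g^n\kappa_1$,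 $\mathcal D_h=2B_0\Delta_h^2+g^n\kappa_2$, $\mathbf N_h^n=-g^n\mathbf H_h^n+g^n\kappa_1\mathbf Q_h^n$, $\mathcal N_h^n=-g^n\mu_h^n+g^n\kappa_2u_h^n$, $\phi_1(z)=(e^z-1)/z$, $$\mathbf Q_h^{n+1}=e^{-\tau\mathcal L_h}\mathbf Q_h^n+\tau\phi_1(-\tau\mathcal L_h)\mathbf N_h^n,\qquad u_h^{n+1}=e^{-\tau\mathcal D_h}u_h^n+\tau\phi_1(-\tau\mathcal D_h)\mathcal N_h^n,$$ $$\tilde s^{n+1}=s^n+g^n\big(\langle\mathbf H_h^n,\delta\mathbf Q\rangle_h+\langle\mu_h^n,\delta u\rangle_h\big),\qquad s^{n+1}=\xi\tilde s^{n+1}+(1-\xi)E_{1h}(\mathbf Q_h^{n+1},u_h^{n+1}),$$ where $\delta\mathbf Q=\mathbf Q_h^{n+1}-\mathbf Q_h^n$, $\delta u=u_h^{n+1}-u_h^n$ and $\xi=\xi^{n+1}\in[0,1]$ is such that $s^{n+1}-\tilde s^{n+1}\le\eta_0\tau\mathcal R^{n+1}$, $\mathcal R^{n+1}=\frac1\tau\big(\langle\mathcal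 Q_1(\tau\mathcal L_h)\delta\mathbf Q,\delta\mathbf Q\rangle_h+\langle\mathcal Q_1(\tau\mathcal D_h)\delta u,\delta u\rangle_h\big)$, $\mathcal Q_1(z)=\frac z{e^z-1}+\frac z2$. **Theorem.** For every $M$ there are positive constants $C_g,C_{Lip,\mathbf Q},C_{Lip,u}$, depending only on $M$, $\Omega$, the parameters $K,A,B,C,a,b,c,B_0,q,\kappa_1,\kappa_2$ and the exact solution (including $T$), but not on $h,\tau,n,\eta_0$, such that, whenever $\|\mathbf Q_h^0\|_{H_h^1}\le M$, $\|u_h^0\|_{H_h^2}\le M$ and $|s^0|\le M$, for all $n\ge0$ with $t_n=n\tau\le T$ the errors $\mathbf E_{\mathbf Q}^n=\mathbf Q_h^n-\mathbf Q(t_n)$, $e_u^n=u_h^n-u(t_n)$ (at the grid points) and $e_s^n=s^n-s(t_n)$ satisfy $$|g^n-g(t_n)|\le C_g\big(|e_s^n|+\|\mathbf E_{\mathbf Q}^n\|_{H_h^1}+\|e_u^n\|_{H_h^2}+h^2\big),$$ $$\|\mathbf N_h^n-\mathbf N(t_n)\|_h\le C_{Lip,\mathbf Q}\big(|e_s^n|+\|\mathbf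 E_{\mathbf Q}^n\|_{H_h^1}+\|e_u^n\|_{H_h^2}+h^2\big),$$ $$\|\mathcal N_h^n-\mathcal N(t_n)\|_h\le C_{Lip,u}\big(|e_s^n|+\|\mathbf E_{\mathbf Q}^n\|_{H_h^2}+\|e_u^n\|_{H_h^2}+h^2\big).$$ -/

import Mathlib

open Set

noncomputable section

namespace SmA

/-! ### The model: parameters and pointwise quantities -/

/-- Parameters of the smectic-A model (`K, A, B, C, a, b, c, B0, q`) and the two stabilization
parameters `κ1, κ2` of the scheme. -/
structure Params where
  K : ℝ
  A : ℝ
  B : ℝ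
  C : ℝ
  a : ℝ
  b : ℝ
  c : ℝ
  B0 : ℝ
  q : ℝ
  κ1 : ℝ
  κ2 : ℝ

/-- Signs of the parameters, and the temperature regime in which the nematic and the smectic
order are coupled: `A < B² / (27 C)` if `d = 3`, `A < 0` if `d = 2`. -/
structure Params.Admissible (P : Params) (d : ℕ) : Prop where
  K_pos : 0 < P.K
  B_pos : 0 < P.B
  C_pos : 0 < P.C
  c_pos : 0 < P.c
  B0_pos : 0 < P.B0
  κ1_pos : 0 < P.κ1
  κ2_pos : 0 < P.κ2
  regime_three : d = 3 → P.A < P.B ^ 2 / (27 * P.C)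
  regime_two : d = 2 → P.A < 0

/-- The equilibrium scalar order parameter `s₊`. -/
def sPlus (P : Params) (d : ℕ) : ℝ :=
  if d = 3 then (P.B + √(P.B ^ 2 - 24 * P.A * P.C)) / (4 * P.C) else √(-2 * P.A / P.C)

variable {d : ℕ}

/-- Frobenius product `X : Y`. -/
def frob (X Y : Matrix (Fin d) (Fin d) ℝ) : ℝ := ∑ i, ∑ j, X i j * Y i j

/-- Membership in the space of symmetric traceless `d × d` matrices. -/
def IsQTensor (X : Matrix (Fin d) (Fin d) ℝ) : Prop := X.IsSymm ∧ X.trace = 0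

/-- `M = Q / s₊ + I / d`. -/
def mTensor (P : Params) (Q : Matrix (Fin d) (Fin d) ℝ) : Matrix (Fin d) (Fin d) ℝ :=
  (1 / sPlus P d) • Q + (1 / (d : ℝ)) • (1 : Matrix (Fin d) (Fin d) ℝ)

/-- Nematic bulk energy density; the cubic term is present for `d = 3` only. -/
def fbn (P : Params) (Q : Matrix (Fin d) (Fin d) ℝ) : ℝ :=
  P.A / 2 * (Q * Q).trace - (if d = 3 then P.B / 3 * (Q * Q * Q).trace else 0)
    + P.C / 4 * (Q * Q).trace ^ 2

/-- Smectic bulk energy density. -/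
def fs (P : Params) (u : ℝ) : ℝ := P.a / 2 * u ^ 2 + P.b / 3 * u ^ 3 + P.c / 4 * u ^ 4

/-- Density of the nonlinear energy `E₁`, as a function of the values of `Q`, of `u` and of the
Hessian of `u` at a point. -/
def energyDensity (P : Params) (Q : Matrix (Fin d) (Fin d) ℝ) (u : ℝ)
    (hess : Matrix (Fin d) (Fin d) ℝ) : ℝ :=
  2 * P.B0 * P.q ^ 2 * frob hess (u • mTensor P Q)
    + P.B0 * P.q ^ 4 * frob (u • mTensor P Q) (u • mTensor P Q) + fbn P Q + fs P u

/-- The variation `H` of `E₁` in `Q` (projected to symmetric traceless matrices), as a function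
of the values of `Q`, of `u` and of the Hessian of `u` at a point. -/
def hVar (P : Params) (Q : Matrix (Fin d) (Fin d) ℝ) (u : ℝ)
    (hess : Matrix (Fin d) (Fin d) ℝ) : Matrix (Fin d) (Fin d) ℝ :=
  P.A • Q
    - (if d = 3 then P.B else 0) • (Q * Q - ((Q * Q).trace / d) • (1 : Matrix (Fin d) (Fin d) ℝ))
    + (P.C * (Q * Q).trace) • Q
    + (2 * P.B0 * P.q ^ 2 / sPlus P d) •
        (u • hess - ((u • hess).trace / d) • (1 : Matrix (Fin d) (Fin d) ℝ))
    + (2 * P.B0 * P.q ^ 4 / sPlus P d ^ 2 * u ^ 2) • Q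

/-- The variation `μ` of `E₁` in `u`, as a function of the values of `Q`, of `u`, of the Hessian
of `u` and of the double divergence of `M u` at a point. -/
def muVar (P : Params) (Q : Matrix (Fin d) (Fin d) ℝ) (u : ℝ)
    (hess : Matrix (Fin d) (Fin d) ℝ) (divdiv : ℝ) : ℝ :=
  P.a * u + P.b * u ^ 2 + P.c * u ^ 3 + 2 * P.B0 * P.q ^ 2 * frob (mTensor P Q) hess
    + 2 * P.B0 * P.q ^ 2 * divdiv + 2 * P.B0 * P.q ^ 4 * frob (mTensor P Q) (mTensor P Q) * u

/-! ### The exact solution on the periodic box `Ω = [0, L]^d` -/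

/-- Partial derivative in the direction of the `k`-th axis. -/
def pd (k : Fin d) (f : (Fin d → ℝ) → ℝ) (x : Fin d → ℝ) : ℝ := fderiv ℝ f x (Pi.single k 1)

/-- Laplacian. -/
def lapC (f : (Fin d → ℝ) → ℝ) (x : Fin d → ℝ) : ℝ := ∑ k, pd k (pd k f) x

/-- Hessian `D² f`. -/
def hessC (f : (Fin d → ℝ) → ℝ) (x : Fin d → ℝ) : Matrix (Fin d) (Fin d) ℝ :=
  Matrix.of fun k l => pd k (pd l f) x

/-- `∇ · (∇ · (M u))`. -/
def divDivC (P : Params) (Q : (Fin d → ℝ) → Matrix (Fin d) (Fin d) ℝ) (u : (Fin d → ℝ) → ℝ)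
    (x : Fin d → ℝ) : ℝ :=
  ∑ k, ∑ l, pd k (pd l fun y => mTensor P (Q y) k l * u y) x

/-- The nonlinear energy `E₁(Q, u)`, an integral over `[0, L]^d`. -/
def energyC (P : Params) (L : ℝ) (Q : (Fin d → ℝ) → Matrix (Fin d) (Fin d) ℝ)
    (u : (Fin d → ℝ) → ℝ) : ℝ :=
  ∫ x in Icc (0 : Fin d → ℝ) (fun _ => L), energyDensity P (Q x) (u x) (hessC u x)

/-- The multiplier `g(Q, u, s) = exp s / exp E₁(Q, u)`. -/
def multC (P : Params) (L : ℝ) (Q : (Fin d → ℝ) → Matrix (Fin d) (Fin d) ℝ)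
    (u : (Fin d → ℝ) → ℝ) (s : ℝ) : ℝ :=
  Real.exp s / Real.exp (energyC P L Q u)

/-- The variation `H(Q, u)`. -/
def hC (P : Params) (Q : (Fin d → ℝ) → Matrix (Fin d) (Fin d) ℝ) (u : (Fin d → ℝ) → ℝ)
    (x : Fin d → ℝ) : Matrix (Fin d) (Fin d) ℝ :=
  hVar P (Q x) (u x) (hessC u x)

/-- The variation `μ(Q, u)`. -/
def muC (P : Params) (Q : (Fin d → ℝ) → Matrix (Fin d) (Fin d) ℝ) (u : (Fin d → ℝ) → ℝ)
    (x : Fin d → ℝ) : ℝ :=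
  muVar P (Q x) (u x) (hessC u x) (divDivC P Q u x)

/-- The nonlinear term of the `Q`-equation, `-g H + g κ1 Q`. -/
def nonlinQC (P : Params) (L : ℝ) (Q : (Fin d → ℝ) → Matrix (Fin d) (Fin d) ℝ)
    (u : (Fin d → ℝ) → ℝ) (s : ℝ) (x : Fin d → ℝ) : Matrix (Fin d) (Fin d) ℝ :=
  -(multC P L Q u s • hC P Q u x) + (multC P L Q u s * P.κ1) • Q x

/-- The nonlinear term of the `u`-equation, `-g μ + g κ2 u`. -/
def nonlinUC (P : Params) (L : ℝ) (Q : (Fin d → ℝ) → Matrix (Fin d) (Fin d) ℝ)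
    (u : (Fin d → ℝ) → ℝ) (s : ℝ) (x : Fin d → ℝ) : ℝ :=
  -(multC P L Q u s * muC P Q u x) + multC P L Q u s * P.κ2 * u x

/-- A time dependent scalar field that is `L`-periodic in every space direction and of class `C⁴`
in space, with space derivatives up to order four bounded on `[0, T] × ℝ^d`. -/
structure IsSmoothPeriodic (L T : ℝ) (f : ℝ → (Fin d → ℝ) → ℝ) : Prop where
  periodic : ∀ t ∈ Icc 0 T, ∀ k : Fin d, Function.Periodic (f t) (Pi.single k L)
  contDiff : ∀ t ∈ Icc 0 T, ContDiff ℝ 4 (f t)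
  bounded : ∃ R : ℝ, ∀ t ∈ Icc 0 T, ∀ m ≤ 4, ∀ x, ‖iteratedFDeriv ℝ m (f t) x‖ ≤ R

/-- `(Q, u, s)` is a (sufficiently smooth, spatially periodic) solution on `[0, T]` of
`∂ₜ Q - K Δ Q = -g H`, `∂ₜ u + 2 B0 Δ² u = -g μ`, `s' = g (∫ H : ∂ₜ Q + ∫ μ ∂ₜ u)`,
`s = E₁(Q, u)`. -/
structure IsExactSolution (P : Params) (L T : ℝ)
    (Q : ℝ → (Fin d → ℝ) → Matrix (Fin d) (Fin d) ℝ) (u : ℝ → (Fin d → ℝ) → ℝ)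
    (s : ℝ → ℝ) : Prop where
  tensor : ∀ t ∈ Icc 0 T, ∀ x, IsQTensor (Q t x)
  smooth_Q : ∀ i j, IsSmoothPeriodic L T fun t x => Q t x i j
  smooth_u : IsSmoothPeriodic L T u
  eq_Q : ∀ t ∈ Icc 0 T, ∀ x, ∀ i j,
    HasDerivWithinAt (fun r => Q r x i j)
      (P.K * lapC (fun y => Q t y i j) x
        - multC P L (Q t) (u t) (s t) * hC P (Q t) (u t) x i j) (Icc 0 T) t
  eq_u : ∀ t ∈ Icc 0 T, ∀ x,
    HasDerivWithinAt (fun r => u r x)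
      (-(2 * P.B0 * lapC (lapC (u t)) x)
        - multC P L (Q t) (u t) (s t) * muC P (Q t) (u t) x) (Icc 0 T) t
  eq_s : ∀ t ∈ Icc 0 T,
    HasDerivWithinAt s
      (multC P L (Q t) (u t) (s t) *
        ((∫ x in Icc (0 : Fin d → ℝ) (fun _ => L), ∑ i, ∑ j,
            hC P (Q t) (u t) x i j * derivWithin (fun r => Q r x i j) (Icc 0 T) t)
          + ∫ x in Icc (0 : Fin d → ℝ) (fun _ => L),
            muC P (Q t) (u t) x * derivWithin (fun r => u r x) (Icc 0 T) t)) (Icc 0 T) t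
  s_eq : ∀ t ∈ Icc 0 T, s t = energyC P L (Q t) (u t)

/-! ### Periodic grid functions -/

/-- The periodic uniform grid with `J` points per direction. -/
abbrev Grid (d J : ℕ) : Type := Fin d → ZMod J

/-- Periodic scalar grid functions. -/
abbrev GridFn (d J : ℕ) : Type := Grid d J → ℝ

/-- Periodic matrix valued grid functions. -/
abbrev GridTensor (d J : ℕ) : Type := Grid d J → Matrix (Fin d) (Fin d) ℝ

variable {J : ℕ}

/-- The mesh size `h = L / J`. -/
def mesh (L : ℝ) (J : ℕ) : ℝ := L / J

/-- The point of `[0, L)^d` with grid index `p`. -/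
def gridPt (L : ℝ) (p : Grid d J) : Fin d → ℝ := fun k => mesh L J * (p k).val

/-- Restriction of a field to the grid. -/
def gridRestrict {α : Type*} (L : ℝ) (f : (Fin d → ℝ) → α) : Grid d J → α := fun p => f (gridPt L p)

/-- The `(i, j)` component of a matrix valued grid function. -/
def entry (Φ : GridTensor d J) (i j : Fin d) : GridFn d J := fun p => Φ p i j

/-- Forward difference. -/
def dFwd (h : ℝ) (k : Fin d) : GridFn d J →ₗ[ℝ] GridFn d J where
  toFun U := fun p => (U (p + Pi.single k 1) - U p) / h
  map_add' U V := by funext p; simp only [Pi.add_apply]; ring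
  map_smul' r U := by funext p; simp only [Pi.smul_apply, smul_eq_mul, RingHom.id_apply]; ring

/-- Backward difference. -/
def dBwd (h : ℝ) (k : Fin d) : GridFn d J →ₗ[ℝ] GridFn d J where
  toFun U := fun p => (U p - U (p - Pi.single k 1)) / h
  map_add' U V := by funext p; simp only [Pi.add_apply]; ring
  map_smul' r U := by funext p; simp only [Pi.smul_apply, smul_eq_mul, RingHom.id_apply]; ring

/-- Central difference. -/
def dCtr (h : ℝ) (k : Fin d) : GridFn d J →ₗ[ℝ] GridFn d J where
  toFun U := fun p => (U (p + Pi.single k 1) - U (p - Pi.single k 1)) / (2 * h)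
  map_add' U V := by funext p; simp only [Pi.add_apply]; ring
  map_smul' r U := by funext p; simp only [Pi.smul_apply, smul_eq_mul, RingHom.id_apply]; ring

/-- The discrete Laplacian. -/
def lapH (h : ℝ) : GridFn d J →ₗ[ℝ] GridFn d J := ∑ k, dFwd h k ∘ₗ dBwd h k

/-- The discrete Hessian, by central differences. -/
def hessH (h : ℝ) (U : GridFn d J) : GridTensor d J :=
  fun p => Matrix.of fun k l => dCtr h k (dCtr h l U) p

/-- The discrete double divergence of `M u`; it is the adjoint of the discrete Hessian. -/
def divDivH (P : Params) (h : ℝ) (Q : GridTensor d J) (u : GridFn d J) : GridFn d J :=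
  fun p => ∑ k, ∑ l, dCtr h k (dCtr h l fun r => mTensor P (Q r) k l * u r) p

section Norms

variable [NeZero J]

/-- The discrete `l²` inner product of scalar grid functions. -/
def innerH (h : ℝ) (U V : GridFn d J) : ℝ := h ^ d * ∑ p, U p * V p

/-- The discrete `l²` inner product of matrix valued grid functions. -/
def innerHT (h : ℝ) (Φ Ψ : GridTensor d J) : ℝ := ∑ i, ∑ j, innerH h (entry Φ i j) (entry Ψ i j)

/-- Squared discrete `l²` norm. -/
def l2Sq (h : ℝ) (U : GridFn d J) : ℝ := innerH h U U

/-- Squared discrete `H¹` norm. -/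
def h1Sq (h : ℝ) (U : GridFn d J) : ℝ := l2Sq h U + ∑ k, l2Sq h (dFwd h k U)

/-- Squared discrete `H²` norm. -/
def h2Sq (h : ℝ) (U : GridFn d J) : ℝ := h1Sq h U + l2Sq h (lapH h U)

/-- Discrete `l²` norm. -/
def normL2 (h : ℝ) (U : GridFn d J) : ℝ := √(l2Sq h U)

/-- Discrete `H²` norm. -/
def normH2 (h : ℝ) (U : GridFn d J) : ℝ := √(h2Sq h U)

/-- Discrete `l²` norm of a matrix valued grid function. -/
def normL2T (h : ℝ) (Φ : GridTensor d J) : ℝ := √(∑ i, ∑ j, l2Sq h (entry Φ i j))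

/-- Discrete `H¹` norm of a matrix valued grid function. -/
def normH1T (h : ℝ) (Φ : GridTensor d J) : ℝ := √(∑ i, ∑ j, h1Sq h (entry Φ i j))

/-- Discrete `H²` norm of a matrix valued grid function. -/
def normH2T (h : ℝ) (Φ : GridTensor d J) : ℝ := √(∑ i, ∑ j, h2Sq h (entry Φ i j))

/-! ### The discrete nonlinear terms -/

/-- The discrete nonlinear energy `E₁ₕ`. -/
def energyH (P : Params) (h : ℝ) (Q : GridTensor d J) (u : GridFn d J) : ℝ :=
  innerH h (fun p => energyDensity P (Q p) (u p) (hessH h u p)) 1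

/-- The discrete multiplier `g = exp s / exp E₁ₕ`. -/
def multH (P : Params) (h : ℝ) (Q : GridTensor d J) (u : GridFn d J) (s : ℝ) : ℝ :=
  Real.exp s / Real.exp (energyH P h Q u)

/-- The discrete variation `Hₕ`. -/
def hH (P : Params) (h : ℝ) (Q : GridTensor d J) (u : GridFn d J) : GridTensor d J :=
  fun p => hVar P (Q p) (u p) (hessH h u p)

/-- The discrete variation `μₕ`. -/
def muH (P : Params) (h : ℝ) (Q : GridTensor d J) (u : GridFn d J) : GridFn d J :=
  fun p => muVar P (Q p) (u p) (hessH h u p) (divDivH P h Q u p)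

/-- The discrete nonlinear term of the `Q`-equation, `-g Hₕ + g κ1 Q`. -/
def nonlinQH (P : Params) (h : ℝ) (Q : GridTensor d J) (u : GridFn d J) (s : ℝ) :
    GridTensor d J :=
  fun p => -(multH P h Q u s • hH P h Q u p) + (multH P h Q u s * P.κ1) • Q p

/-- The discrete nonlinear term of the `u`-equation, `-g μₕ + g κ2 u`. -/
def nonlinUH (P : Params) (h : ℝ) (Q : GridTensor d J) (u : GridFn d J) (s : ℝ) : GridFn d J :=
  fun p => -(multH P h Q u s * muH P h Q u p) + multH P h Q u s * P.κ2 * u p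

/-! ### The scheme -/

/-- The operator `-K Δₕ + g κ1`; on matrix valued grid functions it acts componentwise. -/
def opL (P : Params) (h g : ℝ) : GridFn d J →ₗ[ℝ] GridFn d J :=
  -(P.K • lapH h) + (g * P.κ1) • LinearMap.id

/-- The operator `2 B0 Δₕ² + g κ2`. -/
def opD (P : Params) (h g : ℝ) : GridFn d J →ₗ[ℝ] GridFn d J :=
  (2 * P.B0) • (lapH h ∘ₗ lapH h) + (g * P.κ2) • LinearMap.id

/-- `f(S)` for a symmetric operator `S` on grid functions, by the functional calculus of the
symmetric matrix of `S`. -/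
def opFun (f : ℝ → ℝ) (S : GridFn d J →ₗ[ℝ] GridFn d J) : GridFn d J →ₗ[ℝ] GridFn d J :=
  Matrix.toLin' (cfc f (LinearMap.toMatrix' S))

/-- `f(S)` applied to the components of a matrix valued grid function. -/
def opFunT (f : ℝ → ℝ) (S : GridFn d J →ₗ[ℝ] GridFn d J) (Φ : GridTensor d J) : GridTensor d J :=
  fun p => Matrix.of fun i j => opFun f S (entry Φ i j) p

/-- `φ₁(z) = (e^z - 1) / z`. -/
def phi1 (z : ℝ) : ℝ := if z = 0 then 1 else (Real.exp z - 1) / z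

/-- `𝒬₁(z) = z / (e^z - 1) + z / 2`. -/
def calQ1 (z : ℝ) : ℝ := (if z = 0 then 1 else z / (Real.exp z - 1)) + z / 2

/-- The discrete dissipation rate `(1/τ) (⟨𝒬₁(τ 𝓛) δQ, δQ⟩ + ⟨𝒬₁(τ 𝓓) δu, δu⟩)`; here `g` is the
multiplier in `𝓛` and `𝓓`. -/
def dissRate (P : Params) (h τ g : ℝ) (dQ : GridTensor d J) (du : GridFn d J) : ℝ :=
  1 / τ * (innerHT h (opFunT (fun z => calQ1 (τ * z)) (opL P h g) dQ) dQ
    + innerH h (opFun (fun z => calQ1 (τ * z)) (opD P h g) du) du)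

/-- `(Q n, u n, s n)`, `n = 0, 1, 2, …`, is a numerical solution of the relaxed generalized SAV
exponential integrator scheme with mesh size `h`, time step `τ` and relaxation constant `η0`;
`sTil` is the provisional auxiliary variable and `ξ` the relaxation factor. -/
structure IsSchemeSolution (P : Params) (h τ η0 : ℝ) (Q : ℕ → GridTensor d J)
    (u : ℕ → GridFn d J) (s sTil ξ : ℕ → ℝ) : Prop where
  tensor : ∀ n p, IsQTensor (Q n p)
  step_Q : ∀ n, Q (n + 1) =
    opFunT (fun z => Real.exp (-τ * z)) (opL P h (multH P h (Q n) (u n) (s n))) (Q n)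
      + τ • opFunT (fun z => phi1 (-τ * z)) (opL P h (multH P h (Q n) (u n) (s n)))
          (nonlinQH P h (Q n) (u n) (s n))
  step_u : ∀ n, u (n + 1) =
    opFun (fun z => Real.exp (-τ * z)) (opD P h (multH P h (Q n) (u n) (s n))) (u n)
      + τ • opFun (fun z => phi1 (-τ * z)) (opD P h (multH P h (Q n) (u n) (s n)))
          (nonlinUH P h (Q n) (u n) (s n))
  step_sTil : ∀ n, sTil (n + 1) = s n + multH P h (Q n) (u n) (s n) *
    (innerHT h (hH P h (Q n) (u n)) (Q (n + 1) - Q n)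
      + innerH h (muH P h (Q n) (u n)) (u (n + 1) - u n))
  relax_mem : ∀ n, ξ (n + 1) ∈ Icc (0 : ℝ) 1
  relax_eq : ∀ n, s (n + 1) =
    ξ (n + 1) * sTil (n + 1) + (1 - ξ (n + 1)) * energyH P h (Q (n + 1)) (u (n + 1))
  relax_le : ∀ n, s (n + 1) - sTil (n + 1) ≤ η0 * τ *
    dissRate P h τ (multH P h (Q n) (u n) (s n)) (Q (n + 1) - Q n) (u (n + 1) - u n)

end Norms

end SmA

end

open SmA

namespace SmA

/-! ### Calculus of periodic grid functions -/

section GridCalculus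

variable {d J : ℕ} {h : ℝ}

/-! Along the exact solution `s = E₁`, so the exact multiplier is identically one and the discrete
quantities are compared with fixed smooth data. The difficulty is that the numerical state has no
obvious bound: the modified energy `linEnergy + s` is bounded above, but no lower bound on `s` is at
hand. The way out is that `g = exp (s - E₁ₕ)` is small where the state is large. If `linEnergy + s ≤
F`, then `s - E₁ₕ ≤ F - (linEnergy + E₁ₕ)`, and `linEnergy + E₁ₕ` grows at least quadratically in
the `H¹` norm of `Q` and the `H²` norm of `u`. Hence `g` times a power of these norms is bounded
(`exists_multH_mul_pow_le`), and this replaces a bound of the state everywhere.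

Coercivity (`exists_energyDensity_ge`, `exists_energyH_ge`) comes from completing a square with a
small loss: the coupling costs a fraction `θ < 1` of `B₀ |D²u|²` and a small multiple of `|M u|²`,
which the quartic bulk terms absorb. Summation by parts bounds the central Hessian by the discrete
Laplacian with constant one, so `(1 - θ) B₀ ‖Δₕ u‖²` survives.

The upper bound `F` (`exists_energy_bound`) rests on the identity of
`IsSchemeSolution.energy_identity`, which holds because `𝒬₁(z) + z/2` is the reciprocal of `φ₁(-z)`.
If `τ ≤ 1`, the relaxation returns at most the dissipated amount and the modified energy decreases.
If `τ ≥ 1`, at most `T` steps are taken, and a single step maps bounded states to bounded states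
(`exists_step_bound`), because `𝒬₁ ≥ 1` makes the dissipation control the increment.

For the Lipschitz estimates, let `ε` be the size of the errors of `Q` in `H¹` and of `u` in `H²`
plus `h²`. Pointwise expansions of the polynomial densities, the discrete embeddings `H² ⊂ L^∞`
(Fourier transform) and `H¹ ⊂ L⁶` (Loomis–Whitney), and second order consistency bound the errors of
`E₁ₕ` and `Hₕ` by `ε` times a power of `1 + ε`. For `μₕ` the double divergence of `M u` and the
product of the error of `Q` with the Hessian error require the `H²` norm of the error of `Q`. As `1
+ ε` is at most a constant times one plus the norms of the state, the factor `g` in front of `Hₕ`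
and `μₕ` absorbs these powers. For `g - 1` there are two cases: small errors, where the exponential
is Lipschitz, and large errors, where boundedness of `g` suffices (`exists_abs_multH_sub_one_le`).
-/

theorem dBwd_apply (k : Fin d) (U : GridFn d J) (p : Grid d J) :
    dBwd h k U p = dFwd h k U (p - Pi.single k 1) := by
  simp [dBwd, dFwd]

theorem dCtr_apply (k : Fin d) (U : GridFn d J) (p : Grid d J) :
    dCtr h k U p = (1 / 2) * (dFwd h k U p + dFwd h k U (p - Pi.single k 1)) := by
  simp only [dCtr, dFwd, LinearMap.coe_mk, AddHom.coe_mk, sub_add_cancel]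
  rcases eq_or_ne h 0 with rfl | h0
  · simp
  · field_simp; ring

theorem dFwd_comm (k l : Fin d) (U : GridFn d J) :
    dFwd h k (dFwd h l U) = dFwd h l (dFwd h k U) := by
  funext p
  simp only [dFwd, LinearMap.coe_mk, AddHom.coe_mk, add_right_comm p]
  ring

theorem dFwd_dBwd_comm (k l : Fin d) (U : GridFn d J) :
    dFwd h k (dBwd h l U) = dBwd h l (dFwd h k U) := by
  funext p
  simp only [dFwd, dBwd, LinearMap.coe_mk, AddHom.coe_mk, add_sub_right_comm p]
  ring

theorem dFwd_dCtr_comm (k l : Fin d) (U : GridFn d J) :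
    dFwd h k (dCtr h l U) = dCtr h l (dFwd h k U) := by
  funext p
  simp only [dFwd, dCtr, LinearMap.coe_mk, AddHom.coe_mk, add_sub_right_comm p,
    add_right_comm p]
  ring

theorem lapH_apply (U : GridFn d J) : lapH h U = ∑ k, dFwd h k (dBwd h k U) := by
  simp [lapH, LinearMap.sum_apply]

theorem lapH_dFwd (k : Fin d) (U : GridFn d J) : lapH h (dFwd h k U) = dFwd h k (lapH h U) := by
  simp only [lapH_apply, map_sum]
  refine Finset.sum_congr rfl fun l _ => ?_
  rw [← dFwd_dBwd_comm, dFwd_comm]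

variable [NeZero J]

theorem normL2_eq (hh : 0 ≤ h) (U : GridFn d J) :
    normL2 h U = √(h ^ d) * ‖WithLp.toLp 2 U‖ := by
  rw [EuclideanSpace.norm_eq, ← Real.sqrt_mul (by positivity)]
  simp [normL2, l2Sq, innerH, sq]

theorem l2Sq_nonneg (hh : 0 ≤ h) (U : GridFn d J) : 0 ≤ l2Sq h U :=
  mul_nonneg (by positivity) (Finset.sum_nonneg fun _ _ => mul_self_nonneg _)

theorem normL2_nonneg (U : GridFn d J) : 0 ≤ normL2 h U := Real.sqrt_nonneg _

theorem normL2_sq (hh : 0 ≤ h) (U : GridFn d J) : normL2 h U ^ 2 = l2Sq h U :=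
  Real.sq_sqrt (l2Sq_nonneg hh U)

theorem normL2_add_le (hh : 0 ≤ h) (U V : GridFn d J) :
    normL2 h (U + V) ≤ normL2 h U + normL2 h V := by
  simp only [normL2_eq hh, ← mul_add, WithLp.toLp_add]
  exact mul_le_mul_of_nonneg_left (norm_add_le _ _) (Real.sqrt_nonneg _)

theorem normL2_smul (hh : 0 ≤ h) (r : ℝ) (U : GridFn d J) :
    normL2 h (r • U) = |r| * normL2 h U := by
  simp only [normL2_eq hh, WithLp.toLp_smul, norm_smul, Real.norm_eq_abs]
  ring

theorem normL2_zero : normL2 h (0 : GridFn d J) = 0 := by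
  simp [normL2, l2Sq, innerH]

theorem normL2_sum_le (hh : 0 ≤ h) {ι : Type*} (s : Finset ι) (U : ι → GridFn d J) :
    normL2 h (∑ i ∈ s, U i) ≤ ∑ i ∈ s, normL2 h (U i) := by
  classical
  induction s using Finset.induction_on with
  | empty => simp [normL2_zero]
  | insert a s ha ih =>
    rw [Finset.sum_insert ha, Finset.sum_insert ha]
    exact (normL2_add_le hh _ _).trans (by gcongr)

theorem l2Sq_mono (hh : 0 ≤ h) {U V : GridFn d J} (H : ∀ p, |U p| ≤ V p) :
    l2Sq h U ≤ l2Sq h V := by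
  refine mul_le_mul_of_nonneg_left (Finset.sum_le_sum fun p _ => ?_) (by positivity)
  rw [← abs_mul_abs_self (U p)]
  exact mul_self_le_mul_self (abs_nonneg _) (H p)

theorem normL2_mono (hh : 0 ≤ h) {U V : GridFn d J} (H : ∀ p, |U p| ≤ V p) :
    normL2 h U ≤ normL2 h V := Real.sqrt_le_sqrt (l2Sq_mono hh H)

theorem abs_innerH_le (hh : 0 ≤ h) (U V : GridFn d J) :
    |innerH h U V| ≤ normL2 h U * normL2 h V := by
  have := abs_real_inner_le_norm (WithLp.toLp 2 V) (WithLp.toLp 2 U)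
  rw [normL2_eq hh, normL2_eq hh, innerH, abs_mul, abs_of_nonneg (by positivity : 0 ≤ h ^ d)]
  have e : inner ℝ (WithLp.toLp 2 V) (WithLp.toLp 2 U) = ∑ p, U p * V p := by
    simp [PiLp.inner_apply]
  rw [e] at this
  calc h ^ d * |∑ p, U p * V p| ≤ h ^ d * (‖WithLp.toLp 2 V‖ * ‖WithLp.toLp 2 U‖) := by gcongr
    _ = √(h ^ d) * √(h ^ d) * (‖WithLp.toLp 2 V‖ * ‖WithLp.toLp 2 U‖) := by
      rw [Real.mul_self_sqrt (by positivity)]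
    _ = _ := by ring

theorem innerH_comm (U V : GridFn d J) : innerH h U V = innerH h V U := by
  simp [innerH, mul_comm]

theorem innerH_add_left (U V W : GridFn d J) :
    innerH h (U + V) W = innerH h U W + innerH h V W := by
  simp [innerH, add_mul, Finset.sum_add_distrib, mul_add]

theorem innerH_smul_left (r : ℝ) (U W : GridFn d J) :
    innerH h (r • U) W = r * innerH h U W := by
  simp only [innerH, Pi.smul_apply, smul_eq_mul, mul_assoc, ← Finset.mul_sum]; ring

theorem innerH_add_right (U V W : GridFn d J) :
    innerH h W (U + V) = innerH h W U + innerH h W V := by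
  rw [innerH_comm, innerH_add_left, innerH_comm U, innerH_comm V]

theorem innerH_smul_right (r : ℝ) (U W : GridFn d J) :
    innerH h W (r • U) = r * innerH h W U := by
  rw [innerH_comm, innerH_smul_left, innerH_comm]

theorem innerH_sub_left (U V W : GridFn d J) :
    innerH h (U - V) W = innerH h U W - innerH h V W := by
  simp [innerH, sub_mul, Finset.sum_sub_distrib, mul_sub]

theorem innerH_sub_right (U V W : GridFn d J) :
    innerH h W (U - V) = innerH h W U - innerH h W V := by
  rw [innerH_comm, innerH_sub_left, innerH_comm U, innerH_comm V]

theorem innerH_sum_left {ι : Type*} (s : Finset ι) (U : ι → GridFn d J) (W : GridFn d J) :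
    innerH h (∑ i ∈ s, U i) W = ∑ i ∈ s, innerH h (U i) W := by
  simp only [innerH, Finset.sum_apply, Finset.sum_mul, Finset.mul_sum]
  rw [Finset.sum_comm]

theorem innerH_mono (hh : 0 ≤ h) {U V U' V' : GridFn d J} (H : ∀ p, U p * V p ≤ U' p * V' p) :
    innerH h U V ≤ innerH h U' V' :=
  mul_le_mul_of_nonneg_left (Finset.sum_le_sum fun p _ => H p) (by positivity)

theorem innerH_const_one (hL : (J : ℝ) * h = L) (r : ℝ) :
    innerH h (fun _ : Grid d J => r) 1 = L ^ d * r := by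
  simp only [innerH, Pi.one_apply, mul_one, Finset.sum_const, Finset.card_univ, Fintype.card_pi,
    ZMod.card, Finset.prod_const, Fintype.card_fin, nsmul_eq_mul, ← hL]
  push_cast
  ring

/-- Translation of the argument preserves sums over the grid. -/
theorem sum_translate (a : Grid d J) (F : GridFn d J) : ∑ p, F (p + a) = ∑ p, F p :=
  Fintype.sum_equiv (Equiv.addRight a) _ _ fun _ => rfl

theorem l2Sq_translate (a : Grid d J) (U : GridFn d J) :
    l2Sq h (fun p => U (p + a)) = l2Sq h U := by
  simp only [l2Sq, innerH]
  rw [sum_translate a fun p => U p * U p]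

theorem normL2_translate (a : Grid d J) (U : GridFn d J) :
    normL2 h (fun p => U (p + a)) = normL2 h U := by
  simp only [normL2, l2Sq_translate]

theorem normL2_le_of_abs_le (hh : 0 ≤ h) (hL : (J : ℝ) * h = L) {U : GridFn d J} {r : ℝ}
    (H : ∀ p, |U p| ≤ r) : normL2 h U ≤ r * √(L ^ d) := by
  have hr : 0 ≤ r := (abs_nonneg _).trans (H 0)
  have : l2Sq h U ≤ L ^ d * (r * r) := by
    rw [← innerH_const_one hL]
    refine innerH_mono hh fun p => ?_
    rw [← abs_mul_abs_self (U p), Pi.one_apply, mul_one]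
    exact mul_self_le_mul_self (abs_nonneg _) (H p)
  rw [normL2]
  calc √(l2Sq h U) ≤ √(L ^ d * (r * r)) := Real.sqrt_le_sqrt this
    _ = r * √(L ^ d) := by
      rw [Real.sqrt_mul (by rw [← hL]; positivity), Real.sqrt_mul_self hr, mul_comm]

theorem normL2_mul_le (hh : 0 ≤ h) {U V : GridFn d J} {r : ℝ} (H : ∀ p, |U p| ≤ r) :
    normL2 h (U * V) ≤ r * normL2 h V := by
  have hr : 0 ≤ r := (abs_nonneg _).trans (H 0)
  have e : normL2 h (r • fun p => |V p|) = r * normL2 h V := by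
    rw [normL2_smul hh, abs_of_nonneg hr]
    simp [normL2, l2Sq, innerH]
  rw [← e]
  refine normL2_mono hh fun p => ?_
  simp only [Pi.mul_apply, abs_mul, Pi.smul_apply, smul_eq_mul]
  gcongr
  exact H p

theorem normL2_abs (U : GridFn d J) : normL2 h (fun p => |U p|) = normL2 h U := by
  simp [normL2, l2Sq, innerH]

/-! #### Difference operators -/

theorem innerH_dFwd (k : Fin d) (U V : GridFn d J) :
    innerH h (dFwd h k U) V = -innerH h U (dBwd h k V) := by
  have e : ∑ p, U (p + Pi.single k 1) / h * V p
      = ∑ p, U p / h * V (p - Pi.single k 1) := by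
    refine Eq.trans ?_ (sum_translate (Pi.single k 1) fun p => U p / h * V (p - Pi.single k 1))
    simp
  have : ∑ p, dFwd h k U p * V p = -∑ p, U p * dBwd h k V p := by
    simp only [dFwd, dBwd, LinearMap.coe_mk, AddHom.coe_mk, sub_div, sub_mul, mul_sub,
      Finset.sum_sub_distrib, e, neg_sub]
    congr 1 <;> exact Finset.sum_congr rfl fun p _ => by ring
  simp only [innerH, this, mul_neg]

theorem innerH_dCtr (k : Fin d) (U V : GridFn d J) :
    innerH h (dCtr h k U) V = -innerH h U (dCtr h k V) := by
  have e : ∑ p, U (p + Pi.single k 1) / (2 * h) * V p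
      = ∑ p, U p / (2 * h) * V (p - Pi.single k 1) := by
    refine Eq.trans ?_ (sum_translate (Pi.single k 1)
      fun p => U p / (2 * h) * V (p - Pi.single k 1))
    simp
  have e' : ∑ p, U p / (2 * h) * V (p + Pi.single k 1)
      = ∑ p, U (p - Pi.single k 1) / (2 * h) * V p := by
    refine Eq.trans ?_ (sum_translate (Pi.single k 1)
      fun p => U (p - Pi.single k 1) / (2 * h) * V p)
    simp
  have : ∑ p, dCtr h k U p * V p = -∑ p, U p * dCtr h k V p := by
    simp only [dCtr, LinearMap.coe_mk, AddHom.coe_mk, sub_div, sub_mul, mul_sub,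
      Finset.sum_sub_distrib, e, neg_sub, ← e']
    congr 1 <;> exact Finset.sum_congr rfl fun p _ => by ring
  simp only [innerH, this, mul_neg]

/-- A backward difference is a translated forward difference, and sums over the periodic grid ignore
translations; so summation by parts pairs forward differences with forward differences. -/
theorem innerH_lapH (U V : GridFn d J) :
    innerH h (lapH h U) V = -∑ k, innerH h (dFwd h k U) (dFwd h k V) := by
  rw [lapH_apply, innerH_sum_left, ← Finset.sum_neg_distrib]
  refine Finset.sum_congr rfl fun k _ => ?_
  rw [innerH_dFwd]
  simp only [innerH, dBwd_apply]
  congr 2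
  refine (sum_translate (Pi.single k 1) fun p =>
    dFwd h k U (p - Pi.single k 1) * dFwd h k V (p - Pi.single k 1)).symm.trans ?_
  simp

theorem innerH_lapH_comm (U V : GridFn d J) :
    innerH h (lapH h U) V = innerH h U (lapH h V) := by
  rw [innerH_lapH, innerH_comm U, innerH_lapH]
  simp only [innerH_comm]

/-- Two summations by parts, with no boundary terms and commuting differences. This is the discrete
form of the equality of the `L²` norms of Hessian and Laplacian on the torus; it lets the Laplacian
in the `H²` norm control all mixed differences. -/
theorem sum_l2Sq_dFwd_dFwd (U : GridFn d J) :
    ∑ k, ∑ l, l2Sq h (dFwd h k (dFwd h l U)) = l2Sq h (lapH h U) := by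
  have : l2Sq h (lapH h U) = -∑ l, innerH h (dFwd h l U) (dFwd h l (lapH h U)) := by
    rw [l2Sq, innerH_lapH]
  rw [this, Finset.sum_comm, ← Finset.sum_neg_distrib]
  refine Finset.sum_congr rfl fun l _ => ?_
  rw [← lapH_dFwd, innerH_comm, innerH_lapH, neg_neg]
  rfl

theorem l2Sq_dFwd_dFwd_le (hh : 0 ≤ h) (k l : Fin d) (U : GridFn d J) :
    l2Sq h (dFwd h k (dFwd h l U)) ≤ l2Sq h (lapH h U) := by
  rw [← sum_l2Sq_dFwd_dFwd]
  exact (Finset.single_le_sum (f := fun l => l2Sq h (dFwd h k (dFwd h l U)))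
    (fun _ _ => l2Sq_nonneg hh _) (Finset.mem_univ l)).trans
    (Finset.single_le_sum (f := fun k => ∑ l, l2Sq h (dFwd h k (dFwd h l U)))
    (fun _ _ => Finset.sum_nonneg fun _ _ => l2Sq_nonneg hh _) (Finset.mem_univ k))

/-- A central difference is the mean of a forward difference and its translate, and translations
preserve the norm. -/
theorem l2Sq_dCtr_le (hh : 0 ≤ h) (k : Fin d) (U : GridFn d J) :
    l2Sq h (dCtr h k U) ≤ l2Sq h (dFwd h k U) := by
  have e : dCtr h k U = (1 / 2 : ℝ) • (dFwd h k U + fun p => dFwd h k U (p + -Pi.single k 1)) := by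
    funext p
    simp [dCtr_apply, sub_eq_add_neg]
  have : normL2 h (dCtr h k U) ≤ normL2 h (dFwd h k U) := by
    rw [e, normL2_smul hh]
    have := normL2_add_le hh (dFwd h k U) fun p => dFwd h k U (p + -Pi.single k 1)
    rw [normL2_translate] at this
    rw [abs_of_pos (by norm_num)]
    linarith
  rw [← normL2_sq hh, ← normL2_sq hh]
  exact pow_le_pow_left₀ (normL2_nonneg _) this 2

theorem l2Sq_dCtr_dCtr_le (hh : 0 ≤ h) (k l : Fin d) (U : GridFn d J) :
    l2Sq h (dCtr h k (dCtr h l U)) ≤ l2Sq h (dFwd h k (dFwd h l U)) := by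
  refine (l2Sq_dCtr_le hh _ _).trans ?_
  rw [dFwd_dCtr_comm, dFwd_comm k l]
  exact l2Sq_dCtr_le hh _ _

/-- The constant one matters: it lets the term `B₀ ‖Δₕ u‖²` of the linear energy pay for the part `θ
B₀ |Dₕ² u|²`, `θ < 1`, lost in the nonlinear energy. -/
theorem sum_l2Sq_dCtr_dCtr_le (hh : 0 ≤ h) (U : GridFn d J) :
    ∑ k, ∑ l, l2Sq h (dCtr h k (dCtr h l U)) ≤ l2Sq h (lapH h U) := by
  rw [← sum_l2Sq_dFwd_dFwd]
  exact Finset.sum_le_sum fun k _ => Finset.sum_le_sum fun l _ => l2Sq_dCtr_dCtr_le hh k l U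

theorem normL2_dCtr_dCtr_le (hh : 0 ≤ h) (k l : Fin d) (U : GridFn d J) :
    normL2 h (dCtr h k (dCtr h l U)) ≤ normL2 h (lapH h U) :=
  Real.sqrt_le_sqrt ((l2Sq_dCtr_dCtr_le hh k l U).trans (l2Sq_dFwd_dFwd_le hh k l U))

/-- Interpolation: the squared gradient norm is the pairing of `U` with `-Δₕ U`, to which
Cauchy–Schwarz and Young apply. -/
theorem sum_l2Sq_dFwd_le (hh : 0 ≤ h) (U : GridFn d J) :
    ∑ k, l2Sq h (dFwd h k U) ≤ (l2Sq h U + l2Sq h (lapH h U)) / 2 := by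
  have e : ∑ k, l2Sq h (dFwd h k U) = -innerH h (lapH h U) U := by
    rw [innerH_lapH, neg_neg]; rfl
  have h1 := (neg_le_abs _).trans (abs_innerH_le hh (lapH h U) U)
  have h2 := two_mul_le_add_sq (normL2 h (lapH h U)) (normL2 h U)
  rw [normL2_sq hh, normL2_sq hh] at h2
  linarith

/-! #### Discrete Sobolev norms -/

/-- Discrete `H¹` norm of a scalar grid function. -/
noncomputable def normH1 (h : ℝ) (U : GridFn d J) : ℝ := √(h1Sq h U)

theorem h1Sq_nonneg (hh : 0 ≤ h) (U : GridFn d J) : 0 ≤ h1Sq h U :=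
  add_nonneg (l2Sq_nonneg hh _) (Finset.sum_nonneg fun _ _ => l2Sq_nonneg hh _)

theorem h2Sq_nonneg (hh : 0 ≤ h) (U : GridFn d J) : 0 ≤ h2Sq h U :=
  add_nonneg (h1Sq_nonneg hh _) (l2Sq_nonneg hh _)

theorem normH1_nonneg (U : GridFn d J) : 0 ≤ normH1 h U := Real.sqrt_nonneg _

theorem normH2_nonneg (U : GridFn d J) : 0 ≤ normH2 h U := Real.sqrt_nonneg _

theorem normL2_le_normH1 (hh : 0 ≤ h) (U : GridFn d J) : normL2 h U ≤ normH1 h U :=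
  Real.sqrt_le_sqrt (le_add_of_nonneg_right (Finset.sum_nonneg fun _ _ => l2Sq_nonneg hh _))

theorem normH1_le_normH2 (hh : 0 ≤ h) (U : GridFn d J) : normH1 h U ≤ normH2 h U :=
  Real.sqrt_le_sqrt (le_add_of_nonneg_right (l2Sq_nonneg hh _))

theorem normL2_dFwd_le_normH1 (hh : 0 ≤ h) (k : Fin d) (U : GridFn d J) :
    normL2 h (dFwd h k U) ≤ normH1 h U :=
  Real.sqrt_le_sqrt ((Finset.single_le_sum (f := fun k => l2Sq h (dFwd h k U))
    (fun _ _ => l2Sq_nonneg hh _) (Finset.mem_univ k)).trans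
    (le_add_of_nonneg_left (l2Sq_nonneg hh _)))

theorem normL2_lapH_le_normH2 (hh : 0 ≤ h) (U : GridFn d J) :
    normL2 h (lapH h U) ≤ normH2 h U :=
  Real.sqrt_le_sqrt (le_add_of_nonneg_left (h1Sq_nonneg hh _))

theorem normL2_dCtr_dCtr_le_normH2 (hh : 0 ≤ h) (k l : Fin d) (U : GridFn d J) :
    normL2 h (dCtr h k (dCtr h l U)) ≤ normH2 h U :=
  (normL2_dCtr_dCtr_le hh k l U).trans (normL2_lapH_le_normH2 hh U)

theorem normH1_le_sum (hh : 0 ≤ h) (U : GridFn d J) :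
    normH1 h U ≤ normL2 h U + ∑ k, normL2 h (dFwd h k U) := by
  have n0 := normL2_nonneg (h := h) U
  have n1 : 0 ≤ ∑ k, normL2 h (dFwd h k U) := Finset.sum_nonneg fun k _ => normL2_nonneg _
  refine Real.sqrt_le_iff.2 ⟨by positivity, ?_⟩
  have : ∑ k, l2Sq h (dFwd h k U) ≤ (∑ k, normL2 h (dFwd h k U)) ^ 2 := by
    simp only [← normL2_sq hh]
    exact Finset.sum_sq_le_sq_sum_of_nonneg fun k _ => normL2_nonneg _
  rw [h1Sq, ← normL2_sq hh]
  nlinarith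

theorem normH2_le_add (hh : 0 ≤ h) (U : GridFn d J) :
    normH2 h U ≤ normH1 h U + normL2 h (lapH h U) := by
  have n0 := normL2_nonneg (h := h) (lapH h U)
  have n1 := normH1_nonneg (h := h) U
  refine Real.sqrt_le_iff.2 ⟨by positivity, ?_⟩
  rw [h2Sq, ← normL2_sq hh, ← Real.sq_sqrt (h1Sq_nonneg hh U)]
  change normH1 h U ^ 2 + _ ≤ _
  nlinarith

/-- A map between grid functions that does not increase `l²` norms and commutes with forward
differences up to further maps of this kind does not increase `H¹` norms. -/
theorem normH1_le_of_l2 (hh : 0 ≤ h) {U V : GridFn d J} (h0 : normL2 h U ≤ normL2 h V)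
    (h1 : ∀ k, normL2 h (dFwd h k U) ≤ normL2 h (dFwd h k V)) : normH1 h U ≤ normH1 h V := by
  refine Real.sqrt_le_sqrt (add_le_add ?_ (Finset.sum_le_sum fun k _ => ?_))
  · rw [← normL2_sq hh, ← normL2_sq hh]; exact pow_le_pow_left₀ (normL2_nonneg _) h0 2
  · rw [← normL2_sq hh, ← normL2_sq hh]; exact pow_le_pow_left₀ (normL2_nonneg _) (h1 k) 2

theorem normH1_entry_le (hh : 0 ≤ h) (Φ : GridTensor d J) (i j : Fin d) :
    normH1 h (entry Φ i j) ≤ normH1T h Φ :=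
  Real.sqrt_le_sqrt ((Finset.single_le_sum (f := fun j => h1Sq h (entry Φ i j))
    (fun _ _ => h1Sq_nonneg hh _) (Finset.mem_univ j)).trans
    (Finset.single_le_sum (f := fun i => ∑ j, h1Sq h (entry Φ i j))
    (fun _ _ => Finset.sum_nonneg fun _ _ => h1Sq_nonneg hh _) (Finset.mem_univ i)))

theorem normH2_entry_le (hh : 0 ≤ h) (Φ : GridTensor d J) (i j : Fin d) :
    normH2 h (entry Φ i j) ≤ normH2T h Φ :=
  Real.sqrt_le_sqrt ((Finset.single_le_sum (f := fun j => h2Sq h (entry Φ i j))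
    (fun _ _ => h2Sq_nonneg hh _) (Finset.mem_univ j)).trans
    (Finset.single_le_sum (f := fun i => ∑ j, h2Sq h (entry Φ i j))
    (fun _ _ => Finset.sum_nonneg fun _ _ => h2Sq_nonneg hh _) (Finset.mem_univ i)))

theorem normH1T_le_normH2T (hh : 0 ≤ h) (Φ : GridTensor d J) : normH1T h Φ ≤ normH2T h Φ :=
  Real.sqrt_le_sqrt (Finset.sum_le_sum fun _ _ => Finset.sum_le_sum fun _ _ =>
    le_add_of_nonneg_right (l2Sq_nonneg hh _))

theorem normL2T_le_of_entry_le (hh : 0 ≤ h) {Φ : GridTensor d J} {r : ℝ}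
    (H : ∀ i j, normL2 h (entry Φ i j) ≤ r) : normL2T h Φ ≤ d * r := by
  rcases Nat.eq_zero_or_pos d with rfl | hd
  · simp [normL2T]
  have hr : 0 ≤ r := (normL2_nonneg _).trans (H ⟨0, hd⟩ ⟨0, hd⟩)
  refine Real.sqrt_le_iff.2 ⟨by positivity, ?_⟩
  calc ∑ i, ∑ j, l2Sq h (entry Φ i j) ≤ ∑ _i : Fin d, ∑ _j : Fin d, r ^ 2 := by
        gcongr with i _ j _
        rw [← normL2_sq hh]
        exact pow_le_pow_left₀ (normL2_nonneg _) (H i j) 2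
    _ = (d * r) ^ 2 := by simp; ring

end GridCalculus

/-! ### The exponential integrator step -/

section ExponentialStep

/-- Away from zero `𝒬₁(w) = (w/2) coth (w/2)`. The difference to one is a quotient whose numerator
and denominator vanish at zero and share the sign of `w`. Being valid for every real `w`, the bound
needs no sign of the operators to which it is applied. -/
theorem one_le_calQ1 (w : ℝ) : 1 ≤ calQ1 w := by
  have mono : Monotone fun x : ℝ => x * (Real.exp x + 1) - 2 * (Real.exp x - 1) := by
    refine monotone_of_deriv_nonneg (by fun_prop) fun x => ?_
    have hd : HasDerivAt (fun x : ℝ => x * (Real.exp x + 1) - 2 * (Real.exp x - 1))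
        (1 * (Real.exp x + 1) + x * Real.exp x - 2 * Real.exp x) x :=
      ((hasDerivAt_id x).mul ((Real.hasDerivAt_exp x).add_const 1)).sub
        (((Real.hasDerivAt_exp x).sub_const 1).const_mul 2)
    rw [hd.deriv]
    have h1 := Real.add_one_le_exp (-x)
    have h2 : Real.exp (-x) * Real.exp x = 1 := by rw [← Real.exp_add]; simp
    nlinarith [Real.exp_pos x]
  rcases lt_trichotomy w 0 with hw | rfl | hw
  · have h1 := mono hw.le
    have h2 : Real.exp w - 1 < 0 := by linarith [Real.exp_lt_one_iff.2 hw]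
    have e : calQ1 w = 1 + (w * (Real.exp w + 1) - 2 * (Real.exp w - 1))
        / (2 * (Real.exp w - 1)) := by
      rw [calQ1, if_neg hw.ne]
      field_simp [h2.ne]
      ring
    simp only [zero_mul, Real.exp_zero, sub_self, mul_zero] at h1
    rw [e, le_add_iff_nonneg_right]
    exact div_nonneg_of_nonpos h1 (by linarith)
  · simp [calQ1]
  · have h1 := mono hw.le
    have h2 : 0 < Real.exp w - 1 := by linarith [Real.one_lt_exp_iff.2 hw]
    have e : calQ1 w = 1 + (w * (Real.exp w + 1) - 2 * (Real.exp w - 1))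
        / (2 * (Real.exp w - 1)) := by
      rw [calQ1, if_neg hw.ne']
      field_simp [h2.ne']
      ring
    simp only [zero_mul, Real.exp_zero, sub_self, mul_zero] at h1
    rw [e, le_add_iff_nonneg_right]
    exact div_nonneg h1 (by linarith)

/-- Adding `w/2` to `𝒬₁(w)` turns `w/(e^w - 1)` into `w/(1 - e^{-w})`, the reciprocal of `φ₁(-w)`.
This relation produces the energy identity. -/
theorem calQ1_add_mul_phi1 (w : ℝ) : (calQ1 w + w / 2) * phi1 (-w) = 1 := by
  rcases eq_or_ne w 0 with rfl | hw
  · simp [calQ1, phi1]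
  · have h1 : Real.exp w - 1 ≠ 0 := by
      rw [sub_ne_zero]; exact mt (Real.exp_eq_one_iff w).1 hw
    rw [calQ1, phi1, if_neg hw, if_neg (neg_ne_zero.2 hw), Real.exp_neg]
    have := (Real.exp_pos w).ne'
    field_simp
    ring

theorem exp_neg_eq_phi1 (w : ℝ) : Real.exp (-w) = 1 - w * phi1 (-w) := by
  rcases eq_or_ne w 0 with rfl | hw
  · simp
  · rw [phi1, if_neg (neg_ne_zero.2 hw)]
    field_simp
    ring

variable {d J : ℕ} [NeZero J] {h τ : ℝ} {S : GridFn d J →ₗ[ℝ] GridFn d J}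

theorem isSelfAdjoint_toMatrix (hh : 0 < h)
    (hS : ∀ U V, innerH h (S U) V = innerH h U (S V)) :
    IsSelfAdjoint (LinearMap.toMatrix' S) := by
  ext p r
  have := hS (Pi.single p 1) (Pi.single r 1)
  simp only [innerH, Pi.single_apply, mul_ite, ite_mul, mul_one, one_mul, mul_zero, zero_mul,
    Finset.sum_ite_eq', Finset.mem_univ, if_true] at this
  have h0 : h ^ d ≠ 0 := by positivity
  have := mul_left_cancel₀ h0 this
  simpa [Matrix.star_apply, LinearMap.toMatrix'_apply, Pi.single_apply] using this

/-- The spectrum is finite, so the functional calculus applies to arbitrary functions and the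
continuity side conditions are vacuous. -/
theorem continuousOn_spectrum {n : Type*} [Fintype n] [DecidableEq n] (A : Matrix n n ℝ)
    (f : ℝ → ℝ) : ContinuousOn f (spectrum ℝ A) :=
  (Matrix.finite_real_spectrum (A := A)).continuousOn f

/-- The increment of one exponential integrator step, written with `𝒬₁`. -/
theorem exponential_step_identity
    (hA : IsSelfAdjoint (LinearMap.toMatrix' S)) {U N U' : GridFn d J}
    (hU' : U' = opFun (fun z => Real.exp (-τ * z)) S U
      + τ • opFun (fun z => phi1 (-τ * z)) S N) :
    τ • (N - S U) = opFun (fun z => calQ1 (τ * z)) S (U' - U) + (τ / 2) • S (U' - U) := by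
  set A := LinearMap.toMatrix' S with hAdef
  have hc := continuousOn_spectrum A
  have hSv : ∀ V, S V = A.mulVec V := fun V => by
    rw [hAdef, LinearMap.toMatrix'_mulVec]
  have e1 : cfc (fun z => Real.exp (-τ * z)) A
      = 1 - τ • (cfc (fun z => phi1 (-τ * z)) A * A) := by
    have : (fun z => Real.exp (-τ * z)) = fun z => 1 - τ • (phi1 (-τ * z) * z) := by
      funext z
      have := exp_neg_eq_phi1 (τ * z)
      rw [← neg_mul] at this
      rw [this, smul_eq_mul]; ring
    rw [this, cfc_sub _ _ A (hc _) (hc _), cfc_const_one ℝ A, cfc_smul _ _ A (hc _),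
      cfc_mul _ _ A (hc _) (hc _), cfc_id' ℝ A]
  -- On the operator level `𝒬₁(τS) + τS/2` inverts `φ₁(-τS)`.
  have e2 : (cfc (fun z => calQ1 (τ * z)) A + (τ / 2) • A) * cfc (fun z => phi1 (-τ * z)) A
      = 1 := by
    have e3 : cfc (fun z : ℝ => (τ / 2) • z) A = (τ / 2) • A := by
      rw [cfc_smul _ _ A (hc _), cfc_id' ℝ A]
    rw [← e3, ← cfc_add A _ _ (hc _) (hc _), ← cfc_mul _ _ A (hc _) (hc _), ← cfc_const_one ℝ A]
    congr 1
    funext z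
    have := calQ1_add_mul_phi1 (τ * z)
    rw [← neg_mul] at this
    rw [← this, smul_eq_mul]; ring
  -- Replacing the exponential by `1 - τ φ₁(-τS) S` puts the whole increment behind `φ₁`, which is
  -- then inverted by `e2`.
  have e4 : U' - U = τ • (cfc (fun z => phi1 (-τ * z)) A).mulVec (N - S U) := by
    rw [hU', opFun, opFun, Matrix.toLin'_apply, Matrix.toLin'_apply, ← hAdef, e1,
      Matrix.sub_mulVec, Matrix.one_mulVec, Matrix.smul_mulVec, Matrix.mulVec_sub, hSv,
      Matrix.mulVec_mulVec, smul_sub]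
    abel
  have e5 : opFun (fun z => calQ1 (τ * z)) S (U' - U) + (τ / 2) • S (U' - U)
      = (cfc (fun z => calQ1 (τ * z)) A + (τ / 2) • A).mulVec (U' - U) := by
    rw [opFun, Matrix.toLin'_apply, ← hAdef, hSv, Matrix.add_mulVec, Matrix.smul_mulVec]
  rw [e5, e4, Matrix.mulVec_smul, Matrix.mulVec_mulVec, e2, Matrix.one_mulVec]

/-- Write `f = 1 + (√(f - 1))²`. The functional calculus turns the second summand into the square of
a symmetric matrix, whose quadratic form is a sum of squares. -/
theorem l2Sq_le_innerH_opFun (hh : 0 < h) (hA : IsSelfAdjoint (LinearMap.toMatrix' S))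
    {f : ℝ → ℝ} (hf : ∀ z, 1 ≤ f z) (V : GridFn d J) :
    l2Sq h V ≤ innerH h (opFun f S V) V := by
  set A := LinearMap.toMatrix' S with hAdef
  have hc := continuousOn_spectrum A
  set B := cfc (fun z => √(f z - 1)) A with hB
  have e : cfc f A = 1 + B * B := by
    have : f = fun z => 1 + √(f z - 1) * √(f z - 1) := by
      funext z
      rw [Real.mul_self_sqrt (by linarith [hf z])]; ring
    conv_lhs => rw [this]
    rw [cfc_add A _ _ (hc _) (hc _), cfc_const_one ℝ A, cfc_mul _ _ A (hc _) (hc _)]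
  have hBs : B.transpose = B := by
    have : IsSelfAdjoint B := cfc_predicate _ A
    simpa [IsSelfAdjoint, Matrix.star_eq_conjTranspose, Matrix.conjTranspose_eq_transpose_of_trivial]
      using this
  have e2 : opFun f S V = V + B.mulVec (B.mulVec V) := by
    rw [opFun, Matrix.toLin'_apply, ← hAdef, e, Matrix.add_mulVec, Matrix.one_mulVec,
      Matrix.mulVec_mulVec]
  have e3 : innerH h (B.mulVec (B.mulVec V)) V = l2Sq h (B.mulVec V) := by
    have : B.mulVec (B.mulVec V) ⬝ᵥ V = B.mulVec V ⬝ᵥ B.mulVec V := by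
      rw [Matrix.dotProduct_mulVec (B.mulVec V), ← Matrix.mulVec_transpose, hBs]
    simp only [innerH, l2Sq]
    exact congrArg _ this
  rw [e2, innerH_add_left, e3]
  have := l2Sq_nonneg hh.le (B.mulVec V)
  change innerH h V V ≤ _
  linarith

theorem opL_selfAdjoint (P : Params) (hh : 0 < h) (g : ℝ) :
    IsSelfAdjoint (LinearMap.toMatrix' (opL (d := d) (J := J) P h g)) := by
  refine isSelfAdjoint_toMatrix hh fun U V => ?_
  simp only [opL, LinearMap.add_apply, LinearMap.neg_apply, LinearMap.smul_apply,
    LinearMap.id_apply, ← neg_smul, innerH_add_left, innerH_add_right, innerH_smul_left,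
    innerH_smul_right, innerH_lapH_comm]

theorem opD_selfAdjoint (P : Params) (hh : 0 < h) (g : ℝ) :
    IsSelfAdjoint (LinearMap.toMatrix' (opD (d := d) (J := J) P h g)) := by
  refine isSelfAdjoint_toMatrix hh fun U V => ?_
  simp only [opD, LinearMap.add_apply, LinearMap.smul_apply, LinearMap.comp_apply,
    LinearMap.id_apply, innerH_add_left, innerH_add_right, innerH_smul_left,
    innerH_smul_right, innerH_lapH_comm]

end ExponentialStep

/-! ### The dissipation identity -/

section Dissipation

variable {d J : ℕ} {h τ g : ℝ} {P : Params}

theorem opL_apply (V : GridFn d J) :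
    opL P h g V = (-P.K) • lapH h V + (g * P.κ1) • V := by
  simp [opL]

theorem opD_apply (V : GridFn d J) :
    opD P h g V = (2 * P.B0) • lapH h (lapH h V) + (g * P.κ2) • V := by
  simp [opD]

variable [NeZero J]

/-- Pairing of the variation with the increment, for a component of the `Q`-equation. -/
theorem innerH_step_opL (hh : 0 < h) (hτ : 0 < τ) {U H U' : GridFn d J}
    (hU' : U' = opFun (fun z => Real.exp (-τ * z)) (opL P h g) U
      + τ • opFun (fun z => phi1 (-τ * z)) (opL P h g) (-(g • H) + (g * P.κ1) • U)) :
    g * innerH h H (U' - U)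
      = -(1 / τ * innerH h (opFun (fun z => calQ1 (τ * z)) (opL P h g) (U' - U)) (U' - U))
        - P.K * ∑ k, innerH h (dFwd h k U) (dFwd h k (U' - U))
        - P.K / 2 * ∑ k, l2Sq h (dFwd h k (U' - U)) - g * P.κ1 / 2 * l2Sq h (U' - U) := by
  have key := exponential_step_identity (opL_selfAdjoint P hh g) hU'
  obtain ⟨V, hV⟩ : ∃ V, V = U' - U := ⟨_, rfl⟩
  rw [← hV] at key ⊢
  -- After pairing with the increment, the stabilization `g κ1 U` inside the nonlinear term cancels
  -- the same term of the operator applied to `U`; only its action on the increment remains.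
  have := congrArg (fun W => innerH h W V) key
  simp only [opL_apply, ← neg_smul, innerH_add_left, innerH_smul_left, innerH_sub_left,
    innerH_lapH] at this
  simp only [l2Sq]
  refine mul_left_cancel₀ hτ.ne' ?_
  have e : τ * (1 / τ) = 1 := by field_simp
  linear_combination
    (-1) * this + innerH h (opFun (fun z => calQ1 (τ * z)) (opL P h g) V) V * e

/-- Pairing of the variation with the increment, for the `u`-equation. -/
theorem innerH_step_opD (hh : 0 < h) (hτ : 0 < τ) {U H U' : GridFn d J}
    (hU' : U' = opFun (fun z => Real.exp (-τ * z)) (opD P h g) U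
      + τ • opFun (fun z => phi1 (-τ * z)) (opD P h g) (-(g • H) + (g * P.κ2) • U)) :
    g * innerH h H (U' - U)
      = -(1 / τ * innerH h (opFun (fun z => calQ1 (τ * z)) (opD P h g) (U' - U)) (U' - U))
        - 2 * P.B0 * innerH h (lapH h U) (lapH h (U' - U))
        - P.B0 * l2Sq h (lapH h (U' - U)) - g * P.κ2 / 2 * l2Sq h (U' - U) := by
  have key := exponential_step_identity (opD_selfAdjoint P hh g) hU'
  obtain ⟨V, hV⟩ : ∃ V, V = U' - U := ⟨_, rfl⟩
  rw [← hV] at key ⊢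
  have := congrArg (fun W => innerH h W V) key
  simp only [opD_apply, ← neg_smul, innerH_add_left, innerH_smul_left, innerH_sub_left,
    innerH_lapH_comm (lapH h _)] at this
  simp only [l2Sq]
  refine mul_left_cancel₀ hτ.ne' ?_
  have e : τ * (1 / τ) = 1 := by field_simp
  linear_combination
    (-1) * this + innerH h (opFun (fun z => calQ1 (τ * z)) (opD P h g) V) V * e

end Dissipation

/-! ### The discrete Sobolev inequality `H² ⊂ L^∞`, by the discrete Fourier transform -/

section Fourier

variable {d J : ℕ} [NeZero J]

/-- The characters of the group `(ℤ / J)^d`. -/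
noncomputable def gridChar (k p : Grid d J) : ℂ := ∏ i, ZMod.stdAddChar (k i * p i)

theorem gridChar_add (k p r : Grid d J) : gridChar k (p + r) = gridChar k p * gridChar k r := by
  simp only [gridChar, Pi.add_apply, mul_add, AddChar.map_add_eq_mul, Finset.prod_mul_distrib]

theorem norm_gridChar (k p : Grid d J) : ‖gridChar k p‖ = 1 := by
  simp [gridChar, norm_prod, AddChar.norm_apply]

theorem gridChar_neg (k p : Grid d J) :
    gridChar k (-p) = (starRingEnd ℂ) (gridChar k p) := by
  have h1 : gridChar k p * gridChar k (-p) = 1 := by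
    rw [← gridChar_add, add_neg_cancel]; simp [gridChar]
  have h2 : gridChar k p * (starRingEnd ℂ) (gridChar k p) = 1 := by
    rw [Complex.mul_conj, Complex.normSq_eq_norm_sq, norm_gridChar]; simp
  have h0 : gridChar k p ≠ 0 := fun h => by rw [h] at h1; simp at h1
  exact mul_left_cancel₀ h0 (h1.trans h2.symm)

/-- Orthogonality of characters: the sum factorizes over the directions, and one nonzero coordinate
makes its factor vanish. -/
theorem sum_gridChar (a : Grid d J) :
    ∑ k, gridChar k a = if a = 0 then (J : ℂ) ^ d else 0 := by
  have e : ∑ k : Grid d J, gridChar k a = ∏ i, ∑ j : ZMod J, ZMod.stdAddChar (j * a i) := by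
    rw [Finset.prod_univ_sum]
    exact Finset.sum_congr (by ext; simp) fun _ _ => rfl
  rw [e]
  simp only [AddChar.sum_mulShift _ (ZMod.isPrimitive_stdAddChar J), ZMod.card]
  split_ifs with ha
  · subst ha; simp
  · obtain ⟨i, hi⟩ := Function.ne_iff.1 ha
    exact Finset.prod_eq_zero (Finset.mem_univ i) (by simp [show a i ≠ 0 from hi])

/-- The discrete Fourier transform of a real grid function. -/
noncomputable def gridDft (U : GridFn d J) (k : Grid d J) : ℂ := ∑ p, (U p : ℂ) * gridChar k (-p)

/-- Fourier inversion. The transform is unnormalized, so powers of `J` appear here and in the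
Plancherel identity below. -/
theorem sum_gridDft_mul_gridChar (U : GridFn d J) (r : Grid d J) :
    ∑ k, gridDft U k * gridChar k r = (J : ℂ) ^ d * U r := by
  simp only [gridDft, Finset.sum_mul]
  rw [Finset.sum_comm]
  have : ∀ p, ∑ k, (U p : ℂ) * gridChar k (-p) * gridChar k r
      = if p = r then (J : ℂ) ^ d * U r else 0 := fun p => by
    simp only [mul_assoc, ← gridChar_add, ← Finset.mul_sum, sum_gridChar]
    by_cases hp : p = r
    · subst hp; simp [mul_comm]
    · have : ¬ (-p + r = 0) := fun h => hp (by rw [neg_add_eq_zero] at h; exact h)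
      simp [hp, this]
  simp only [this, Finset.sum_ite_eq', Finset.mem_univ, if_true]

theorem conj_gridDft (U : GridFn d J) (k : Grid d J) :
    (starRingEnd ℂ) (gridDft U k) = ∑ p, (U p : ℂ) * gridChar k p := by
  simp only [gridDft, map_sum, map_mul, gridChar_neg, Complex.conj_conj, Complex.conj_ofReal]

theorem sum_norm_gridDft_sq (U : GridFn d J) :
    ∑ k, ‖gridDft U k‖ ^ 2 = (J : ℝ) ^ d * ∑ p, U p * U p := by
  have : ∑ k, gridDft U k * (starRingEnd ℂ) (gridDft U k)
      = ∑ p, (U p : ℂ) * ((J : ℂ) ^ d * U p) := by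
    simp only [conj_gridDft, Finset.mul_sum]
    rw [Finset.sum_comm]
    refine Finset.sum_congr rfl fun p _ => ?_
    rw [← sum_gridDft_mul_gridChar, Finset.mul_sum]
    exact Finset.sum_congr rfl fun k _ => by ring
  apply Complex.ofReal_injective
  simp only [Complex.mul_conj, Complex.normSq_eq_norm_sq] at this
  push_cast at this ⊢
  rw [this, Finset.mul_sum]
  exact Finset.sum_congr rfl fun p _ => by ring

theorem gridDft_translate (U : GridFn d J) (a k : Grid d J) :
    gridDft (fun p => U (p + a)) k = gridChar k a * gridDft U k := by
  simp only [gridDft]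
  rw [Finset.mul_sum]
  refine (Fintype.sum_equiv (Equiv.addRight a) _ _ fun p => ?_)
  simp only [Equiv.coe_addRight, neg_add, gridChar_add]
  have : gridChar k a * gridChar k (-a) = 1 := by
    rw [← gridChar_add, add_neg_cancel]; simp [gridChar]
  linear_combination (-((U (p + a) : ℂ) * gridChar k (-p))) * this

/-- The symbol of `-Δₕ`. -/
noncomputable def lapSymbol (h : ℝ) (k : Grid d J) : ℝ :=
  ∑ i, (‖gridChar k (Pi.single i 1) - 1‖ / h) ^ 2

/-- Translation multiplies the transform by a character, and `2 - z - z̄ = |z - 1|²` on the unit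
circle; hence the symbol is a sum of squares. -/
theorem gridDft_lapH (h : ℝ) (U : GridFn d J) (k : Grid d J) :
    gridDft (lapH h U) k = -(lapSymbol h k : ℂ) * gridDft U k := by
  have e : ∀ p, ((lapH h U p : ℝ) : ℂ) = ∑ i : Fin d,
      ((U (p + Pi.single i 1) : ℂ) - 2 * U p + U (p + -Pi.single i 1)) / (h : ℂ) ^ 2 := fun p => by
    rw [lapH_apply]
    simp only [Finset.sum_apply, dFwd, dBwd, LinearMap.coe_mk, AddHom.coe_mk, add_sub_cancel_right,
      ← sub_eq_add_neg]
    push_cast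
    exact Finset.sum_congr rfl fun i _ => by ring
  have e1 : gridDft (lapH h U) k = ∑ i : Fin d,
      (gridChar k (Pi.single i 1) - 2 + gridChar k (-Pi.single i 1)) / (h : ℂ) ^ 2
        * gridDft U k := by
    have : ∀ i : Fin d, (gridChar k (Pi.single i 1) - 2 + gridChar k (-Pi.single i 1))
        / (h : ℂ) ^ 2 * gridDft U k
        = ∑ p, ((U (p + Pi.single i 1) : ℂ) - 2 * U p + U (p + -Pi.single i 1)) / (h : ℂ) ^ 2
          * gridChar k (-p) := fun i => by
      have t1 := gridDft_translate U (Pi.single i 1) k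
      have t2 := gridDft_translate U (-Pi.single i 1) k
      calc _ = (gridChar k (Pi.single i 1) * gridDft U k - 2 * gridDft U k
            + gridChar k (-Pi.single i 1) * gridDft U k) / (h : ℂ) ^ 2 := by ring
        _ = _ := by
          rw [← t1, ← t2]
          simp only [gridDft, Finset.mul_sum, ← Finset.sum_sub_distrib, ← Finset.sum_add_distrib,
            Finset.sum_div]
          exact Finset.sum_congr rfl fun p _ => by ring
    rw [Finset.sum_congr rfl fun i _ => this i, Finset.sum_comm, gridDft]
    exact Finset.sum_congr rfl fun p _ => by rw [e, Finset.sum_mul]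
  rw [e1, ← Finset.sum_mul, lapSymbol]
  congr 1
  push_cast
  rw [← Finset.sum_neg_distrib]
  refine Finset.sum_congr rfl fun i _ => ?_
  have h1 : ((‖gridChar k (Pi.single i 1) - 1‖ : ℝ) : ℂ) ^ 2
      = 2 - gridChar k (Pi.single i 1) - gridChar k (-Pi.single i 1) := by
    rw [gridChar_neg, ← Complex.ofReal_pow, ← Complex.normSq_eq_norm_sq, ← Complex.mul_conj]
    have h2 : gridChar k (Pi.single i 1) * (starRingEnd ℂ) (gridChar k (Pi.single i 1)) = 1 := by
      rw [Complex.mul_conj, Complex.normSq_eq_norm_sq, norm_gridChar]; simp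
    simp only [map_sub, map_one]
    linear_combination h2
  rw [div_pow, h1]
  ring

theorem gridChar_single (k : Grid d J) (i : Fin d) :
    gridChar k (Pi.single i 1) = ZMod.stdAddChar (k i) := by
  rw [gridChar, Finset.prod_eq_single i]
  · simp
  · intro b _ hb; simp [hb]
  · simp

/-- `|e^{iθ} - 1| = 2 |sin (θ/2)|`, followed by Jordan's inequality. The representative of least
absolute value keeps `θ/2` in `[-π/2, π/2]`, where Jordan's inequality holds. -/
theorem valMinAbs_le_norm_stdAddChar_sub_one (j : ZMod J) :
    4 * |(j.valMinAbs : ℝ)| / J ≤ ‖(ZMod.stdAddChar j : ℂ) - 1‖ := by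
  have hJ : (0 : ℝ) < J := by exact_mod_cast NeZero.pos J
  have e : (ZMod.stdAddChar j : ℂ)
      = Complex.exp (Complex.I * ((2 * Real.pi * j.valMinAbs / J : ℝ) : ℂ)) := by
    conv_lhs => rw [← ZMod.coe_valMinAbs j]
    rw [ZMod.stdAddChar_coe]
    congr 1
    push_cast
    ring
  rw [e, Complex.norm_exp_I_mul_ofReal_sub_one, norm_mul, Real.norm_eq_abs, Real.norm_eq_abs]
  have hx : 2 * Real.pi * j.valMinAbs / J / 2 = Real.pi * j.valMinAbs / J := by ring
  have ha : |Real.pi * j.valMinAbs / J| = Real.pi * |(j.valMinAbs : ℝ)| / J := by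
    rw [abs_div, abs_mul, abs_of_pos Real.pi_pos, abs_of_pos hJ]
  have hle : |(j.valMinAbs : ℝ)| ≤ J / 2 := by
    have h1 := ZMod.natAbs_valMinAbs_le j
    have h2 : ((j.valMinAbs.natAbs : ℕ) : ℝ) = |(j.valMinAbs : ℝ)| := by
      rw [Nat.cast_natAbs]; push_cast; rfl
    rw [← h2]
    calc ((j.valMinAbs.natAbs : ℕ) : ℝ) ≤ ((J / 2 : ℕ) : ℝ) := by exact_mod_cast h1
      _ ≤ J / 2 := Nat.cast_div_le
  have := Real.mul_abs_le_abs_sin (x := Real.pi * j.valMinAbs / J) (by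
    rw [ha, div_le_iff₀ hJ]
    nlinarith [Real.pi_pos])
  rw [ha] at this
  rw [hx]
  calc 4 * |(j.valMinAbs : ℝ)| / J = 2 * (2 / Real.pi * (Real.pi * |(j.valMinAbs : ℝ)| / J)) := by
        field_simp [Real.pi_ne_zero]; ring
    _ ≤ _ := by
      rw [abs_of_pos (by norm_num : (0 : ℝ) < 2)]
      gcongr

/-- The exponent `1/3` is the share of one direction among three; it leaves decay `|n|^{-4/3}`,
which is still summable. -/
theorem summable_symbol_weight (L : ℝ) (hL : 0 < L) :
    Summable fun n : ℤ => (1 + (4 * |(n : ℝ)| / L) ^ 4) ^ (-(1 / 3 : ℝ)) := by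
  have hs : Summable fun n : ℤ => (4 / L) ^ (-(4 / 3 : ℝ)) * |(n : ℝ)| ^ (-(4 / 3 : ℝ)) :=
    (Real.summable_abs_int_rpow (by norm_num)).mul_left _
  -- The power `|0| ^ (-4/3)` is zero by convention, so the comparison series receives an extra one
  -- at the origin.
  have hs' : Summable fun n : ℤ => (if n = 0 then (1 : ℝ) else 0)
      + (4 / L) ^ (-(4 / 3 : ℝ)) * |(n : ℝ)| ^ (-(4 / 3 : ℝ)) :=
    (summable_of_ne_finset_zero (s := {0}) fun n hn => if_neg (by simpa using hn)).add hs
  refine Summable.of_nonneg_of_le (fun n => by positivity) (fun n => ?_) hs'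
  rcases eq_or_ne n 0 with rfl | hn
  · simp only [Int.cast_zero, abs_zero, mul_zero, zero_div, if_true]
    norm_num
  · have hn' : 0 < |(n : ℝ)| := by positivity
    rw [if_neg hn, zero_add, ← Real.mul_rpow (by positivity) (by positivity)]
    have : (4 / L * |(n : ℝ)|) ^ (-(4 / 3 : ℝ)) = ((4 * |(n : ℝ)| / L) ^ 4) ^ (-(1 / 3 : ℝ)) := by
      rw [← Real.rpow_natCast, ← Real.rpow_mul (by positivity)]
      norm_num
      congr 1
      ring
    rw [this]
    exact Real.rpow_le_rpow_of_nonpos (by positivity) (by linarith) (by norm_num)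

/-- The symbol squared dominates `(4|n_i|/L)^4` for each frequency component separately. Splitting
the weight evenly over the directions bounds the multiple sum by a power of one convergent series,
independently of `J`. -/
theorem exists_sum_symbol_le (d : ℕ) (hd : d ≤ 3) (L : ℝ) (hL : 0 < L) :
    ∃ S : ℝ, 0 ≤ S ∧ ∀ (J : ℕ) [NeZero J],
      ∑ k : Grid d J, (1 + lapSymbol (mesh L J) k ^ 2)⁻¹ ≤ S := by
  set w : ℤ → ℝ := fun n => (1 + (4 * |(n : ℝ)| / L) ^ 4) ^ (-(1 / 3 : ℝ)) with hw
  have hw0 : ∀ n, 0 ≤ w n := fun n => by positivity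
  refine ⟨(∑' n, w n) ^ d, pow_nonneg (tsum_nonneg hw0) d, fun J _ => ?_⟩
  have hJ : (0 : ℝ) < J := by exact_mod_cast NeZero.pos J
  have h1 : ∑ j : ZMod J, w j.valMinAbs ≤ ∑' n, w n := by
    -- Least representatives are injective on `ZMod J`, so the sum over residues is a partial sum of
    -- the series over the integers.
    have := Summable.sum_le_tsum (Finset.univ.image fun j : ZMod J => j.valMinAbs)
      (fun n _ => hw0 n) (summable_symbol_weight L hL)
    rwa [Finset.sum_image fun a _ b _ hab => ZMod.injective_valMinAbs hab] at this
  have h2 : ∑ k : Grid d J, ∏ i, w (k i).valMinAbs = (∑ j : ZMod J, w j.valMinAbs) ^ d := by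
    have := Finset.prod_univ_sum (fun _ : Fin d => (Finset.univ : Finset (ZMod J)))
      fun _ j => w j.valMinAbs
    rw [Finset.prod_const, Finset.card_univ, Fintype.card_fin] at this
    rw [this]
    exact Finset.sum_congr (by ext; simp) fun _ _ => rfl
  refine le_trans ?_ (pow_le_pow_left₀ (Finset.sum_nonneg fun j _ => hw0 _) h1 d)
  rw [← h2]
  refine Finset.sum_le_sum fun k _ => ?_
  set b := 1 + lapSymbol (mesh L J) k ^ 2 with hb
  have hb1 : 1 ≤ b := by rw [hb]; nlinarith [sq_nonneg (lapSymbol (mesh L J) k)]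
  have hfac : ∀ i, b ^ (-(1 / 3 : ℝ)) ≤ w (k i).valMinAbs := fun i => by
    refine Real.rpow_le_rpow_of_nonpos (by positivity) ?_ (by norm_num)
    have h3 : 4 * |((k i).valMinAbs : ℝ)| / L
        ≤ ‖gridChar k (Pi.single i 1) - 1‖ / mesh L J := by
      rw [gridChar_single, mesh, div_div_eq_mul_div]
      have := valMinAbs_le_norm_stdAddChar_sub_one (k i)
      rw [div_le_iff₀ hJ] at this
      gcongr
    have h4 : (4 * |((k i).valMinAbs : ℝ)| / L) ^ 2 ≤ lapSymbol (mesh L J) k :=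
      (pow_le_pow_left₀ (by positivity) h3 2).trans
        (Finset.single_le_sum (f := fun i => (‖gridChar k (Pi.single i 1) - 1‖ / mesh L J) ^ 2)
          (fun _ _ => sq_nonneg _) (Finset.mem_univ i))
    have := pow_le_pow_left₀ (by positivity) h4 2
    rw [hb]
    linarith
  have hb0 : 0 ≤ b ^ (-(1 / 3 : ℝ)) := by positivity
  -- Here `d ≤ 3` enters: the base is at least one and `-1 ≤ -d/3`.
  calc b⁻¹ ≤ (b ^ (-(1 / 3 : ℝ))) ^ d := by
        rw [← Real.rpow_natCast, ← Real.rpow_mul (by linarith), ← Real.rpow_neg_one]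
        refine Real.rpow_le_rpow_of_exponent_le hb1 ?_
        have : (d : ℝ) ≤ 3 := by exact_mod_cast hd
        linarith
    _ = ∏ _i : Fin d, b ^ (-(1 / 3 : ℝ)) := by simp
    _ ≤ ∏ i, w (k i).valMinAbs := Finset.prod_le_prod (fun _ _ => hb0) fun i _ => hfac i

/-- Discrete Sobolev inequality: the maximum norm is bounded by the `H²` norm. -/
theorem exists_abs_le_normH2 (d : ℕ) (hd : d ≤ 3) (L : ℝ) (hL : 0 < L) :
    ∃ C : ℝ, 0 ≤ C ∧ ∀ (J : ℕ) [NeZero J] (U : GridFn d J) (p : Grid d J),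
      |U p| ≤ C * normH2 (mesh L J) U := by
  obtain ⟨S, hS0, hS⟩ := exists_sum_symbol_le d hd L hL
  refine ⟨√(S / L ^ d), Real.sqrt_nonneg _, fun J _ U p => ?_⟩
  have hJ : (0 : ℝ) < J := by exact_mod_cast NeZero.pos J
  set h := mesh L J with hh
  have hpos : 0 < h := div_pos hL hJ
  have hJh : (J : ℝ) * h = L := by rw [hh, mesh]; field_simp
  have h1 : (J : ℝ) ^ d * |U p| ≤ ∑ k, ‖gridDft U k‖ := by
    have := congrArg norm (sum_gridDft_mul_gridChar U p)
    rw [norm_mul, norm_pow, Complex.norm_natCast, Complex.norm_real, Real.norm_eq_abs] at this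
    rw [← this]
    refine (norm_sum_le _ _).trans (Finset.sum_le_sum fun k _ => ?_)
    rw [norm_mul, norm_gridChar, mul_one]
  -- Cauchy–Schwarz with weight `1 + λ²`: the weighted sum of squares is the `l²` energy of `U` and
  -- `Δₕ U` by Plancherel, the reciprocal weights sum to at most `S`.
  have h2 : (∑ k, ‖gridDft U k‖) ^ 2 ≤ (∑ k : Grid d J, (1 + lapSymbol h k ^ 2)⁻¹)
      * ∑ k, (1 + lapSymbol h k ^ 2) * ‖gridDft U k‖ ^ 2 := by
    refine Finset.sum_sq_le_sum_mul_sum_of_sq_le_mul _ (fun k _ => by positivity)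
      (fun k _ => by positivity) fun k _ => ?_
    rw [inv_mul_cancel_left₀ (by positivity)]
  have h3 : ∑ k : Grid d J, (1 + lapSymbol h k ^ 2) * ‖gridDft U k‖ ^ 2
      = (J : ℝ) ^ d * (∑ p, U p * U p + ∑ p, lapH h U p * lapH h U p) := by
    rw [mul_add, ← sum_norm_gridDft_sq, ← sum_norm_gridDft_sq, ← Finset.sum_add_distrib]
    refine Finset.sum_congr rfl fun k _ => ?_
    rw [gridDft_lapH, norm_mul, norm_neg, Complex.norm_real, Real.norm_eq_abs, mul_pow, sq_abs]
    ring
  have h4 : h ^ d * (∑ p, U p * U p + ∑ p, lapH h U p * lapH h U p) ≤ h2Sq h U := by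
    rw [mul_add, h2Sq, h1Sq]
    have : 0 ≤ ∑ k, l2Sq h (dFwd h k U) := Finset.sum_nonneg fun _ _ => l2Sq_nonneg hpos.le _
    change l2Sq h U + l2Sq h (lapH h U) ≤ _
    linarith
  have hLd : 0 < L ^ d := by positivity
  have h5 : L ^ d * |U p| ^ 2 ≤ S * h2Sq h U := by
    have hJd : 0 < (J : ℝ) ^ d := by positivity
    have hhd : 0 < h ^ d := by positivity
    have h6 : ((J : ℝ) ^ d * |U p|) ^ 2
        ≤ S * ((J : ℝ) ^ d * (∑ p, U p * U p + ∑ p, lapH h U p * lapH h U p)) := by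
      refine (pow_le_pow_left₀ (by positivity) h1 2).trans (h2.trans ?_)
      rw [h3]
      refine mul_le_mul_of_nonneg_right (hS J) ?_
      have : 0 ≤ ∑ p, U p * U p := Finset.sum_nonneg fun _ _ => mul_self_nonneg _
      have : 0 ≤ ∑ p, lapH h U p * lapH h U p := Finset.sum_nonneg fun _ _ => mul_self_nonneg _
      positivity
    have h7 : L ^ d = (J : ℝ) ^ d * h ^ d := by rw [← hJh, mul_pow]
    have h8 := mul_le_mul_of_nonneg_left h4 hS0
    refine le_of_mul_le_mul_left ?_ hJd
    calc (J : ℝ) ^ d * (L ^ d * |U p| ^ 2) = h ^ d * ((J : ℝ) ^ d * |U p|) ^ 2 := by rw [h7]; ring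
      _ ≤ h ^ d * (S * ((J : ℝ) ^ d * (∑ p, U p * U p + ∑ p, lapH h U p * lapH h U p))) := by
        gcongr
      _ = (J : ℝ) ^ d * (S * (h ^ d * (∑ p, U p * U p + ∑ p, lapH h U p * lapH h U p))) := by ring
      _ ≤ _ := by gcongr
  rw [normH2, ← Real.sqrt_mul (by positivity)]
  refine Real.le_sqrt_of_sq_le ?_
  rw [div_mul_eq_mul_div, le_div_iff₀ hLd]
  linarith

end Fourier

/-! ### The discrete Sobolev inequality `H¹ ⊂ L⁶` -/

section Gagliardo

variable {J : ℕ} [NeZero J]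

/-- Walk from `y` to `x` in unit steps. Fewer than `J` steps are needed, so no edge is used twice
and the telescoping sum is at most the total variation. -/
theorem le_add_sum_abs_sub (w : ZMod J → ℝ) (x y : ZMod J) :
    w x ≤ w y + ∑ z, |w (z + 1) - w z| := by
  have step : ∀ n : ℕ, w (y + n) ≤ w y + ∑ i ∈ Finset.range n, |w (y + i + 1) - w (y + i)| := by
    intro n
    induction n with
    | zero => simp
    | succ n ih =>
      rw [Finset.sum_range_succ]
      have := le_abs_self (w (y + n + 1) - w (y + n))
      push_cast
      rw [← add_assoc]
      linarith
  have hx : y + ((x - y).val : ZMod J) = x := by rw [ZMod.natCast_zmod_val]; ring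
  have h1 := step (x - y).val
  rw [hx] at h1
  refine h1.trans (add_le_add_right ?_ _)
  have inj : Set.InjOn (fun i : ℕ => y + (i : ZMod J)) (Finset.range (x - y).val) := by
    intro i hi j hj hij
    have hi' := (Finset.mem_range.1 hi).trans (ZMod.val_lt _)
    have hj' := (Finset.mem_range.1 hj).trans (ZMod.val_lt _)
    have := congrArg ZMod.val (add_left_cancel hij)
    rwa [ZMod.val_cast_of_lt hi', ZMod.val_cast_of_lt hj'] at this
  rw [← Finset.sum_image (f := fun z => |w (z + 1) - w z|) inj]
  exact Finset.sum_le_sum_of_subset_of_nonneg (Finset.subset_univ _) fun _ _ _ => abs_nonneg _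

/-- On a periodic line a function is at most its mean plus its total variation. -/
theorem le_mean_add_variation {h L : ℝ} (hL : (J : ℝ) * h = L) (hh : 0 < h) (w : ZMod J → ℝ)
    (x : ZMod J) : w x ≤ ∑ z, (h / L * w z + |w (z + 1) - w z|) := by
  have hJ : (0 : ℝ) < J := by exact_mod_cast NeZero.pos J
  have := Finset.sum_le_sum fun (y : ZMod J) (_ : y ∈ Finset.univ) => le_add_sum_abs_sub w x y
  rw [Finset.sum_const, Finset.sum_add_distrib, Finset.sum_const, Finset.card_univ, ZMod.card,
    nsmul_eq_mul, nsmul_eq_mul] at this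
  rw [Finset.sum_add_distrib, ← Finset.mul_sum]
  have e : h / L = 1 / J := by rw [← hL]; field_simp
  rw [e]
  have : w x ≤ (∑ y, w y + J * ∑ z, |w (z + 1) - w z|) / J := by
    rw [le_div_iff₀ hJ]; linarith
  refine this.trans (le_of_eq ?_)
  field_simp

/-- The discrete Loomis–Whitney inequality in three dimensions. -/
theorem loomis_whitney {ι : Type*} [Fintype ι] (a b c : ι → ι → ℝ) :
    (∑ x, ∑ y, ∑ z, a y z * b x z * c x y) ^ 2
      ≤ (∑ y, ∑ z, a y z ^ 2) * (∑ x, ∑ z, b x z ^ 2) * ∑ x, ∑ y, c x y ^ 2 := by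
  have e : ∑ x, ∑ y, ∑ z, a y z * b x z * c x y
      = ∑ q : ι × ι, c q.1 q.2 * ∑ z, a q.2 z * b q.1 z := by
    rw [Fintype.sum_prod_type]
    simp only [Finset.mul_sum]
    exact Finset.sum_congr rfl fun x _ => Finset.sum_congr rfl fun y _ =>
      Finset.sum_congr rfl fun z _ => by ring
  rw [e]
  -- Cauchy–Schwarz in `(x, y)` splits off `c`; a second one in `z`, for fixed `(x, y)`, separates
  -- `a` from `b`.
  refine (Finset.sum_mul_sq_le_sq_mul_sq _ _ _).trans ?_
  have h1 : ∑ q : ι × ι, c q.1 q.2 ^ 2 = ∑ x, ∑ y, c x y ^ 2 := Fintype.sum_prod_type _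
  have h2 : ∑ q : ι × ι, (∑ z, a q.2 z * b q.1 z) ^ 2
      ≤ (∑ y, ∑ z, a y z ^ 2) * ∑ x, ∑ z, b x z ^ 2 := by
    calc _ ≤ ∑ q : ι × ι, (∑ z, a q.2 z ^ 2) * ∑ z, b q.1 z ^ 2 :=
          Finset.sum_le_sum fun q _ => Finset.sum_mul_sq_le_sq_mul_sq _ _ _
      _ = _ := by
          rw [Fintype.sum_prod_type, Finset.sum_comm, Finset.sum_mul]
          exact Finset.sum_congr rfl fun x _ => by rw [Finset.mul_sum]
  rw [h1, mul_comm]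
  gcongr

/-- The integral of a function over the lines parallel to the `k`-th axis, summed over all
lines: the mean part plus the total variation. -/
noncomputable def lineSum {d : ℕ} (h L : ℝ) (k : Fin d) (w : GridFn d J) : ℝ :=
  ∑ p, (h / L * w p + |w (p + Pi.single k 1) - w p|)

theorem sum_grid_three (F : GridFn 3 J) : ∑ p, F p = ∑ x, ∑ y, ∑ z, F ![x, y, z] := by
  let e : ZMod J × ZMod J × ZMod J ≃ Grid 3 J :=
    { toFun := fun q => ![q.1, q.2.1, q.2.2]
      invFun := fun p => (p 0, p 1, p 2)
      left_inv := fun q => rfl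
      right_inv := fun p => by ext i; fin_cases i <;> rfl }
  rw [← Fintype.sum_equiv e (fun q => F (e q)) F fun _ => rfl, Fintype.sum_prod_type]
  simp only [Fintype.sum_prod_type]
  rfl

theorem sum_grid_two (F : GridFn 2 J) : ∑ p, F p = ∑ x, ∑ y, F ![x, y] := by
  let e : ZMod J × ZMod J ≃ Grid 2 J :=
    { toFun := fun q => ![q.1, q.2]
      invFun := fun p => (p 0, p 1)
      left_inv := fun q => rfl
      right_inv := fun p => by ext i; fin_cases i <;> rfl }
  rw [← Fintype.sum_equiv e (fun q => F (e q)) F fun _ => rfl, Fintype.sum_prod_type]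
  rfl

/-- In each direction `w` is at most its line sum, which does not depend on that coordinate. Hence
`f² = w³` is at most a product of three functions of two variables each, and Loomis–Whitney applies
to their square roots. -/
theorem sq_sum_le_lineSum_three {h L : ℝ} (hL : (J : ℝ) * h = L) (hh : 0 < h) (w f : GridFn 3 J)
    (hw : ∀ p, 0 ≤ w p) (hf : ∀ p, f p ^ 2 = w p ^ 3) :
    (∑ p, f p) ^ 2 ≤ lineSum h L 0 w * lineSum h L 1 w * lineSum h L 2 w := by
  have hJ : (0 : ℝ) < J := by exact_mod_cast NeZero.pos J
  have hL0 : 0 < L := by rw [← hL]; positivity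
  set A : ZMod J → ZMod J → ℝ := fun y z =>
    ∑ x, (h / L * w ![x, y, z] + |w ![x + 1, y, z] - w ![x, y, z]|) with hA
  set B : ZMod J → ZMod J → ℝ := fun x z =>
    ∑ y, (h / L * w ![x, y, z] + |w ![x, y + 1, z] - w ![x, y, z]|) with hB
  set C : ZMod J → ZMod J → ℝ := fun x y =>
    ∑ z, (h / L * w ![x, y, z] + |w ![x, y, z + 1] - w ![x, y, z]|) with hC
  have hA0 : ∀ y z, 0 ≤ A y z := fun y z => Finset.sum_nonneg fun x _ =>
    add_nonneg (mul_nonneg (by positivity) (hw _)) (abs_nonneg _)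
  have hB0 : ∀ y z, 0 ≤ B y z := fun y z => Finset.sum_nonneg fun x _ =>
    add_nonneg (mul_nonneg (by positivity) (hw _)) (abs_nonneg _)
  have hC0 : ∀ y z, 0 ≤ C y z := fun y z => Finset.sum_nonneg fun x _ =>
    add_nonneg (mul_nonneg (by positivity) (hw _)) (abs_nonneg _)
  have s0 : ∀ x y z : ZMod J, ![x, y, z] + Pi.single 0 1 = ![x + 1, y, z] := fun x y z => by
    ext i; fin_cases i <;> simp
  have s1 : ∀ x y z : ZMod J, ![x, y, z] + Pi.single 1 1 = ![x, y + 1, z] := fun x y z => by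
    ext i; fin_cases i <;> simp
  have s2 : ∀ x y z : ZMod J, ![x, y, z] + Pi.single 2 1 = ![x, y, z + 1] := fun x y z => by
    ext i; fin_cases i <;> simp
  have e0 : lineSum h L 0 w = ∑ y, ∑ z, √(A y z) ^ 2 := by
    simp only [Real.sq_sqrt (hA0 _ _), lineSum]
    rw [sum_grid_three, Finset.sum_comm]
    refine Finset.sum_congr rfl fun y _ => ?_
    rw [Finset.sum_comm]
    simp only [s0, hA]
  have e1 : lineSum h L 1 w = ∑ x, ∑ z, √(B x z) ^ 2 := by
    simp only [Real.sq_sqrt (hB0 _ _), lineSum]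
    rw [sum_grid_three]
    refine Finset.sum_congr rfl fun y _ => ?_
    rw [Finset.sum_comm]
    simp only [s1, hB]
  have e2 : lineSum h L 2 w = ∑ x, ∑ y, √(C x y) ^ 2 := by
    simp only [Real.sq_sqrt (hC0 _ _), lineSum]
    rw [sum_grid_three]
    simp only [s2, hC]
  rw [e0, e1, e2]
  refine le_trans ?_ (loomis_whitney _ _ _)
  rw [← sq_abs]
  refine pow_le_pow_left₀ (abs_nonneg _) ?_ 2
  refine (Finset.abs_sum_le_sum_abs _ _).trans ?_
  rw [sum_grid_three fun p => |f p|]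
  refine Finset.sum_le_sum fun x _ => Finset.sum_le_sum fun y _ => Finset.sum_le_sum fun z _ => ?_
  refine abs_le_of_sq_le_sq ?_ (by positivity)
  rw [hf, mul_pow, mul_pow, Real.sq_sqrt (hA0 _ _), Real.sq_sqrt (hB0 _ _), Real.sq_sqrt (hC0 _ _)]
  have a1 := le_mean_add_variation hL hh (fun x => w ![x, y, z]) x
  have a2 := le_mean_add_variation hL hh (fun y => w ![x, y, z]) y
  have a3 := le_mean_add_variation hL hh (fun z => w ![x, y, z]) z
  have w0 := hw ![x, y, z]
  calc w ![x, y, z] ^ 3 = w ![x, y, z] * w ![x, y, z] * w ![x, y, z] := by ring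
    _ ≤ A y z * B x z * C x y := by
      have := hA0 y z
      have := hB0 x z
      gcongr

/-- In the plane the two line sums depend on different variables, so the double sum of their product
factorizes and no Loomis–Whitney inequality is needed. -/
theorem sum_le_lineSum_two {h L : ℝ} (hL : (J : ℝ) * h = L) (hh : 0 < h) (w : GridFn 2 J)
    (hw : ∀ p, 0 ≤ w p) : ∑ p, w p ^ 2 ≤ lineSum h L 0 w * lineSum h L 1 w := by
  have hJ : (0 : ℝ) < J := by exact_mod_cast NeZero.pos J
  have hL0 : 0 < L := by rw [← hL]; positivity
  set A : ZMod J → ℝ := fun y => ∑ x, (h / L * w ![x, y] + |w ![x + 1, y] - w ![x, y]|) with hA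
  set B : ZMod J → ℝ := fun x => ∑ y, (h / L * w ![x, y] + |w ![x, y + 1] - w ![x, y]|) with hB
  have hA0 : ∀ y, 0 ≤ A y := fun y => Finset.sum_nonneg fun x _ =>
    add_nonneg (mul_nonneg (by positivity) (hw _)) (abs_nonneg _)
  have s0 : ∀ x y : ZMod J, ![x, y] + Pi.single 0 1 = ![x + 1, y] := fun x y => by
    ext i; fin_cases i <;> simp
  have s1 : ∀ x y : ZMod J, ![x, y] + Pi.single 1 1 = ![x, y + 1] := fun x y => by
    ext i; fin_cases i <;> simp
  have e0 : lineSum h L 0 w = ∑ y, A y := by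
    simp only [lineSum]
    rw [sum_grid_two, Finset.sum_comm]
    simp only [s0, hA]
  have e1 : lineSum h L 1 w = ∑ x, B x := by
    simp only [lineSum]
    rw [sum_grid_two]
    simp only [s1, hB]
  rw [e0, e1, sum_grid_two, Finset.sum_mul_sum, Finset.sum_comm]
  refine Finset.sum_le_sum fun y _ => Finset.sum_le_sum fun x _ => ?_
  have a1 := le_mean_add_variation hL hh (fun x => w ![x, y]) x
  have a2 := le_mean_add_variation hL hh (fun y => w ![x, y]) y
  rw [sq]
  exact mul_le_mul a1 a2 (hw _) (hA0 _)

variable {d : ℕ} {h : ℝ}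

theorem innerH_abs_le (hh : 0 ≤ h) (U V : GridFn d J) :
    h ^ d * ∑ p, |U p| * |V p| ≤ normL2 h U * normL2 h V := by
  have := (le_abs_self _).trans (abs_innerH_le hh (fun p => |U p|) fun p => |V p|)
  rwa [normL2_abs, normL2_abs] at this

/-- If differences of `w` are controlled by differences of `U` times values of `V`, the line
sums of `w` are controlled by norms of `U` and `V`. -/
theorem pow_mul_lineSum_le {L : ℝ} (hL : 0 < L) (hh : 0 < h) (k : Fin d) (c : ℝ) (hc : 0 ≤ c)
    {w U V : GridFn d J} (hw : ∀ p, w p ≤ |U p| * |V p|)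
    (hd : ∀ p r, |w p - w r| ≤ c * (|U p - U r| * (|V p| + |V r|))) :
    h ^ d * lineSum h L k w ≤ h * ((1 / L + 2 * c) * normL2 h V * normH1 h U) := by
  have n1 := normL2_le_normH1 hh.le U
  have n2 := normL2_dFwd_le_normH1 hh.le k U
  have nV := normL2_nonneg (h := h) V
  have h1 : h ^ d * ∑ p, w p ≤ normL2 h V * normH1 h U := by
    calc h ^ d * ∑ p, w p ≤ h ^ d * ∑ p, |U p| * |V p| := by
          gcongr with p; exact hw p
      _ ≤ normL2 h U * normL2 h V := innerH_abs_le hh.le _ _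
      _ ≤ _ := by rw [mul_comm]; gcongr
  have h2 : h ^ d * ∑ p, |w (p + Pi.single k 1) - w p|
      ≤ h * (2 * c * normL2 h V * normH1 h U) := by
    have e : ∀ p, |w (p + Pi.single k 1) - w p|
        ≤ h * c * (|dFwd h k U p| * |V (p + Pi.single k 1)| + |dFwd h k U p| * |V p|) := fun p => by
      refine (hd _ _).trans (le_of_eq ?_)
      simp only [dFwd, LinearMap.coe_mk, AddHom.coe_mk, abs_div, abs_of_pos hh]
      field_simp
    calc _ ≤ h ^ d * ∑ p,
          h * c * (|dFwd h k U p| * |V (p + Pi.single k 1)| + |dFwd h k U p| * |V p|) := by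
          gcongr with p; exact e p
      _ = h * c * (h ^ d * ∑ p, |dFwd h k U p| * |V (p + Pi.single k 1)|
            + h ^ d * ∑ p, |dFwd h k U p| * |V p|) := by
          rw [← Finset.mul_sum, Finset.sum_add_distrib]; ring
      _ ≤ h * c * (normL2 h (dFwd h k U) * normL2 h V + normL2 h (dFwd h k U) * normL2 h V) := by
          refine mul_le_mul_of_nonneg_left (add_le_add ?_ (innerH_abs_le hh.le _ _)) (by positivity)
          refine (innerH_abs_le hh.le (dFwd h k U) fun p => V (p + Pi.single k 1)).trans ?_
          rw [normL2_translate]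
      _ ≤ h * c * (normH1 h U * normL2 h V + normH1 h U * normL2 h V) := by gcongr
      _ = _ := by ring
  have e : h ^ d * lineSum h L k w
      = h / L * (h ^ d * ∑ p, w p) + h ^ d * ∑ p, |w (p + Pi.single k 1) - w p| := by
    rw [lineSum, Finset.sum_add_distrib, ← Finset.mul_sum]; ring
  rw [e]
  calc _ ≤ h / L * (normL2 h V * normH1 h U) + h * (2 * c * normL2 h V * normH1 h U) := by gcongr
    _ = _ := by ring

theorem lineSum_nonneg {L : ℝ} (hL : 0 < L) (hh : 0 < h) (k : Fin d) {w : GridFn d J}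
    (hw : ∀ p, 0 ≤ w p) : 0 ≤ lineSum h L k w :=
  Finset.sum_nonneg fun p _ => add_nonneg (mul_nonneg (by positivity) (hw p)) (abs_nonneg _)

theorem abs_pow_four_sub_le (x y : ℝ) :
    |x ^ 4 - y ^ 4| ≤ 2 * (|x - y| * (|x ^ 3| + |y ^ 3|)) := by
  have e : x ^ 4 - y ^ 4 = (x - y) * (x ^ 3 + y ^ 3 + x * y * (x + y)) := by ring
  have hb : |x ^ 3 + y ^ 3 + x * y * (x + y)| ≤ 2 * (|x ^ 3| + |y ^ 3|) := by
    have h1 : |x * y * (x + y)| ≤ |x| ^ 3 + |y| ^ 3 := by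
      rw [abs_mul, abs_mul]
      have := abs_add_le x y
      have hx := abs_nonneg x
      have hy := abs_nonneg y
      calc |x| * |y| * |x + y| ≤ |x| * |y| * (|x| + |y|) := by gcongr
        _ ≤ _ := by nlinarith [mul_nonneg (add_nonneg hx hy) (sq_nonneg (|x| - |y|))]
    have h2 := abs_add_le (x ^ 3 + y ^ 3) (x * y * (x + y))
    have h3 := abs_add_le (x ^ 3) (y ^ 3)
    rw [abs_pow, abs_pow] at *
    linarith
  rw [e, abs_mul]
  calc _ ≤ |x - y| * (2 * (|x ^ 3| + |y ^ 3|)) := by gcongr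
    _ = _ := by ring

theorem abs_abs_cube_sub_le (x y : ℝ) :
    |(|x| ^ 3) - |y| ^ 3| ≤ 2 * (|x - y| * (|x ^ 2| + |y ^ 2|)) := by
  have e : |x| ^ 3 - |y| ^ 3 = (|x| - |y|) * (|x| ^ 2 + |x| * |y| + |y| ^ 2) := by ring
  have h1 := abs_abs_sub_abs_le x y
  rw [e, abs_mul, abs_pow, abs_pow, abs_of_nonneg (by positivity : 0 ≤ |x| ^ 2 + |x| * |y| + |y| ^ 2)]
  have h2 : |x| ^ 2 + |x| * |y| + |y| ^ 2 ≤ 2 * (|x| ^ 2 + |y| ^ 2) := by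
    nlinarith [sq_nonneg (|x| - |y|)]
  calc _ ≤ |x - y| * (2 * (|x| ^ 2 + |y| ^ 2)) := by gcongr
    _ = _ := by ring

/-- `‖U²‖² ≤ ‖U‖ ‖U³‖`. -/
theorem normL2_sq_sq_le (hh : 0 ≤ h) (U : GridFn d J) :
    normL2 h (U ^ 2) ^ 2 ≤ normL2 h U * normL2 h (U ^ 3) := by
  refine le_trans (le_of_eq ?_) ((le_abs_self _).trans (abs_innerH_le hh U (U ^ 3)))
  rw [normL2_sq hh, l2Sq, innerH, innerH]
  congr 1
  exact Finset.sum_congr rfl fun p _ => by simp only [Pi.pow_apply]; ring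

theorem l2Sq_cube (U : GridFn d J) : l2Sq h (U ^ 3) = h ^ d * ∑ p, U p ^ 6 := by
  rw [l2Sq, innerH]
  congr 1
  exact Finset.sum_congr rfl fun p _ => by simp only [Pi.pow_apply]; ring

end Gagliardo

/-- Discrete Sobolev inequality: the `L⁶` norm is bounded by the `H¹` norm. -/
theorem exists_normL2_cube_le (d : ℕ) (hd : d = 2 ∨ d = 3) (L : ℝ) (hL : 0 < L) :
    ∃ C : ℝ, 0 ≤ C ∧ ∀ (J : ℕ) [NeZero J] (U : GridFn d J),
      normL2 (mesh L J) (U ^ 3) ≤ C * normH1 (mesh L J) U ^ 3 := by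
  -- This is the constant of `pow_mul_lineSum_le` with `c = 2`; its square serves `d = 2`, its cube
  -- `d = 3`.
  set κ := 1 / L + 2 * 2 with hκ
  have hκ0 : 0 < κ := by positivity
  refine ⟨κ ^ 2 + κ ^ 3, by positivity, fun J _ U => ?_⟩
  have hJ : (0 : ℝ) < J := by exact_mod_cast NeZero.pos J
  set h := mesh L J with hh
  have hpos : 0 < h := div_pos hL hJ
  have hJh : (J : ℝ) * h = L := by rw [hh, mesh]; field_simp
  set b := normL2 h (U ^ 3) with hb
  set N := normH1 h U with hN
  have hb0 : 0 ≤ b := normL2_nonneg _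
  have hN0 : 0 ≤ N := normH1_nonneg _
  have hb2 : b ^ 2 = h ^ d * ∑ p, U p ^ 6 := by rw [hb, normL2_sq hpos.le, l2Sq_cube]
  -- The argument bounds a power of `b` by a smaller power of `b` and cancels, so `b = 0` is treated
  -- apart.
  rcases hb0.eq_or_lt with hb1 | hb1
  · rw [← hb1]; positivity
  rcases hd with rfl | rfl
  -- For `d = 2` the choice `w = |U|³` makes the sum of `w²` the sixth power sum. Differences of `w`
  -- cost the `l²` norm of `U²`, which `normL2_sq_sq_le` interpolates between `U` and `U³`.
  · set w : GridFn 2 J := fun p => |U p| ^ 3 with hw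
    have hw0 : ∀ p, 0 ≤ w p := fun p => by positivity
    have hV : ∀ k, h * lineSum h L k w ≤ κ * normL2 h (U ^ 2) * N := fun k => by
      have := pow_mul_lineSum_le hL hpos k 2 (by norm_num) (w := w) (U := U) (V := U ^ 2)
        (fun p => by simp only [hw, Pi.pow_apply, abs_pow]; exact le_of_eq (by ring))
        fun p r => abs_abs_cube_sub_le _ _
      rw [pow_two, mul_assoc] at this
      exact le_of_mul_le_mul_left this hpos
    have h1 : b ^ 2 ≤ (h * lineSum h L 0 w) * (h * lineSum h L 1 w) := by
      have h2 := sum_le_lineSum_two hJh hpos w hw0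
      have e : ∑ p, U p ^ 6 = ∑ p, w p ^ 2 :=
        Finset.sum_congr rfl fun p _ => by rw [hw, ← pow_mul, Even.pow_abs (by decide)]
      rw [hb2, e]
      calc h ^ 2 * ∑ p, w p ^ 2 ≤ h ^ 2 * (lineSum h L 0 w * lineSum h L 1 w) := by gcongr
        _ = _ := by ring
    have hl0 := lineSum_nonneg hL hpos 1 hw0
    have n2 := normL2_nonneg (h := h) (U ^ 2)
    have h3 : b ^ 2 ≤ (κ * normL2 h (U ^ 2) * N) * (κ * normL2 h (U ^ 2) * N) :=
      h1.trans (mul_le_mul (hV 0) (hV 1) (by positivity) (by positivity))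
    have h4 : normL2 h (U ^ 2) ^ 2 ≤ N * b :=
      (normL2_sq_sq_le hpos.le U).trans (by gcongr; exact normL2_le_normH1 hpos.le U)
    have h5 : b * b ≤ κ ^ 2 * N ^ 3 * b := by
      calc b * b ≤ κ ^ 2 * N ^ 2 * normL2 h (U ^ 2) ^ 2 := by nlinarith
        _ ≤ κ ^ 2 * N ^ 2 * (N * b) := by gcongr
        _ = _ := by ring
    have h6 := le_of_mul_le_mul_right h5 hb1
    refine h6.trans ?_
    gcongr
    have : 0 < κ ^ 3 := by positivity
    linarith
  -- For `d = 3` the choice `w = U⁴` gives `w³ = (U⁶)²`, and differences of `w` cost `U³`, whose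
  -- norm is `b` itself. This yields `b⁴ ≤ κ³ N³ b³`.
  · set w : GridFn 3 J := fun p => U p ^ 4 with hw
    have hw0 : ∀ p, 0 ≤ w p := fun p => by positivity
    have hV : ∀ k, h ^ 2 * lineSum h L k w ≤ κ * b * N := fun k => by
      have := pow_mul_lineSum_le hL hpos k 2 (by norm_num) (w := w) (U := U) (V := U ^ 3)
        (fun p => by
          simp only [hw, Pi.pow_apply]
          rw [← abs_mul]
          exact (le_of_eq (by ring)).trans (le_abs_self _))
        fun p r => abs_pow_four_sub_le _ _
      rw [pow_succ', mul_assoc] at this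
      exact le_of_mul_le_mul_left this hpos
    have h1 : (b ^ 2) ^ 2
        ≤ (h ^ 2 * lineSum h L 0 w) * (h ^ 2 * lineSum h L 1 w) * (h ^ 2 * lineSum h L 2 w) := by
      have h2 := sq_sum_le_lineSum_three hJh hpos w (fun p => U p ^ 6) hw0 fun p => by
        rw [hw]; ring
      rw [hb2]
      calc (h ^ 3 * ∑ p, U p ^ 6) ^ 2 = h ^ 6 * (∑ p, U p ^ 6) ^ 2 := by ring
        _ ≤ h ^ 6 * (lineSum h L 0 w * lineSum h L 1 w * lineSum h L 2 w) := by gcongr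
        _ = _ := by ring
    have hl0 := fun k => lineSum_nonneg hL hpos k hw0
    have h3 : (b ^ 2) ^ 2 ≤ (κ * b * N) * (κ * b * N) * (κ * b * N) := by
      refine h1.trans ?_
      have := hl0 0
      have := hl0 1
      have := hl0 2
      exact mul_le_mul (mul_le_mul (hV 0) (hV 1) (by positivity) (by positivity)) (hV 2)
        (by positivity) (by positivity)
    have h5 : b * b ^ 3 ≤ κ ^ 3 * N ^ 3 * b ^ 3 := by
      calc b * b ^ 3 = (b ^ 2) ^ 2 := by ring
        _ ≤ _ := h3
        _ = _ := by ring
    have h6 := le_of_mul_le_mul_right h5 (by positivity)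
    refine h6.trans ?_
    gcongr
    have : 0 < κ ^ 2 := by positivity
    linarith

/-! ### Families of smooth periodic functions with uniformly bounded derivatives -/

section SmoothFamilies

open MeasureTheory

variable {d : ℕ} {ι : Type*} {L : ℝ} {n : ℕ}

/-- A family of `L`-periodic functions of class `C^n` with derivatives up to order `n` bounded
uniformly over the family. -/
structure SmoothFam (L : ℝ) (n : ℕ) (F : ι → (Fin d → ℝ) → ℝ) : Prop where
  periodic : ∀ i k, Function.Periodic (F i) (Pi.single k L)
  contDiff : ∀ i, ContDiff ℝ n (F i)
  bounded : ∃ R : ℝ, ∀ i, ∀ m ≤ n, ∀ x, ‖iteratedFDeriv ℝ m (F i) x‖ ≤ R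

namespace SmoothFam

variable {F G : ι → (Fin d → ℝ) → ℝ}

theorem exists_bound (hF : SmoothFam L n F) :
    ∃ R : ℝ, 0 ≤ R ∧ ∀ i, ∀ m ≤ n, ∀ x, ‖iteratedFDeriv ℝ m (F i) x‖ ≤ R := by
  obtain ⟨R, hR⟩ := hF.bounded
  exact ⟨|R|, abs_nonneg _, fun i m hm x => (hR i m hm x).trans (le_abs_self R)⟩

theorem exists_abs_le (hF : SmoothFam L n F) : ∃ R : ℝ, 0 ≤ R ∧ ∀ i x, |F i x| ≤ R := by
  obtain ⟨R, h0, hR⟩ := hF.exists_bound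
  exact ⟨R, h0, fun i x => by simpa using hR i 0 (Nat.zero_le _) x⟩

theorem of_le (hF : SmoothFam L n F) {m : ℕ} (hm : m ≤ n) : SmoothFam L m F where
  periodic := hF.periodic
  contDiff i := (hF.contDiff i).of_le (by exact_mod_cast hm)
  bounded := hF.bounded.imp fun _ h i j hj x => h i j (hj.trans hm) x

theorem const (c : ℝ) : SmoothFam L n (fun (_ : ι) (_ : Fin d → ℝ) => c) where
  periodic _ _ _ := rfl
  contDiff _ := contDiff_const
  bounded := ⟨|c|, fun _ m _ x => by
    rcases Nat.eq_zero_or_pos m with rfl | hm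
    · simp
    · rw [iteratedFDeriv_const_of_ne hm.ne']; simp⟩

theorem add (hF : SmoothFam L n F) (hG : SmoothFam L n G) :
    SmoothFam L n (fun i x => F i x + G i x) where
  periodic i k x := by simp only [hF.periodic i k x, hG.periodic i k x]
  contDiff i := (hF.contDiff i).add (hG.contDiff i)
  bounded := by
    obtain ⟨R, h0, hR⟩ := hF.exists_bound
    obtain ⟨R', h0', hR'⟩ := hG.exists_bound
    refine ⟨R + R', fun i m hm x => ?_⟩
    have e := iteratedFDeriv_add_apply (x := x)
      (((hF.contDiff i).of_le (by exact_mod_cast hm : (m : WithTop ℕ∞) ≤ n)).contDiffAt)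
      (((hG.contDiff i).of_le (by exact_mod_cast hm : (m : WithTop ℕ∞) ≤ n)).contDiffAt)
    change ‖iteratedFDeriv ℝ m (F i + G i) x‖ ≤ _
    rw [e]
    exact (norm_add_le _ _).trans (add_le_add (hR i m hm x) (hR' i m hm x))

theorem mul (hF : SmoothFam L n F) (hG : SmoothFam L n G) :
    SmoothFam L n (fun i x => F i x * G i x) where
  periodic i k x := by simp only [hF.periodic i k x, hG.periodic i k x]
  contDiff i := (hF.contDiff i).mul (hG.contDiff i)
  bounded := by
    obtain ⟨R, h0, hR⟩ := hF.exists_bound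
    obtain ⟨R', h0', hR'⟩ := hG.exists_bound
    refine ⟨2 ^ n * (R * R'), fun i m hm x => ?_⟩
    refine (norm_iteratedFDeriv_mul_le (hF.contDiff i) (hG.contDiff i) x
      (by exact_mod_cast hm)).trans ?_
    calc ∑ j ∈ Finset.range (m + 1), (m.choose j : ℝ) * ‖iteratedFDeriv ℝ j (F i) x‖
          * ‖iteratedFDeriv ℝ (m - j) (G i) x‖
        ≤ ∑ j ∈ Finset.range (m + 1), (m.choose j : ℝ) * R * R' := by
          gcongr with j hj
          · exact hR i j ((Nat.lt_succ_iff.1 (Finset.mem_range.1 hj)).trans hm) x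
          · exact hR' i _ ((Nat.sub_le _ _).trans hm) x
      _ = 2 ^ m * (R * R') := by
          simp only [mul_assoc]
          rw [← Finset.sum_mul]
          congr 1
          exact_mod_cast Nat.sum_range_choose m
      _ ≤ 2 ^ n * (R * R') := by gcongr; norm_num

theorem const_mul (c : ℝ) (hF : SmoothFam L n F) : SmoothFam L n (fun i x => c * F i x) :=
  (const c).mul hF

theorem sub (hF : SmoothFam L n F) (hG : SmoothFam L n G) :
    SmoothFam L n (fun i x => F i x - G i x) := by
  have := hF.add (hG.const_mul (-1))
  simpa only [neg_one_mul, ← sub_eq_add_neg] using this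

theorem pow (hF : SmoothFam L n F) (m : ℕ) : SmoothFam L n (fun i x => F i x ^ m) := by
  induction m with
  | zero => simpa using const 1
  | succ m ih => simpa only [pow_succ] using ih.mul hF

theorem sum {κ : Type*} (s : Finset κ) {F : κ → ι → (Fin d → ℝ) → ℝ}
    (hF : ∀ j ∈ s, SmoothFam L n (F j)) : SmoothFam L n (fun i x => ∑ j ∈ s, F j i x) := by
  classical
  induction s using Finset.induction_on with
  | empty => simpa using const 0
  | insert a s ha ih =>
    simp only [Finset.sum_insert ha]
    exact (hF a (Finset.mem_insert_self _ _)).add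
      (ih fun j hj => hF j (Finset.mem_insert_of_mem hj))

end SmoothFam

/-- Derivative in the direction `v`. -/
noncomputable def dirDeriv (v : Fin d → ℝ) (f : (Fin d → ℝ) → ℝ) (x : Fin d → ℝ) : ℝ :=
  fderiv ℝ f x v

theorem contDiff_dirDeriv {f : (Fin d → ℝ) → ℝ} (v : Fin d → ℝ) (hf : ContDiff ℝ (n + 1 : ℕ) f) :
    ContDiff ℝ n (dirDeriv v f) :=
  (hf.fderiv_right (m := n) (by norm_cast)).clm_apply contDiff_const

theorem norm_iteratedFDeriv_dirDeriv_le {f : (Fin d → ℝ) → ℝ} (v x : Fin d → ℝ) (m : ℕ)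
    (hf : ContDiff ℝ (m + 1 : ℕ) f) :
    ‖iteratedFDeriv ℝ m (dirDeriv v f) x‖ ≤ ‖v‖ * ‖iteratedFDeriv ℝ (m + 1) f x‖ := by
  have := norm_iteratedFDeriv_clm_apply_const (𝕜 := ℝ) (f := fderiv ℝ f) (c := v) (x := x)
    (N := m) (n := m) ((hf.fderiv_right (m := m) (by norm_cast)).contDiffAt) le_rfl
  rwa [norm_iteratedFDeriv_fderiv] at this

theorem SmoothFam.dirDeriv {F : ι → (Fin d → ℝ) → ℝ} (v : Fin d → ℝ)
    (hF : SmoothFam L (n + 1) F) : SmoothFam L n (fun i => dirDeriv v (F i)) where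
  periodic i k x := by
    have : F i = fun y => F i (y + Pi.single k L) := funext fun y => (hF.periodic i k y).symm
    conv_rhs => rw [SmA.dirDeriv, this, fderiv_comp_add_right]
    rfl
  contDiff i := contDiff_dirDeriv v (hF.contDiff i)
  bounded := by
    obtain ⟨R, h0, hR⟩ := hF.exists_bound
    refine ⟨‖v‖ * R, fun i m hm x => ?_⟩
    refine (norm_iteratedFDeriv_dirDeriv_le v x m ((hF.contDiff i).of_le ?_)).trans ?_
    · exact_mod_cast Nat.succ_le_succ hm
    · gcongr; exact hR i _ (Nat.succ_le_succ hm) x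

theorem SmoothFam.pd {F : ι → (Fin d → ℝ) → ℝ} (k : Fin d)
    (hF : SmoothFam L (n + 1) F) : SmoothFam L n (fun i => pd k (F i)) :=
  hF.dirDeriv (Pi.single k 1)

/-! ### Taylor estimates for difference stencils -/

/-- The mean value inequality on the unit interval. Iterating it gives the Taylor estimates below;
factorials are given up, since the constants are immaterial. -/
theorem abs_le_of_hasDerivAt {f f' : ℝ → ℝ} {C : ℝ} (h0 : f 0 = 0)
    (hf : ∀ t, HasDerivAt f (f' t) t) (hC : ∀ t ∈ Icc (0 : ℝ) 1, |f' t| ≤ C) :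
    ∀ t ∈ Icc (0 : ℝ) 1, |f t| ≤ C := by
  intro t ht
  have := Convex.norm_image_sub_le_of_norm_hasDerivWithin_le (s := Icc (0 : ℝ) 1) (f := f)
    (f' := f') (C := C) (fun x _ => (hf x).hasDerivWithinAt) (fun x hx => hC x hx)
    (convex_Icc 0 1) (left_mem_Icc.2 zero_le_one) ht
  rw [h0, sub_zero, sub_zero, Real.norm_eq_abs, Real.norm_eq_abs, abs_of_nonneg ht.1] at this
  have hC0 : 0 ≤ C := (abs_nonneg _).trans (hC 0 (left_mem_Icc.2 zero_le_one))
  exact this.trans (mul_le_of_le_one_right hC0 ht.2)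

theorem hasDerivAt_line {f : (Fin d → ℝ) → ℝ} (hf : Differentiable ℝ f) (x v : Fin d → ℝ)
    (t : ℝ) : HasDerivAt (fun t : ℝ => f (x + t • v)) (dirDeriv v f (x + t • v)) t := by
  have h1 : HasDerivAt (fun t : ℝ => x + t • v) v t := by
    simpa using ((hasDerivAt_id t).smul_const v).const_add x
  exact (hf (x + t • v)).hasFDerivAt.comp_hasDerivAt t h1

theorem hasDerivAt_line_neg {f : (Fin d → ℝ) → ℝ} (hf : Differentiable ℝ f) (x v : Fin d → ℝ)
    (t : ℝ) : HasDerivAt (fun t : ℝ => f (x + (-t) • v)) (-dirDeriv v f (x + (-t) • v)) t := by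
  have := (hasDerivAt_line hf x v (-t)).scomp t (hasDerivAt_neg t)
  rwa [neg_one_smul] at this

theorem abs_dirDeriv_le {f : (Fin d → ℝ) → ℝ} (v x : Fin d → ℝ) (hf : ContDiff ℝ 1 f) :
    |dirDeriv v f x| ≤ ‖v‖ * ‖iteratedFDeriv ℝ 1 f x‖ := by
  simpa using norm_iteratedFDeriv_dirDeriv_le v x 0 hf

theorem abs_dirDeriv_two_le {f : (Fin d → ℝ) → ℝ} (v x : Fin d → ℝ) (hf : ContDiff ℝ 2 f) :
    |dirDeriv v (dirDeriv v f) x| ≤ ‖v‖ ^ 2 * ‖iteratedFDeriv ℝ 2 f x‖ := by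
  refine (abs_dirDeriv_le v x (contDiff_dirDeriv (n := 1) v hf)).trans ?_
  have := norm_iteratedFDeriv_dirDeriv_le v x 1 hf
  calc _ ≤ ‖v‖ * (‖v‖ * ‖iteratedFDeriv ℝ 2 f x‖) := by gcongr
    _ = _ := by ring

theorem abs_dirDeriv_four_le {f : (Fin d → ℝ) → ℝ} (v x : Fin d → ℝ) (hf : ContDiff ℝ 4 f) :
    |dirDeriv v (dirDeriv v (dirDeriv v (dirDeriv v f))) x|
      ≤ ‖v‖ ^ 4 * ‖iteratedFDeriv ℝ 4 f x‖ := by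
  have c1 : ContDiff ℝ 3 (dirDeriv v f) := contDiff_dirDeriv (n := 3) v hf
  have c2 : ContDiff ℝ 2 (dirDeriv v (dirDeriv v f)) := contDiff_dirDeriv (n := 2) v c1
  refine (abs_dirDeriv_two_le v x c2).trans ?_
  have h1 := norm_iteratedFDeriv_dirDeriv_le v x 2 c1
  have h2 := norm_iteratedFDeriv_dirDeriv_le v x 3 hf
  calc _ ≤ ‖v‖ ^ 2 * (‖v‖ * (‖v‖ * ‖iteratedFDeriv ℝ 4 f x‖)) := by
        gcongr
        exact h1.trans (by gcongr)
    _ = _ := by ring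

theorem abs_sub_le_of_contDiff_one {f : (Fin d → ℝ) → ℝ} {R : ℝ} (hf : ContDiff ℝ 1 f)
    (hR : ∀ x, ‖iteratedFDeriv ℝ 1 f x‖ ≤ R) (x v : Fin d → ℝ) :
    |f (x + v) - f x| ≤ R * ‖v‖ := by
  have := abs_le_of_hasDerivAt (f := fun t => f (x + t • v) - f x)
    (f' := fun t => dirDeriv v f (x + t • v)) (C := R * ‖v‖) (by simp)
    (fun t => (hasDerivAt_line (hf.differentiable (by norm_num)) x v t).sub_const _)
    (fun t _ => (abs_dirDeriv_le v _ hf).trans (by rw [mul_comm]; gcongr; exact hR _))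
    1 (right_mem_Icc.2 zero_le_one)
  simpa using this

theorem abs_second_difference_le {f : (Fin d → ℝ) → ℝ} {R : ℝ} (hf : ContDiff ℝ 2 f)
    (hR : ∀ x, ‖iteratedFDeriv ℝ 2 f x‖ ≤ R) (x v : Fin d → ℝ) :
    |f (x + v) + f (x - v) - 2 * f x| ≤ 2 * R * ‖v‖ ^ 2 := by
  have c1 : ContDiff ℝ 1 (dirDeriv v f) := contDiff_dirDeriv (n := 1) v hf
  have d0 : Differentiable ℝ f := hf.differentiable (by norm_num)
  have d1 := c1.differentiable (by norm_num)
  have hb : ∀ y, |dirDeriv v (dirDeriv v f) y| ≤ R * ‖v‖ ^ 2 := fun y =>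
    (abs_dirDeriv_two_le v y hf).trans (by rw [mul_comm]; gcongr; exact hR _)
  have s2 := abs_le_of_hasDerivAt (C := 2 * R * ‖v‖ ^ 2)
    (f := fun t => dirDeriv v f (x + t • v) - dirDeriv v f (x + (-t) • v))
    (f' := fun t => dirDeriv v (dirDeriv v f) (x + t • v)
      - -dirDeriv v (dirDeriv v f) (x + (-t) • v)) (by simp)
    (fun t => (hasDerivAt_line d1 x v t).sub (hasDerivAt_line_neg d1 x v t))
    (fun t _ => by
      rw [sub_neg_eq_add]
      refine (abs_add_le _ _).trans ?_
      linarith [hb (x + t • v), hb (x + (-t) • v)])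
  have s1 := abs_le_of_hasDerivAt (C := 2 * R * ‖v‖ ^ 2)
    (f := fun t => f (x + t • v) + f (x + (-t) • v) - 2 * f x)
    (f' := fun t => dirDeriv v f (x + t • v) + -dirDeriv v f (x + (-t) • v))
    (by simp; ring)
    (fun t => ((hasDerivAt_line d0 x v t).add (hasDerivAt_line_neg d0 x v t)).sub_const _)
    (fun t ht => by simpa [← sub_eq_add_neg] using s2 t ht)
    1 (right_mem_Icc.2 zero_le_one)
  simpa [← sub_eq_add_neg] using s1

/-- The symmetric stencil along `t ↦ x ± t v` cancels all odd Taylor terms, so after removal of the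
quadratic term the remainder is of fourth order. The bound is lifted from the fourth derivative
through four successive antiderivatives, each vanishing at `t = 0`. -/
theorem abs_second_difference_sub_le {f : (Fin d → ℝ) → ℝ} {R : ℝ} (hf : ContDiff ℝ 4 f)
    (hR : ∀ x, ‖iteratedFDeriv ℝ 4 f x‖ ≤ R) (x v : Fin d → ℝ) :
    |f (x + v) + f (x - v) - 2 * f x - dirDeriv v (dirDeriv v f) x| ≤ 2 * R * ‖v‖ ^ 4 := by
  have c1 : ContDiff ℝ 3 (dirDeriv v f) := contDiff_dirDeriv (n := 3) v hf
  have c2 : ContDiff ℝ 2 (dirDeriv v (dirDeriv v f)) := contDiff_dirDeriv (n := 2) v c1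
  have c3 : ContDiff ℝ 1 (dirDeriv v (dirDeriv v (dirDeriv v f))) :=
    contDiff_dirDeriv (n := 1) v c2
  set f1 := dirDeriv v f with hf1
  set f2 := dirDeriv v f1 with hf2
  set f3 := dirDeriv v f2 with hf3
  have d0 : Differentiable ℝ f := hf.differentiable (by norm_num)
  have d1 := c1.differentiable (by norm_num)
  have d2 := c2.differentiable (by norm_num)
  have d3 := c3.differentiable (by norm_num)
  have hb : ∀ y, |dirDeriv v f3 y| ≤ R * ‖v‖ ^ 4 := fun y =>
    (abs_dirDeriv_four_le v y hf).trans (by rw [mul_comm]; gcongr; exact hR _)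
  have s4 := abs_le_of_hasDerivAt (C := 2 * R * ‖v‖ ^ 4)
    (f := fun t => f3 (x + t • v) - f3 (x + (-t) • v))
    (f' := fun t => dirDeriv v f3 (x + t • v) - -dirDeriv v f3 (x + (-t) • v)) (by simp)
    (fun t => (hasDerivAt_line d3 x v t).sub (hasDerivAt_line_neg d3 x v t))
    (fun t _ => by
      rw [sub_neg_eq_add]
      refine (abs_add_le _ _).trans ?_
      linarith [hb (x + t • v), hb (x + (-t) • v)])
  have s3 := abs_le_of_hasDerivAt (C := 2 * R * ‖v‖ ^ 4)
    (f := fun t => f2 (x + t • v) + f2 (x + (-t) • v) - 2 * f2 x)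
    (f' := fun t => f3 (x + t • v) + -f3 (x + (-t) • v)) (by simp; ring)
    (fun t => ((hasDerivAt_line d2 x v t).add (hasDerivAt_line_neg d2 x v t)).sub_const _)
    (fun t ht => by simpa [← sub_eq_add_neg] using s4 t ht)
  have s2 := abs_le_of_hasDerivAt (C := 2 * R * ‖v‖ ^ 4)
    (f := fun t => f1 (x + t • v) - f1 (x + (-t) • v) - t * (2 * f2 x))
    (f' := fun t => f2 (x + t • v) - -f2 (x + (-t) • v) - 1 * (2 * f2 x)) (by simp)
    (fun t => ((hasDerivAt_line d1 x v t).sub (hasDerivAt_line_neg d1 x v t)).sub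
      ((hasDerivAt_id t).mul_const _))
    (fun t ht => by simpa using s3 t ht)
  have s1 := abs_le_of_hasDerivAt (C := 2 * R * ‖v‖ ^ 4)
    (f := fun t => f (x + t • v) + f (x + (-t) • v) - 2 * f x - t ^ 2 * f2 x)
    (f' := fun t => f1 (x + t • v) + -f1 (x + (-t) • v) - (2 * t) * f2 x) (by simp; ring)
    (fun t => (((hasDerivAt_line d0 x v t).add (hasDerivAt_line_neg d0 x v t)).sub_const _).sub
      (by simpa using ((hasDerivAt_pow 2 t).mul_const (f2 x))))
    (fun t ht => by
      have := s2 t ht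
      rwa [← sub_eq_add_neg, mul_comm 2 t, mul_assoc])
    1 (right_mem_Icc.2 zero_le_one)
  simpa [← sub_eq_add_neg] using s1

theorem dirDeriv_dirDeriv {f : (Fin d → ℝ) → ℝ} (hf : ContDiff ℝ 2 f) (v w x : Fin d → ℝ) :
    dirDeriv v (dirDeriv w f) x = fderiv ℝ (fderiv ℝ f) x v w := by
  have hd : DifferentiableAt ℝ (fderiv ℝ f) x :=
    (hf.fderiv_right (m := 1) (by norm_num)).differentiable (by norm_num) x
  change fderiv ℝ (fun y => fderiv ℝ f y w) x v = _
  rw [fderiv_clm_apply hd (differentiableAt_const w)]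
  simp

/-- Polarization of the symmetric second derivative. It reduces mixed differences to pure second
differences in the two diagonal directions. -/
theorem mixed_second_derivative {f : (Fin d → ℝ) → ℝ} (hf : ContDiff ℝ 2 f)
    (v w x : Fin d → ℝ) :
    dirDeriv (v + w) (dirDeriv (v + w) f) x - dirDeriv (v - w) (dirDeriv (v - w) f) x
      = 4 * dirDeriv v (dirDeriv w f) x := by
  have hs : fderiv ℝ (fderiv ℝ f) x w v = fderiv ℝ (fderiv ℝ f) x v w :=
    (hf.contDiffAt.isSymmSndFDerivAt (by simp)) w v
  simp only [dirDeriv_dirDeriv hf, map_add, map_sub, add_apply,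
    sub_apply, hs]
  ring

/-- The nested central difference is the difference of two pure second differences along `v + w` and
`v - w`. Each vector has length at most `2h`, giving `2 · 2R (2h)⁴ / (4h²) = 16 R h²`. If `k = l`,
then `v - w = 0` and the second stencil vanishes, so no case distinction is needed. -/
theorem abs_cross_difference_sub_le {f : (Fin d → ℝ) → ℝ} {R : ℝ} (hf : ContDiff ℝ 4 f)
    (hR : ∀ x, ‖iteratedFDeriv ℝ 4 f x‖ ≤ R) (x : Fin d → ℝ) {h : ℝ} (hh : 0 < h) (k l : Fin d) :
    |(f (x + (h • Pi.single k 1 + h • Pi.single l 1))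
        + f (x - (h • Pi.single k 1 + h • Pi.single l 1))
        - (f (x + (h • Pi.single k 1 - h • Pi.single l 1))
          + f (x - (h • Pi.single k 1 - h • Pi.single l 1)))) / (4 * h ^ 2)
        - pd k (pd l f) x| ≤ 16 * R * h ^ 2 := by
  have hR0 : 0 ≤ R := (norm_nonneg _).trans (hR x)
  set v : Fin d → ℝ := h • Pi.single k 1 with hv
  set w : Fin d → ℝ := h • Pi.single l 1 with hw
  have nv : ‖v‖ ≤ h := by
    rw [hv, norm_smul, Pi.norm_single]; simp [abs_of_pos hh]
  have nw : ‖w‖ ≤ h := by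
    rw [hw, norm_smul, Pi.norm_single]; simp [abs_of_pos hh]
  have n1 : ‖v + w‖ ^ 4 ≤ (2 * h) ^ 4 :=
    pow_le_pow_left₀ (norm_nonneg _) ((norm_add_le _ _).trans (by linarith)) 4
  have n2 : ‖v - w‖ ^ 4 ≤ (2 * h) ^ 4 :=
    pow_le_pow_left₀ (norm_nonneg _) ((norm_sub_le _ _).trans (by linarith)) 4
  have t1 := abs_le.1 ((abs_second_difference_sub_le hf hR x (v + w)).trans
    (mul_le_mul_of_nonneg_left n1 (by positivity)))
  have t2 := abs_le.1 ((abs_second_difference_sub_le hf hR x (v - w)).trans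
    (mul_le_mul_of_nonneg_left n2 (by positivity)))
  have hm := mixed_second_derivative (hf.of_le (by norm_num)) v w x
  have he : dirDeriv v (dirDeriv w f) x = h ^ 2 * pd k (pd l f) x := by
    have hf2 : ContDiff ℝ 2 f := hf.of_le (by norm_num)
    change _ = h ^ 2 * dirDeriv (Pi.single k 1) (dirDeriv (Pi.single l 1) f) x
    rw [dirDeriv_dirDeriv hf2, dirDeriv_dirDeriv hf2, hv, hw, map_smul, map_smul,
      smul_apply, smul_eq_mul, smul_eq_mul]
    ring
  rw [he] at hm
  have h4 : (0 : ℝ) < 4 * h ^ 2 := by positivity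
  rw [abs_le]
  constructor
  · rw [le_sub_iff_add_le, le_div_iff₀ h4]
    nlinarith
  · rw [sub_le_iff_le_add, div_le_iff₀ h4]
    nlinarith

end SmoothFamilies

/-! ### Restriction of smooth periodic functions to the grid -/

section Restriction

open MeasureTheory

variable {d J : ℕ} {L : ℝ}

theorem mesh_pos [NeZero J] (hL : 0 < L) : 0 < mesh L J :=
  div_pos hL (by exact_mod_cast NeZero.pos J)

theorem card_mul_mesh [NeZero J] : (J : ℝ) * mesh L J = L := by
  have hJ : (J : ℝ) ≠ 0 := by exact_mod_cast NeZero.ne J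
  rw [mesh]; field_simp

theorem mesh_le [NeZero J] (hL : 0 < L) : mesh L J ≤ L :=
  div_le_self hL.le (by exact_mod_cast NeZero.one_le (n := J))

theorem periodic_congr {f : (Fin d → ℝ) → ℝ} (hf : ∀ k, Function.Periodic f (Pi.single k L))
    {x y : Fin d → ℝ} (m : Fin d → ℤ) (hxy : ∀ k, x k = y k + m k * L) : f x = f y := by
  have key : ∀ s : Finset (Fin d), f (y + ∑ k ∈ s, m k • Pi.single k L) = f y := by
    intro s
    induction s using Finset.induction_on with
    | empty => simp
    | insert a s ha ih =>
      rw [Finset.sum_insert ha, add_comm (m a • _), ← add_assoc, (hf a).zsmul (m a), ih]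
  rw [← key Finset.univ]
  congr 1
  funext k
  rw [hxy, Pi.add_apply, Finset.sum_apply, Finset.sum_eq_single k]
  · simp
  · intro b _ hb; simp [Pi.single_eq_of_ne (Ne.symm hb)]
  · simp

/-- Grid indices live in `ZMod J`, points in `ℝ^d`. Any integer lift of an index differs from its
canonical value by a multiple of `J`, which is a whole number of periods after scaling by `h`; so
wrap-around never has to be tracked. -/
theorem eq_gridPt_add [NeZero J] {f : (Fin d → ℝ) → ℝ}
    (hf : ∀ k, Function.Periodic f (Pi.single k L)) (z : Fin d → ℤ) (p : Grid d J)
    (hz : ∀ k, (z k : ZMod J) = p k) {x y : Fin d → ℝ} (hx : ∀ k, x k = mesh L J * z k + y k) :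
    f x = f (gridPt L p + y) := by
  have : ∀ k, ∃ m : ℤ, z k = (p k).val + J * m := fun k => by
    have h1 : (((p k).val : ℤ) : ZMod J) = (z k : ZMod J) := by
      rw [hz k, Int.cast_natCast, ZMod.natCast_zmod_val]
    obtain ⟨m, hm⟩ := (ZMod.intCast_eq_intCast_iff_dvd_sub _ _ _).1 h1
    exact ⟨m, by linarith⟩
  choose m hm using this
  refine periodic_congr hf m fun k => ?_
  have e : (J : ℝ) * mesh L J = L := card_mul_mesh
  rw [hx, hm, Pi.add_apply, gridPt]
  push_cast
  linear_combination (m k : ℝ) * e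

theorem apply_gridPt_add_single [NeZero J] {f : (Fin d → ℝ) → ℝ}
    (hf : ∀ k, Function.Periodic f (Pi.single k L)) (p : Grid d J) (k : Fin d) (y : Fin d → ℝ) :
    f (gridPt L (p + Pi.single k 1) + y) = f (gridPt L p + (mesh L J • Pi.single k 1 + y)) := by
  symm
  refine eq_gridPt_add hf (fun i => (p i).val + (Pi.single k 1 : Fin d → ℤ) i) _ (fun i => ?_)
    fun i => ?_
  · rcases eq_or_ne i k with rfl | hi
    · simp
    · simp [hi]
  · rcases eq_or_ne i k with rfl | hi
    · simp [gridPt]; ring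
    · simp [gridPt, hi]

theorem apply_gridPt_sub_single [NeZero J] {f : (Fin d → ℝ) → ℝ}
    (hf : ∀ k, Function.Periodic f (Pi.single k L)) (p : Grid d J) (k : Fin d) (y : Fin d → ℝ) :
    f (gridPt L (p - Pi.single k 1) + y) = f (gridPt L p + (-(mesh L J • Pi.single k 1) + y)) := by
  have := apply_gridPt_add_single hf (p - Pi.single k 1) k (-(mesh L J • Pi.single k 1) + y)
  rw [sub_add_cancel, add_neg_cancel_left] at this
  exact this.symm

theorem apply_neg_gridPt [NeZero J] {f : (Fin d → ℝ) → ℝ}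
    (hf : ∀ k, Function.Periodic f (Pi.single k L)) (p : Grid d J) (y : Fin d → ℝ) :
    f (-gridPt L p + y) = f (gridPt L (-p) + y) := by
  refine eq_gridPt_add hf (fun i => -((p i).val : ℤ)) _ (fun i => by simp) fun i => ?_
  simp [gridPt]

theorem apply_gridPt_add_single' [NeZero J] {f : (Fin d → ℝ) → ℝ}
    (hf : ∀ k, Function.Periodic f (Pi.single k L)) (p : Grid d J) (k : Fin d) :
    f (gridPt L (p + Pi.single k 1)) = f (gridPt L p + mesh L J • Pi.single k 1) := by
  simpa using apply_gridPt_add_single hf p k 0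

theorem apply_gridPt_sub_single' [NeZero J] {f : (Fin d → ℝ) → ℝ}
    (hf : ∀ k, Function.Periodic f (Pi.single k L)) (p : Grid d J) (k : Fin d) :
    f (gridPt L (p - Pi.single k 1)) = f (gridPt L p - mesh L J • Pi.single k 1) := by
  simpa [sub_eq_add_neg] using apply_gridPt_sub_single hf p k 0

theorem norm_smul_single {h : ℝ} (hh : 0 < h) (k : Fin d) :
    ‖(h • Pi.single k 1 : Fin d → ℝ)‖ = h := by
  rw [norm_smul, Pi.norm_single]; simp [abs_of_pos hh]

/-- Second order consistency of the central mixed second difference. -/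
theorem abs_dCtr_dCtr_sub_le [NeZero J] (hL : 0 < L) {f : (Fin d → ℝ) → ℝ} {R : ℝ}
    (hf : ContDiff ℝ 4 f) (hp : ∀ k, Function.Periodic f (Pi.single k L))
    (hR : ∀ x, ‖iteratedFDeriv ℝ 4 f x‖ ≤ R) (k l : Fin d) (p : Grid d J) :
    |dCtr (mesh L J) k (dCtr (mesh L J) l (gridRestrict L f)) p - pd k (pd l f) (gridPt L p)|
      ≤ 16 * R * mesh L J ^ 2 := by
  have hh : 0 < mesh L J := mesh_pos hL
  have := abs_cross_difference_sub_le hf hR (gridPt L p) hh k l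
  refine le_of_eq_of_le ?_ this
  congr 2
  simp only [dCtr, LinearMap.coe_mk, AddHom.coe_mk, gridRestrict]
  rw [apply_gridPt_add_single' hp, apply_gridPt_sub_single' hp, apply_gridPt_add_single' hp,
    apply_gridPt_sub_single' hp, apply_gridPt_add_single hp, sub_eq_add_neg (gridPt L (p + _)),
    apply_gridPt_add_single hp, apply_gridPt_sub_single hp, sub_eq_add_neg (gridPt L (p - _)),
    apply_gridPt_sub_single hp]
  simp only [sub_eq_add_neg, neg_add, neg_neg]
  field_simp
  ring

theorem abs_dFwd_gridRestrict_le [NeZero J] (hL : 0 < L) {f : (Fin d → ℝ) → ℝ} {R : ℝ}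
    (hf : ContDiff ℝ 1 f) (hp : ∀ k, Function.Periodic f (Pi.single k L))
    (hR : ∀ x, ‖iteratedFDeriv ℝ 1 f x‖ ≤ R) (k : Fin d) (p : Grid d J) :
    |dFwd (mesh L J) k (gridRestrict L f) p| ≤ R := by
  have hh : 0 < mesh L J := mesh_pos hL
  have := abs_sub_le_of_contDiff_one hf hR (gridPt L p) (mesh L J • Pi.single k 1)
  rw [norm_smul_single hh] at this
  simp only [dFwd, LinearMap.coe_mk, AddHom.coe_mk, gridRestrict]
  rwa [apply_gridPt_add_single' hp, abs_div, abs_of_pos hh, div_le_iff₀ hh]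

theorem abs_lapH_gridRestrict_le [NeZero J] (hL : 0 < L) {f : (Fin d → ℝ) → ℝ} {R : ℝ}
    (hf : ContDiff ℝ 2 f) (hp : ∀ k, Function.Periodic f (Pi.single k L))
    (hR : ∀ x, ‖iteratedFDeriv ℝ 2 f x‖ ≤ R) (p : Grid d J) :
    |lapH (mesh L J) (gridRestrict L f) p| ≤ d * (2 * R) := by
  have hh : 0 < mesh L J := mesh_pos hL
  have key : ∀ k, |dFwd (mesh L J) k (dBwd (mesh L J) k (gridRestrict L f)) p| ≤ 2 * R := fun k => by
    have := abs_second_difference_le hf hR (gridPt L p) (mesh L J • Pi.single k 1)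
    rw [norm_smul_single hh] at this
    have e : dFwd (mesh L J) k (dBwd (mesh L J) k (gridRestrict L f)) p
        = (f (gridPt L p + mesh L J • Pi.single k 1) + f (gridPt L p - mesh L J • Pi.single k 1)
          - 2 * f (gridPt L p)) / mesh L J ^ 2 := by
      simp only [dFwd, dBwd, LinearMap.coe_mk, AddHom.coe_mk, gridRestrict, add_sub_cancel_right]
      rw [apply_gridPt_add_single' hp, apply_gridPt_sub_single' hp]
      field_simp
      ring
    rwa [e, abs_div, abs_of_pos (by positivity : 0 < mesh L J ^ 2), div_le_iff₀ (by positivity)]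
  rw [lapH_apply, Finset.sum_apply]
  refine (Finset.abs_sum_le_sum_abs _ _).trans ((Finset.sum_le_sum fun k _ => key k).trans ?_)
  simp

/-- Discrete `H²` norms of restrictions of a smooth family are uniformly bounded. -/
theorem SmoothFam.exists_normH2_le {ι : Type*} {F : ι → (Fin d → ℝ) → ℝ} (hL : 0 < L)
    (hF : SmoothFam L 2 F) : ∃ C : ℝ, 0 ≤ C ∧ ∀ (J : ℕ) [NeZero J] (i : ι),
      normH2 (mesh L J) (gridRestrict L (F i) : GridFn d J) ≤ C := by
  obtain ⟨R, h0, hR⟩ := hF.exists_bound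
  refine ⟨R * √(L ^ d) + ∑ _k : Fin d, R * √(L ^ d) + d * (2 * R) * √(L ^ d), by positivity,
    fun J _ i => ?_⟩
  have hh : 0 < mesh L J := mesh_pos hL
  have hJ : (J : ℝ) * mesh L J = L := card_mul_mesh
  refine (normH2_le_add hh.le _).trans (add_le_add ((normH1_le_sum hh.le _).trans
    (add_le_add ?_ (Finset.sum_le_sum fun k _ => ?_))) ?_)
  · exact normL2_le_of_abs_le hh.le hJ fun p => by
      simpa [gridRestrict] using hR i 0 (by norm_num) (gridPt L p)
  · exact normL2_le_of_abs_le hh.le hJ fun p =>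
      abs_dFwd_gridRestrict_le hL ((hF.contDiff i).of_le (by norm_num)) (hF.periodic i)
        (hR i 1 (by norm_num)) k p
  · exact normL2_le_of_abs_le hh.le hJ fun p =>
      abs_lapH_gridRestrict_le hL (hF.contDiff i) (hF.periodic i) (hR i 2 le_rfl) p

/-! ### Riemann sums of periodic functions -/

theorem setIntegral_Ico_eq_translate (f : (Fin d → ℝ) → ℝ) (a : Fin d → ℝ) (h : ℝ) :
    ∫ x in univ.pi fun k => Ico (a k) (a k + h), f x
      = ∫ y in Icc (0 : Fin d → ℝ) (fun _ => h), f (a + y) := by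
  have h1 : (univ.pi fun k => Ico (a k) (a k + h)) =ᵐ[volume] Icc a (a + fun _ => h) :=
    Measure.univ_pi_Ico_ae_eq_Icc
  rw [setIntegral_congr_set h1]
  have h2 := (measurePreserving_add_left (volume : Measure (Fin d → ℝ)) a).setIntegral_preimage_emb
    (measurableEmbedding_addLeft a) f (Icc a (a + fun _ => h))
  rw [← h2]
  congr 2
  ext y
  simp [mem_Icc]

/-- Half-open cells with their nodes as lower corners tile the half-open box exactly; the cell of a
point is found by taking floors. -/
theorem iUnion_cells [NeZero J] (hL : 0 < L) :
    (univ.pi fun _ : Fin d => Ico (0 : ℝ) L)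
      = ⋃ p : Grid d J, univ.pi fun k => Ico (gridPt L p k) (gridPt L p k + mesh L J) := by
  have hh : 0 < mesh L J := mesh_pos hL
  have hJ : (J : ℝ) * mesh L J = L := card_mul_mesh
  ext x
  simp only [mem_univ_pi, mem_Ico, mem_iUnion, gridPt]
  constructor
  · intro hx
    have hlt : ∀ k, ⌊x k / mesh L J⌋₊ < J := fun k => by
      rw [Nat.floor_lt (div_nonneg (hx k).1 hh.le), div_lt_iff₀ hh, hJ]
      exact (hx k).2
    refine ⟨fun k => (⌊x k / mesh L J⌋₊ : ZMod J), fun k => ?_⟩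
    rw [ZMod.val_cast_of_lt (hlt k)]
    have h1 := Nat.floor_le (div_nonneg (hx k).1 hh.le)
    have h2 := Nat.lt_floor_add_one (x k / mesh L J)
    rw [le_div_iff₀ hh] at h1
    rw [div_lt_iff₀ hh] at h2
    constructor <;> linarith
  · rintro ⟨p, hp⟩ k
    have h1 : ((p k).val : ℝ) + 1 ≤ J := by exact_mod_cast ZMod.val_lt (p k)
    have h2 : 0 ≤ mesh L J * ((p k).val : ℝ) := by positivity
    refine ⟨h2.trans (hp k).1, (hp k).2.trans_le ?_⟩
    have h3 := mul_le_mul_of_nonneg_left h1 hh.le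
    linarith

theorem disjoint_cells [NeZero J] (hL : 0 < L) :
    Pairwise (Function.onFun Disjoint fun p : Grid d J =>
      univ.pi fun k => Ico (gridPt L p k) (gridPt L p k + mesh L J)) := by
  have hh : 0 < mesh L J := mesh_pos hL
  intro p r hpr
  rw [Function.onFun, Set.disjoint_left]
  intro x hx hx'
  refine hpr (funext fun k => ZMod.val_injective J ?_)
  have h1 := hx k (mem_univ k)
  have h2 := hx' k (mem_univ k)
  simp only [mem_Ico, gridPt] at h1 h2
  have a1 : ((p k).val : ℝ) < (r k).val + 1 := by
    have : mesh L J * ((p k).val : ℝ) < mesh L J * ((r k).val + 1) := by linarith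
    exact lt_of_mul_lt_mul_left this hh.le
  have a2 : ((r k).val : ℝ) < (p k).val + 1 := by
    have : mesh L J * ((r k).val : ℝ) < mesh L J * ((p k).val + 1) := by linarith
    exact lt_of_mul_lt_mul_left this hh.le
  have b1 : (p k).val < (r k).val + 1 := by exact_mod_cast a1
  have b2 : (r k).val < (p k).val + 1 := by exact_mod_cast a2
  omega

theorem integral_box_eq_sum_cells [NeZero J] (hL : 0 < L) {f : (Fin d → ℝ) → ℝ}
    (hf : Continuous f) :
    ∫ x in Icc (0 : Fin d → ℝ) (fun _ => L), f x
      = ∑ p : Grid d J, ∫ y in Icc (0 : Fin d → ℝ) (fun _ => mesh L J), f (gridPt L p + y) := by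
  have h1 : (univ.pi fun _ : Fin d => Ico (0 : ℝ) L) =ᵐ[volume] Icc (0 : Fin d → ℝ) fun _ => L :=
    Measure.univ_pi_Ico_ae_eq_Icc
  rw [← setIntegral_congr_set h1, iUnion_cells (J := J) hL, integral_iUnion_fintype]
  · exact Finset.sum_congr rfl fun p _ => setIntegral_Ico_eq_translate f _ _
  · exact fun p => MeasurableSet.univ_pi fun k => measurableSet_Ico
  · exact disjoint_cells hL
  · intro p
    refine (hf.continuousOn.integrableOn_compact (isCompact_Icc (a := gridPt L p)
      (b := gridPt L p + fun _ => mesh L J))).mono_set fun x hx => ?_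
    exact ⟨fun k => (hx k (mem_univ k)).1, fun k => (hx k (mem_univ k)).2.le⟩

/-- The reflection `x ↦ L - x` preserves box and measure, and by periodicity it agrees with `x ↦ -x`
under `f`. -/
theorem integral_box_neg {f : (Fin d → ℝ) → ℝ} (hp : ∀ k, Function.Periodic f (Pi.single k L)) :
    ∫ x in Icc (0 : Fin d → ℝ) (fun _ => L), f (-x)
      = ∫ x in Icc (0 : Fin d → ℝ) (fun _ => L), f x := by
  have h2 := (Measure.measurePreserving_sub_left (volume : Measure (Fin d → ℝ))
    (fun _ => L)).setIntegral_preimage_emb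
    (MeasurableEquiv.subLeft (fun _ : Fin d => L)).measurableEmbedding f
    (Icc (0 : Fin d → ℝ) fun _ => L)
  rw [← h2]
  have e : (fun x : Fin d → ℝ => (fun _ => L) - x) ⁻¹' Icc (0 : Fin d → ℝ) (fun _ => L)
      = Icc (0 : Fin d → ℝ) fun _ => L := by
    ext y
    simp [mem_Icc, Pi.le_def, and_comm]
  rw [e]
  congr 1
  funext x
  exact periodic_congr hp (fun _ => -1) fun k => by
    simp only [Pi.sub_apply, Pi.neg_apply]; push_cast; ring

/-- The rectangle rule is second order accurate for periodic functions. -/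
theorem abs_riemann_sum_sub_integral_le [NeZero J] (hL : 0 < L) {f : (Fin d → ℝ) → ℝ} {R : ℝ}
    (hf : ContDiff ℝ 2 f) (hp : ∀ k, Function.Periodic f (Pi.single k L))
    (hR : ∀ x, ‖iteratedFDeriv ℝ 2 f x‖ ≤ R) :
    |mesh L J ^ d * ∑ p : Grid d J, f (gridPt L p) - ∫ x in Icc (0 : Fin d → ℝ) (fun _ => L), f x|
      ≤ L ^ d * R * mesh L J ^ 2 := by
  have hh : 0 < mesh L J := mesh_pos hL
  have hJ : (J : ℝ) * mesh L J = L := card_mul_mesh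
  have hR0 : 0 ≤ R := (norm_nonneg _).trans (hR 0)
  set h := mesh L J with hhdef
  have hfc := hf.continuous
  set Q : Set (Fin d → ℝ) := Icc (0 : Fin d → ℝ) (fun _ => h) with hQ
  have vol : volume.real Q = h ^ d := by
    rw [hQ, Measure.real, Real.volume_Icc_pi]
    simp [ENNReal.toReal_ofReal hh.le]
  have hint : ∀ g : (Fin d → ℝ) → ℝ, Continuous g → IntegrableOn g Q := fun g hg =>
    hg.continuousOn.integrableOn_compact isCompact_Icc
  have i1 := integral_box_eq_sum_cells (J := J) hL hfc
  -- The nodes are corners of the cells, so one cell alone gives a first order error. Representing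
  -- the integral a second time through the reflected function and averaging replaces `f (p + y)` by
  -- the mean of `f (p + y)` and `f (p - y)`, whose deviation from `f p` is a second difference.
  have i2 := integral_box_eq_sum_cells (J := J) hL (f := fun x => f (-x)) (by fun_prop)
  rw [integral_box_neg hp] at i2
  have i3 : ∑ p : Grid d J, ∫ y in Q, f (-(gridPt L p + y))
      = ∑ p : Grid d J, ∫ y in Q, f (gridPt L p - y) := by
    refine Fintype.sum_equiv (Equiv.neg _) _ _ fun p => ?_
    congr 1
    funext y
    rw [Equiv.neg_apply, sub_eq_add_neg, neg_add, apply_neg_gridPt hp]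
  rw [i3] at i2
  have key : ∀ p : Grid d J, |2 * (h ^ d * f (gridPt L p)) - ((∫ y in Q, f (gridPt L p + y))
      + ∫ y in Q, f (gridPt L p - y))| ≤ h ^ d * (2 * R * h ^ 2) := fun p => by
    have e : 2 * (h ^ d * f (gridPt L p)) - ((∫ y in Q, f (gridPt L p + y))
        + ∫ y in Q, f (gridPt L p - y))
        = -∫ y in Q, (f (gridPt L p + y) + f (gridPt L p - y) - 2 * f (gridPt L p)) := by
      have c1 : IntegrableOn (fun y => f (gridPt L p + y)) Q := hint _ (by fun_prop)
      have c2 : IntegrableOn (fun y => f (gridPt L p - y)) Q := hint _ (by fun_prop)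
      rw [integral_sub (f := fun y => f (gridPt L p + y) + f (gridPt L p - y)) (c1.add c2)
        (hint _ continuous_const), integral_add c1 c2, setIntegral_const, vol, smul_eq_mul]
      ring
    rw [e, abs_neg, ← Real.norm_eq_abs]
    refine (norm_setIntegral_le_of_norm_le_const (C := 2 * R * h ^ 2) ?_ fun y hy => ?_).trans ?_
    · rw [hQ]; exact isCompact_Icc.measure_lt_top
    · rw [Real.norm_eq_abs]
      refine (abs_second_difference_le hf hR _ _).trans ?_
      have : ‖y‖ ≤ h := (pi_norm_le_iff_of_nonneg hh.le).2 fun k => by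
        rw [Real.norm_eq_abs, abs_of_nonneg (hy.1 k)]; exact hy.2 k
      gcongr
    · rw [vol, mul_comm]
  have tot : 2 * (h ^ d * ∑ p : Grid d J, f (gridPt L p)
      - ∫ x in Icc (0 : Fin d → ℝ) (fun _ => L), f x)
      = ∑ p : Grid d J, (2 * (h ^ d * f (gridPt L p)) - ((∫ y in Q, f (gridPt L p + y))
        + ∫ y in Q, f (gridPt L p - y))) := by
    rw [Finset.sum_sub_distrib, Finset.sum_add_distrib, ← Finset.mul_sum, ← Finset.mul_sum, ← i1,
      ← i2]
    ring
  have fin : |2 * (h ^ d * ∑ p : Grid d J, f (gridPt L p)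
      - ∫ x in Icc (0 : Fin d → ℝ) (fun _ => L), f x)| ≤ L ^ d * (2 * R * h ^ 2) := by
    rw [tot]
    refine (Finset.abs_sum_le_sum_abs _ _).trans ((Finset.sum_le_sum fun p _ => key p).trans ?_)
    rw [Finset.sum_const, Finset.card_univ, Fintype.card_pi, ← hJ]
    simp [ZMod.card]
    exact le_of_eq (by ring)
  rw [abs_mul, abs_two] at fin
  linarith

end Restriction

/-! ### Pointwise estimates for the nonlinear terms -/

section Pointwise

variable {d : ℕ}

/-- The sum of the absolute values of the entries of a matrix. -/
def absSum (X : Matrix (Fin d) (Fin d) ℝ) : ℝ := ∑ i, ∑ j, |X i j|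

theorem absSum_nonneg (X : Matrix (Fin d) (Fin d) ℝ) : 0 ≤ absSum X :=
  Finset.sum_nonneg fun _ _ => Finset.sum_nonneg fun _ _ => abs_nonneg _

theorem abs_entry_le_absSum (X : Matrix (Fin d) (Fin d) ℝ) (i j : Fin d) : |X i j| ≤ absSum X :=
  (Finset.single_le_sum (f := fun j => |X i j|) (fun _ _ => abs_nonneg _) (Finset.mem_univ j)).trans
    (Finset.single_le_sum (f := fun i => ∑ j, |X i j|)
      (fun _ _ => Finset.sum_nonneg fun _ _ => abs_nonneg _) (Finset.mem_univ i))

theorem absSum_add_le (X Y : Matrix (Fin d) (Fin d) ℝ) : absSum (X + Y) ≤ absSum X + absSum Y := by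
  simp only [absSum, ← Finset.sum_add_distrib]
  exact Finset.sum_le_sum fun _ _ => Finset.sum_le_sum fun _ _ => abs_add_le _ _

theorem absSum_smul (r : ℝ) (X : Matrix (Fin d) (Fin d) ℝ) : absSum (r • X) = |r| * absSum X := by
  simp only [absSum, Matrix.smul_apply, smul_eq_mul, abs_mul, Finset.mul_sum]

theorem absSum_one : absSum (1 : Matrix (Fin d) (Fin d) ℝ) = d := by
  simp [absSum, Matrix.one_apply, apply_ite]

theorem abs_frob_le (X Y : Matrix (Fin d) (Fin d) ℝ) : |frob X Y| ≤ absSum X * absSum Y := by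
  calc |frob X Y| ≤ ∑ i, ∑ j, |X i j| * |Y i j| := by
        refine (Finset.abs_sum_le_sum_abs _ _).trans (Finset.sum_le_sum fun i _ =>
          (Finset.abs_sum_le_sum_abs _ _).trans (Finset.sum_le_sum fun j _ => ?_))
        rw [abs_mul]
    _ ≤ ∑ i, ∑ j, |X i j| * absSum Y := by
        gcongr with i _ j _
        exact abs_entry_le_absSum Y i j
    _ = _ := by simp only [absSum, Finset.sum_mul]

theorem absSum_mul_le (X Y : Matrix (Fin d) (Fin d) ℝ) : absSum (X * Y) ≤ absSum X * absSum Y := by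
  calc absSum (X * Y) ≤ ∑ i, ∑ j, ∑ k, |X i k| * |Y k j| := by
        refine Finset.sum_le_sum fun i _ => Finset.sum_le_sum fun j _ => ?_
        rw [Matrix.mul_apply]
        refine (Finset.abs_sum_le_sum_abs _ _).trans (Finset.sum_le_sum fun k _ => ?_)
        rw [abs_mul]
    _ = ∑ i, ∑ k, |X i k| * ∑ j, |Y k j| := by
        refine Finset.sum_congr rfl fun i _ => ?_
        rw [Finset.sum_comm]
        exact Finset.sum_congr rfl fun k _ => by rw [Finset.mul_sum]
    _ ≤ ∑ i, ∑ k, |X i k| * absSum Y := by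
        gcongr with i _ k _
        exact Finset.single_le_sum (f := fun k => ∑ j, |Y k j|)
          (fun _ _ => Finset.sum_nonneg fun _ _ => abs_nonneg _) (Finset.mem_univ k)
    _ = _ := by simp only [absSum, Finset.sum_mul]

theorem abs_trace_le (X : Matrix (Fin d) (Fin d) ℝ) : |X.trace| ≤ absSum X := by
  refine (Finset.abs_sum_le_sum_abs _ _).trans (Finset.sum_le_sum fun i _ => ?_)
  exact Finset.single_le_sum (f := fun j => |X i j|) (fun _ _ => abs_nonneg _) (Finset.mem_univ i)

theorem frob_add_left (X Y Z : Matrix (Fin d) (Fin d) ℝ) :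
    frob (X + Y) Z = frob X Z + frob Y Z := by
  simp [frob, add_mul, Finset.sum_add_distrib]

theorem frob_comm (X Y : Matrix (Fin d) (Fin d) ℝ) : frob X Y = frob Y X := by
  simp [frob, mul_comm]

theorem frob_add_right (X Y Z : Matrix (Fin d) (Fin d) ℝ) :
    frob Z (X + Y) = frob Z X + frob Z Y := by
  rw [frob_comm, frob_add_left, frob_comm X, frob_comm Y]

theorem frob_smul_right (r : ℝ) (X Z : Matrix (Fin d) (Fin d) ℝ) :
    frob Z (r • X) = r * frob Z X := by
  simp only [frob, Matrix.smul_apply, smul_eq_mul, Finset.mul_sum, mul_left_comm]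

theorem mTensor_add (P : Params) (Q E : Matrix (Fin d) (Fin d) ℝ) :
    mTensor P (Q + E) = mTensor P Q + (1 / sPlus P d) • E := by
  simp only [mTensor, smul_add]; abel

theorem absSum_mTensor_le (P : Params) (Q : Matrix (Fin d) (Fin d) ℝ) :
    absSum (mTensor P Q) ≤ |1 / sPlus P d| * absSum Q + 1 := by
  refine (absSum_add_le _ _).trans ?_
  rw [absSum_smul, absSum_smul, absSum_one, abs_of_nonneg (by positivity : (0 : ℝ) ≤ 1 / d)]
  gcongr
  rcases Nat.eq_zero_or_pos d with rfl | hd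
  · simp
  · rw [one_div, inv_mul_cancel₀ (by positivity)]

theorem abs_sub_trace_le (X : Matrix (Fin d) (Fin d) ℝ) (i j : Fin d) :
    |(X - (X.trace / d) • (1 : Matrix (Fin d) (Fin d) ℝ)) i j| ≤ 2 * absSum X := by
  have h1 := abs_entry_le_absSum X i j
  have h2 : |X.trace / d * (1 : Matrix (Fin d) (Fin d) ℝ) i j| ≤ absSum X := by
    have hd : (1 : ℝ) ≤ d := by
      exact_mod_cast (Nat.one_le_iff_ne_zero.2 fun h => by subst h; exact i.elim0)
    have h3 : |(1 : Matrix (Fin d) (Fin d) ℝ) i j| ≤ 1 := by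
      rw [Matrix.one_apply]; split_ifs <;> simp
    rw [abs_mul, abs_div, abs_of_pos (by linarith : (0 : ℝ) < d)]
    calc |X.trace| / d * |(1 : Matrix (Fin d) (Fin d) ℝ) i j| ≤ |X.trace| / 1 * 1 := by gcongr
      _ ≤ absSum X := by rw [div_one, mul_one]; exact abs_trace_le X
  simp only [Matrix.sub_apply, Matrix.smul_apply, smul_eq_mul]
  exact (abs_sub _ _).trans (by linarith)

/-- Increment of the square of a matrix. -/
theorem absSum_sq_increment_le {Q E : Matrix (Fin d) (Fin d) ℝ} {R : ℝ} (hQ : absSum Q ≤ R) :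
    absSum (Q * E + E * Q + E * E) ≤ 2 * R * absSum E + absSum E ^ 2 := by
  have hE := absSum_nonneg E
  have h1 := (absSum_mul_le Q E).trans (mul_le_mul_of_nonneg_right hQ hE)
  have h2 := (absSum_mul_le E Q).trans (mul_le_mul_of_nonneg_left hQ hE)
  have h3 := absSum_mul_le E E
  have h4 := absSum_add_le (Q * E + E * Q) (E * E)
  have h5 := absSum_add_le (Q * E) (E * Q)
  nlinarith

/-- Intermediate powers lie below the sum of the extreme ones, so the error bounds below need to
record only those. -/
theorem sq_le_add_cube {W : ℝ} (hW : 0 ≤ W) : W ^ 2 ≤ W + W ^ 3 := by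
  nlinarith [mul_nonneg hW (sq_nonneg (W - 1))]

/-- Local Lipschitz estimate for `H`. -/
theorem abs_hVar_sub_le (P : Params) (d : ℕ) (R : ℝ) (hR : 0 ≤ R) : ∃ C : ℝ, 0 ≤ C ∧
    ∀ (Q E H G : Matrix (Fin d) (Fin d) ℝ) (u e : ℝ) (i j : Fin d),
      absSum Q ≤ R → absSum H ≤ R → |u| ≤ R →
      |hVar P (Q + E) (u + e) (H + G) i j - hVar P Q u H i j|
        ≤ C * ((absSum E + |e|) + (absSum E + |e|) ^ 3 + absSum G * (1 + |e|)) := by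
  set β := if d = 3 then P.B else 0 with hβ
  set c1 := 2 * P.B0 * P.q ^ 2 / sPlus P d with hc1
  set c2 := 2 * P.B0 * P.q ^ 4 / sPlus P d ^ 2 with hc2
  refine ⟨|P.A| + |β| * (4 * R + 2) + |P.C| * (3 * R ^ 2 + 3 * R + 1) + |c1| * (2 * (2 * R + 1))
    + |c2| * (3 * R ^ 2 + 3 * R + 1), by positivity, fun Q E H G u e i j hQ hH hu => ?_⟩
  set m := absSum E with hm
  set γ := absSum G with hγ
  set W := m + |e| with hW
  set S := W + W ^ 3 + γ * (1 + |e|) with hS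
  have m0 : 0 ≤ m := absSum_nonneg E
  have γ0 : 0 ≤ γ := absSum_nonneg G
  have e0 : 0 ≤ |e| := abs_nonneg e
  have W0 : 0 ≤ W := by positivity
  have mW : m ≤ W := by linarith
  have eW : |e| ≤ W := by linarith
  have g0 : 0 ≤ γ * (1 + |e|) := by positivity
  have w3 : 0 ≤ W ^ 3 := by positivity
  have W1 : W ≤ S := by linarith
  have W2 : W ^ 2 ≤ S := by linarith [sq_le_add_cube W0]
  have W3 : W ^ 3 ≤ S := by linarith
  have Wg : γ * (1 + |e|) ≤ S := by linarith
  have cub : 3 * R ^ 2 * W + 3 * R * W ^ 2 + W ^ 3 ≤ (3 * R ^ 2 + 3 * R + 1) * S := by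
    have a1 := mul_le_mul_of_nonneg_left W1 (by positivity : 0 ≤ 3 * R ^ 2)
    have a2 := mul_le_mul_of_nonneg_left W2 (by positivity : 0 ≤ 3 * R)
    linarith
  set D := Q * E + E * Q + E * E with hD
  have hDb : absSum D ≤ 2 * R * W + W ^ 2 := by
    refine (absSum_sq_increment_le hQ).trans ?_
    gcongr
  have hDt : |D.trace| ≤ 2 * R * W + W ^ 2 := (abs_trace_le D).trans hDb
  have hQQ : |(Q * Q).trace| ≤ R ^ 2 := by
    refine (abs_trace_le _).trans ((absSum_mul_le _ _).trans ?_)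
    rw [sq]
    exact mul_le_mul hQ hQ (absSum_nonneg _) hR
  have hexp : (Q + E) * (Q + E) = Q * Q + D := by rw [hD]; noncomm_ring
  set K := e • (H + G) + u • G with hK
  have hKexp : (u + e) • (H + G) = u • H + K := by rw [hK]; module
  have hKb : absSum K ≤ (2 * R + 1) * S := by
    have k1 : absSum K ≤ |e| * (R + γ) + R * γ := by
      refine (absSum_add_le _ _).trans ?_
      rw [absSum_smul, absSum_smul]
      gcongr
      exact (absSum_add_le _ _).trans (by gcongr)
    have k2 : |e| * (R + γ) + R * γ ≤ R * W + (R + 1) * (γ * (1 + |e|)) := by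
      nlinarith [mul_nonneg hR (sub_nonneg.2 eW), mul_nonneg γ0 e0, mul_nonneg hR (mul_nonneg γ0 e0)]
    have a1 := mul_le_mul_of_nonneg_left W1 hR
    have a2 := mul_le_mul_of_nonneg_left Wg (by positivity : 0 ≤ R + 1)
    linarith
  -- Exact expansion of a polynomial increment: each summand contains a factor from the errors `E`,
  -- `e`, `G`, and is then estimated by its own multiple of `S`.
  have id1 : hVar P (Q + E) (u + e) (H + G) i j - hVar P Q u H i j
      = P.A * E i j - β * (D - (D.trace / d) • (1 : Matrix (Fin d) (Fin d) ℝ)) i j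
        + P.C * (((Q * Q).trace + D.trace) * E i j + D.trace * Q i j)
        + c1 * (K - (K.trace / d) • (1 : Matrix (Fin d) (Fin d) ℝ)) i j
        + c2 * ((u + e) ^ 2 * E i j + (2 * u * e + e ^ 2) * Q i j) := by
    simp only [hVar, hexp, hKexp, Matrix.trace_add, Matrix.add_apply, Matrix.sub_apply,
      Matrix.smul_apply, smul_eq_mul, ← hβ, ← hc1, ← hc2]
    ring
  have hEij : |E i j| ≤ W := (abs_entry_le_absSum E i j).trans mW
  have hQij : |Q i j| ≤ R := (abs_entry_le_absSum Q i j).trans hQ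
  have t1 : |P.A * E i j| ≤ |P.A| * S := by
    rw [abs_mul]; gcongr; exact hEij.trans W1
  have t2 : |β * (D - (D.trace / d) • (1 : Matrix (Fin d) (Fin d) ℝ)) i j|
      ≤ |β| * ((4 * R + 2) * S) := by
    rw [abs_mul]
    gcongr
    refine (abs_sub_trace_le D i j).trans ?_
    have a1 := mul_le_mul_of_nonneg_left W1 hR
    linarith
  have t3 : |P.C * (((Q * Q).trace + D.trace) * E i j + D.trace * Q i j)|
      ≤ |P.C| * ((3 * R ^ 2 + 3 * R + 1) * S) := by
    rw [abs_mul]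
    gcongr
    refine le_trans ?_ cub
    refine (abs_add_le _ _).trans ?_
    rw [abs_mul, abs_mul]
    calc _ ≤ (R ^ 2 + (2 * R * W + W ^ 2)) * W + (2 * R * W + W ^ 2) * R := by
          gcongr
          exact (abs_add_le _ _).trans (by gcongr)
      _ = _ := by ring
  have t4 : |c1 * (K - (K.trace / d) • (1 : Matrix (Fin d) (Fin d) ℝ)) i j|
      ≤ |c1| * (2 * (2 * R + 1) * S) := by
    rw [abs_mul]
    gcongr
    refine (abs_sub_trace_le K i j).trans ?_
    linarith
  have t5 : |c2 * ((u + e) ^ 2 * E i j + (2 * u * e + e ^ 2) * Q i j)|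
      ≤ |c2| * ((3 * R ^ 2 + 3 * R + 1) * S) := by
    rw [abs_mul]
    gcongr
    refine le_trans ?_ cub
    refine (abs_add_le _ _).trans ?_
    rw [abs_mul, abs_mul, abs_pow]
    calc _ ≤ (R + W) ^ 2 * W + (2 * R * W + W ^ 2) * R := by
          gcongr
          · exact (abs_add_le _ _).trans (by gcongr)
          · refine (abs_add_le _ _).trans ?_
            rw [abs_mul, abs_mul, abs_two, abs_pow]
            gcongr
      _ = _ := by ring
  rw [id1]
  refine (abs_add_le _ _).trans ?_
  refine (add_le_add_left (abs_add_le _ _) _).trans ?_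
  refine (add_le_add_left (add_le_add_left (abs_add_le _ _) _) _).trans ?_
  have := abs_sub (P.A * E i j) (β * (D - (D.trace / d) • (1 : Matrix (Fin d) (Fin d) ℝ)) i j)
  linarith

theorem poly_increment_le {k0 k1 k2 R u e W S : ℝ} (hR : 0 ≤ R) (hu : |u| ≤ R)
    (eW : |e| ≤ W) (W1 : W ≤ S) (W2 : W ^ 2 ≤ S) (W3 : W ^ 3 ≤ S) :
    |k0 * (u + e) + k1 * (u + e) ^ 2 + k2 * (u + e) ^ 3 - (k0 * u + k1 * u ^ 2 + k2 * u ^ 3)|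
      ≤ (|k0| + |k1| * (2 * R + 1) + |k2| * (3 * R ^ 2 + 3 * R + 1)) * S := by
  have id1 : k0 * (u + e) + k1 * (u + e) ^ 2 + k2 * (u + e) ^ 3
      - (k0 * u + k1 * u ^ 2 + k2 * u ^ 3)
      = k0 * e + k1 * (2 * u * e + e ^ 2) + k2 * (3 * u ^ 2 * e + 3 * u * e ^ 2 + e ^ 3) := by ring
  rw [id1]
  refine (abs_add_le _ _).trans ?_
  refine (add_le_add_left (abs_add_le _ _) _).trans ?_
  rw [abs_mul, abs_mul, abs_mul]
  have b1 : |2 * u * e + e ^ 2| ≤ (2 * R + 1) * S := by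
    have : |2 * u * e + e ^ 2| ≤ 2 * R * W + W ^ 2 := by
      refine (abs_add_le _ _).trans ?_
      rw [abs_mul, abs_mul, abs_two, abs_pow]
      gcongr
    have a1 := mul_le_mul_of_nonneg_left W1 (by positivity : 0 ≤ 2 * R)
    linarith
  have b2 : |3 * u ^ 2 * e + 3 * u * e ^ 2 + e ^ 3| ≤ (3 * R ^ 2 + 3 * R + 1) * S := by
    have : |3 * u ^ 2 * e + 3 * u * e ^ 2 + e ^ 3| ≤ 3 * R ^ 2 * W + 3 * R * W ^ 2 + W ^ 3 := by
      refine (abs_add_le _ _).trans ?_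
      refine (add_le_add_left (abs_add_le _ _) _).trans ?_
      simp only [abs_mul, abs_pow, abs_of_pos (by norm_num : (0 : ℝ) < 3)]
      gcongr
    have a1 := mul_le_mul_of_nonneg_left W1 (by positivity : 0 ≤ 3 * R ^ 2)
    have a2 := mul_le_mul_of_nonneg_left W2 (by positivity : 0 ≤ 3 * R)
    linarith
  have a0 := mul_le_mul_of_nonneg_left (eW.trans W1) (abs_nonneg k0)
  have a1 := mul_le_mul_of_nonneg_left b1 (abs_nonneg k1)
  have a2 := mul_le_mul_of_nonneg_left b2 (abs_nonneg k2)
  linarith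

/-- Local Lipschitz estimate for `μ`. -/
theorem abs_muVar_sub_le (P : Params) (d : ℕ) (R : ℝ) (hR : 0 ≤ R) : ∃ C : ℝ, 0 ≤ C ∧
    ∀ (Q E H G : Matrix (Fin d) (Fin d) ℝ) (u e v δ : ℝ),
      absSum Q ≤ R → absSum H ≤ R → |u| ≤ R →
      |muVar P (Q + E) (u + e) (H + G) (v + δ) - muVar P Q u H v|
        ≤ C * ((absSum E + |e|) + (absSum E + |e|) ^ 3 + absSum G * (1 + absSum E) + |δ|) := by
  set σ := |1 / sPlus P d| with hσ
  set ρ := σ * R + 1 with hρ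
  have σ0 : 0 ≤ σ := abs_nonneg _
  have ρ0 : 0 ≤ ρ := by positivity
  set c1 := 2 * P.B0 * P.q ^ 2 with hc1
  set c2 := 2 * P.B0 * P.q ^ 4 with hc2
  refine ⟨(|P.a| + |P.b| * (2 * R + 1) + |P.c| * (3 * R ^ 2 + 3 * R + 1))
    + |c1| * (ρ + σ * R + σ) + |c1|
    + |c2| * (ρ ^ 2 + 2 * ρ * σ + σ ^ 2 + 2 * ρ * σ * R + σ ^ 2 * R), by positivity,
    fun Q E H G u e v δ hQ hH hu => ?_⟩
  set m := absSum E with hm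
  set γ := absSum G with hγ
  set W := m + |e| with hW
  set S := W + W ^ 3 + γ * (1 + m) + |δ| with hS
  have m0 : 0 ≤ m := absSum_nonneg E
  have γ0 : 0 ≤ γ := absSum_nonneg G
  have e0 : 0 ≤ |e| := abs_nonneg e
  have δ0 : 0 ≤ |δ| := abs_nonneg δ
  have W0 : 0 ≤ W := by positivity
  have mW : m ≤ W := by linarith
  have eW : |e| ≤ W := by linarith
  have g0 : 0 ≤ γ * (1 + m) := by positivity
  have w3 : 0 ≤ W ^ 3 := by positivity
  have W1 : W ≤ S := by linarith
  have W2 : W ^ 2 ≤ S := by linarith [sq_le_add_cube W0]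
  have W3 : W ^ 3 ≤ S := by linarith
  have Wg : γ * (1 + m) ≤ S := by linarith
  have gS : γ ≤ S := by nlinarith
  have gmS : m * γ ≤ S := by nlinarith
  set M := mTensor P Q with hM
  set E' := (1 / sPlus P d) • E with hE'
  have hMb : absSum M ≤ ρ := (absSum_mTensor_le P Q).trans (by rw [hρ]; gcongr)
  have hE'b : absSum E' = σ * m := by rw [hE', absSum_smul]
  have id1 : muVar P (Q + E) (u + e) (H + G) (v + δ) - muVar P Q u H v
      = (P.a * (u + e) + P.b * (u + e) ^ 2 + P.c * (u + e) ^ 3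
          - (P.a * u + P.b * u ^ 2 + P.c * u ^ 3))
        + c1 * (frob M G + frob E' (H + G)) + c1 * δ
        + c2 * ((frob M M + 2 * frob M E' + frob E' E') * e + (2 * frob M E' + frob E' E') * u) := by
    simp only [muVar, mTensor_add, ← hM, ← hE', frob_add_left, frob_add_right, frob_comm E' M,
      ← hc1, ← hc2]
    ring
  have t1 := poly_increment_le (k0 := P.a) (k1 := P.b) (k2 := P.c) hR hu eW W1 W2 W3
  have fME : |frob M E'| ≤ ρ * σ * m := by
    refine (abs_frob_le _ _).trans ?_
    rw [hE'b, mul_assoc]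
    gcongr
  have fEE : |frob E' E'| ≤ σ ^ 2 * m ^ 2 := by
    refine (abs_frob_le _ _).trans (le_of_eq ?_)
    rw [hE'b]; ring
  have fMM : |frob M M| ≤ ρ ^ 2 := by
    refine (abs_frob_le _ _).trans ?_
    rw [sq]
    exact mul_le_mul hMb hMb (absSum_nonneg _) ρ0
  have t2 : |c1 * (frob M G + frob E' (H + G))| ≤ |c1| * ((ρ + σ * R + σ) * S) := by
    rw [abs_mul]
    gcongr
    have a1 : |frob M G| ≤ ρ * γ := (abs_frob_le _ _).trans (by gcongr)
    have a2 : |frob E' (H + G)| ≤ σ * m * (R + γ) := by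
      refine (abs_frob_le _ _).trans ?_
      rw [hE'b]
      gcongr
      exact (absSum_add_le _ _).trans (by gcongr)
    have b1 := mul_le_mul_of_nonneg_left gS ρ0
    have b2 := mul_le_mul_of_nonneg_left (mW.trans W1) (by positivity : 0 ≤ σ * R)
    have b3 := mul_le_mul_of_nonneg_left gmS σ0
    refine (abs_add_le _ _).trans ?_
    linarith
  have t3 : |c1 * δ| ≤ |c1| * S := by
    rw [abs_mul]; gcongr; linarith
  have t4 : |c2 * ((frob M M + 2 * frob M E' + frob E' E') * e + (2 * frob M E' + frob E' E') * u)|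
      ≤ |c2| * ((ρ ^ 2 + 2 * ρ * σ + σ ^ 2 + 2 * ρ * σ * R + σ ^ 2 * R) * S) := by
    rw [abs_mul]
    gcongr
    have h2 : |2 * frob M E' + frob E' E'| ≤ 2 * (ρ * σ * W) + σ ^ 2 * W ^ 2 := by
      refine (abs_add_le _ _).trans ?_
      rw [abs_mul, abs_two]
      gcongr
      · exact fME.trans (by gcongr)
      · exact fEE.trans (by gcongr)
    have h1 : |frob M M + 2 * frob M E' + frob E' E'|
        ≤ ρ ^ 2 + (2 * (ρ * σ * W) + σ ^ 2 * W ^ 2) := by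
      rw [add_assoc]
      exact (abs_add_le _ _).trans (by gcongr)
    refine (abs_add_le _ _).trans ?_
    rw [abs_mul, abs_mul]
    have b1 := mul_le_mul_of_nonneg_left W1 (by positivity : 0 ≤ ρ ^ 2)
    have b2 := mul_le_mul_of_nonneg_left W2 (by positivity : 0 ≤ 2 * ρ * σ)
    have b3 := mul_le_mul_of_nonneg_left W3 (by positivity : 0 ≤ σ ^ 2)
    have b4 := mul_le_mul_of_nonneg_left W1 (by positivity : 0 ≤ 2 * ρ * σ * R)
    have b5 := mul_le_mul_of_nonneg_left W2 (by positivity : 0 ≤ σ ^ 2 * R)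
    calc _ ≤ (ρ ^ 2 + (2 * (ρ * σ * W) + σ ^ 2 * W ^ 2)) * W
          + (2 * (ρ * σ * W) + σ ^ 2 * W ^ 2) * R := by gcongr
      _ ≤ _ := by linarith
  rw [id1]
  refine (abs_add_le _ _).trans ?_
  refine (add_le_add_left (abs_add_le _ _) _).trans ?_
  refine (add_le_add_left (add_le_add_left (abs_add_le _ _) _) _).trans ?_
  linarith

theorem quartic_increment_le {k0 k1 k2 R u e W S : ℝ} (hR : 0 ≤ R) (hu : |u| ≤ R)
    (eW : |e| ≤ W) (W1 : W ≤ S) (W2 : W ^ 2 ≤ S) (W3 : W ^ 3 ≤ S) (W4 : W ^ 4 ≤ S) :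
    |k0 * (2 * u * e + e ^ 2) + k1 * (3 * u ^ 2 * e + 3 * u * e ^ 2 + e ^ 3)
      + k2 * (4 * u ^ 3 * e + 6 * u ^ 2 * e ^ 2 + 4 * u * e ^ 3 + e ^ 4)|
      ≤ (|k0| * (2 * R + 1) + |k1| * (3 * R ^ 2 + 3 * R + 1)
        + |k2| * (4 * R ^ 3 + 6 * R ^ 2 + 4 * R + 1)) * S := by
  refine (abs_add_le _ _).trans ?_
  refine (add_le_add_left (abs_add_le _ _) _).trans ?_
  rw [abs_mul, abs_mul, abs_mul]
  have b0 : |2 * u * e + e ^ 2| ≤ (2 * R + 1) * S := by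
    calc |2 * u * e + e ^ 2| ≤ 2 * R * W + W ^ 2 := by
          refine (abs_add_le _ _).trans ?_
          simp only [abs_mul, abs_two, abs_pow]
          gcongr
      _ ≤ 2 * R * S + S := by gcongr
      _ = _ := by ring
  have b1 : |3 * u ^ 2 * e + 3 * u * e ^ 2 + e ^ 3| ≤ (3 * R ^ 2 + 3 * R + 1) * S := by
    calc |3 * u ^ 2 * e + 3 * u * e ^ 2 + e ^ 3| ≤ 3 * R ^ 2 * W + 3 * R * W ^ 2 + W ^ 3 := by
          refine (abs_add_le _ _).trans ?_
          refine (add_le_add_left (abs_add_le _ _) _).trans ?_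
          simp only [abs_mul, abs_pow, Nat.abs_ofNat]
          gcongr
      _ ≤ 3 * R ^ 2 * S + 3 * R * S + S := by gcongr
      _ = _ := by ring
  have b2 : |4 * u ^ 3 * e + 6 * u ^ 2 * e ^ 2 + 4 * u * e ^ 3 + e ^ 4|
      ≤ (4 * R ^ 3 + 6 * R ^ 2 + 4 * R + 1) * S := by
    calc |4 * u ^ 3 * e + 6 * u ^ 2 * e ^ 2 + 4 * u * e ^ 3 + e ^ 4|
        ≤ 4 * R ^ 3 * W + 6 * R ^ 2 * W ^ 2 + 4 * R * W ^ 3 + W ^ 4 := by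
          refine (abs_add_le _ _).trans ?_
          refine (add_le_add_left (abs_add_le _ _) _).trans ?_
          refine (add_le_add_left (add_le_add_left (abs_add_le _ _) _) _).trans ?_
          simp only [abs_mul, abs_pow, Nat.abs_ofNat]
          gcongr
      _ ≤ 4 * R ^ 3 * S + 6 * R ^ 2 * S + 4 * R * S + S := by gcongr
      _ = _ := by ring
  have a0 := mul_le_mul_of_nonneg_left b0 (abs_nonneg k0)
  have a1 := mul_le_mul_of_nonneg_left b1 (abs_nonneg k1)
  have a2 := mul_le_mul_of_nonneg_left b2 (abs_nonneg k2)
  linarith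

set_option maxHeartbeats 1000000 in
/-- Local Lipschitz estimate for the energy density. -/
theorem abs_energyDensity_sub_le (P : Params) (d : ℕ) (R : ℝ) (hR : 0 ≤ R) : ∃ C : ℝ, 0 ≤ C ∧
    ∀ (Q E H G : Matrix (Fin d) (Fin d) ℝ) (u e : ℝ),
      absSum Q ≤ R → absSum H ≤ R → |u| ≤ R →
      |energyDensity P (Q + E) (u + e) (H + G) - energyDensity P Q u H|
        ≤ C * ((absSum E + |e|) + (absSum E + |e|) ^ 4
          + absSum G * (1 + (absSum E + |e|) + (absSum E + |e|) ^ 3)) := by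
  set σ := |1 / sPlus P d| with hσ
  set ρ := σ * R + 1 with hρ
  have σ0 : 0 ≤ σ := abs_nonneg _
  have ρ0 : 0 ≤ ρ := by positivity
  set β := if d = 3 then P.B / 3 else 0 with hβ
  set c1 := 2 * P.B0 * P.q ^ 2 with hc1
  set c2 := P.B0 * P.q ^ 4 with hc2
  set ν := R * σ + σ + ρ with hν
  have ν0 : 0 ≤ ν := by positivity
  refine ⟨|c1| * (2 * (R * ρ + ν + R * ν)) + |c2| * (2 * (2 * R * ρ * ν + 4 * ν ^ 2))
    + |P.A / 2| * (2 * R + 1) + |β| * (3 * R ^ 2 + 3 * R + 1)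
    + |P.C / 4| * (2 * R ^ 2 * (2 * R + 1) + 4 * (2 * R + 1) ^ 2)
    + (|P.a / 2| * (2 * R + 1) + |P.b / 3| * (3 * R ^ 2 + 3 * R + 1)
      + |P.c / 4| * (4 * R ^ 3 + 6 * R ^ 2 + 4 * R + 1)), by positivity,
    fun Q E H G u e hQ hH hu => ?_⟩
  set m := absSum E with hm
  set γ := absSum G with hγ
  set W := m + |e| with hW
  have m0 : 0 ≤ m := absSum_nonneg E
  have γ0 : 0 ≤ γ := absSum_nonneg G
  have e0 : 0 ≤ |e| := abs_nonneg e
  have W0 : 0 ≤ W := by positivity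
  -- The error of the Hessian occurs only to first order. After summation `γ W³` is a product of two
  -- `l²` functions, and `W⁴` is split as `W³ · W`; this is what the `L⁶` bound can handle.
  set S := W + W ^ 4 + γ * (1 + W + W ^ 3) with hS
  have mW : m ≤ W := by linarith
  have eW : |e| ≤ W := by linarith
  have g0 : 0 ≤ γ * (1 + W + W ^ 3) := by positivity
  have w4 : 0 ≤ W ^ 4 := by positivity
  have W1 : W ≤ S := by linarith
  have W2 : W ^ 2 ≤ S := by
    nlinarith [mul_nonneg W0 (mul_nonneg (by positivity : 0 ≤ W + 1) (sq_nonneg (W - 1))),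
      mul_nonneg W0 (sq_nonneg (W - 1))]
  have W3 : W ^ 3 ≤ S := by
    nlinarith [mul_nonneg W0 (mul_nonneg (by positivity : 0 ≤ W + 1) (sq_nonneg (W - 1))),
      mul_nonneg W0 (sq_nonneg (W - 1)), sq_nonneg (W ^ 2 - W)]
  have W4 : W ^ 4 ≤ S := by linarith
  have w3 : 0 ≤ W ^ 3 := by positivity
  have gS : γ ≤ S := by nlinarith [mul_nonneg γ0 W0, mul_nonneg γ0 w3]
  have gwS : γ * (W + W ^ 2) ≤ 2 * S := by
    have := mul_le_mul_of_nonneg_left (sq_le_add_cube W0) γ0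
    nlinarith [mul_nonneg γ0 W0, mul_nonneg γ0 w3]
  have sq4 : (W + W ^ 2) ^ 2 ≤ 4 * S := by
    have : (W + W ^ 2) ^ 2 = W ^ 2 + 2 * W ^ 3 + W ^ 4 := by ring
    linarith
  set M := mTensor P Q with hM
  set E' := (1 / sPlus P d) • E with hE'
  have hMb : absSum M ≤ ρ := (absSum_mTensor_le P Q).trans (by rw [hρ]; gcongr)
  have hE'b : absSum E' = σ * m := by rw [hE', absSum_smul]
  set V := (u + e) • E' + e • M with hV
  have hVexp : (u + e) • (M + E') = u • M + V := by rw [hV]; module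
  have hVb : absSum V ≤ ν * (W + W ^ 2) := by
    have v1 : absSum V ≤ (R + W) * (σ * W) + W * ρ := by
      refine (absSum_add_le _ _).trans ?_
      rw [absSum_smul (u + e) E', absSum_smul e M, hE'b]
      have := absSum_nonneg M
      gcongr
      exact (abs_add_le _ _).trans (by gcongr)
    refine v1.trans ?_
    have p1 : 0 ≤ R * σ * W ^ 2 := by positivity
    have p2 : 0 ≤ σ * W := by positivity
    have p3 : 0 ≤ ρ * W ^ 2 := by positivity
    have p4 : ν * (W + W ^ 2) = R * σ * W + R * σ * W ^ 2 + σ * W + σ * W ^ 2 + ρ * W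
        + ρ * W ^ 2 := by rw [hν]; ring
    linarith
  have hV1 : absSum V ≤ ν * (2 * S) := hVb.trans (by gcongr; linarith)
  have huM : absSum (u • M) ≤ R * ρ := by
    rw [absSum_smul]
    exact mul_le_mul hu hMb (absSum_nonneg _) hR
  set D := Q * E + E * Q + E * E with hD
  have hDb : absSum D ≤ 2 * R * W + W ^ 2 := by
    refine (absSum_sq_increment_le hQ).trans ?_
    gcongr
  have hDt : |D.trace| ≤ 2 * R * W + W ^ 2 := (abs_trace_le D).trans hDb
  have hQQ : |(Q * Q).trace| ≤ R ^ 2 := by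
    refine (abs_trace_le _).trans ((absSum_mul_le _ _).trans ?_)
    rw [sq]
    exact mul_le_mul hQ hQ (absSum_nonneg _) hR
  have hexp : (Q + E) * (Q + E) = Q * Q + D := by rw [hD]; noncomm_ring
  set T := Q * Q * E + D * Q + D * E with hT
  have hexp3 : (Q * Q + D) * (Q + E) = Q * Q * Q + T := by rw [hT]; noncomm_ring
  have hTb : |T.trace| ≤ (3 * R ^ 2 + 3 * R + 1) * S := by
    have a1 : absSum T ≤ R * R * W + (2 * R * W + W ^ 2) * R + (2 * R * W + W ^ 2) * W := by
      refine (absSum_add_le _ _).trans (add_le_add ((absSum_add_le _ _).trans (add_le_add ?_ ?_)) ?_)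
      · refine (absSum_mul_le _ _).trans ?_
        exact mul_le_mul ((absSum_mul_le _ _).trans (mul_le_mul hQ hQ (absSum_nonneg _) hR)) mW
          m0 (by positivity)
      · exact (absSum_mul_le _ _).trans (mul_le_mul hDb hQ (absSum_nonneg _) (by positivity))
      · exact (absSum_mul_le _ _).trans (mul_le_mul hDb mW (absSum_nonneg _) (by positivity))
    have b1 := mul_le_mul_of_nonneg_left W1 (by positivity : 0 ≤ 3 * R ^ 2)
    have b2 := mul_le_mul_of_nonneg_left W2 (by positivity : 0 ≤ 3 * R)
    refine (abs_trace_le T).trans (a1.trans ?_)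
    linarith only [b1, b2, W3]
  have id1 : energyDensity P (Q + E) (u + e) (H + G) - energyDensity P Q u H
      = c1 * (frob G (u • M) + frob G V + frob H V)
        + c2 * (2 * frob (u • M) V + frob V V)
        + P.A / 2 * D.trace - β * T.trace
        + P.C / 4 * (2 * (Q * Q).trace * D.trace + D.trace ^ 2)
        + (P.a / 2 * (2 * u * e + e ^ 2) + P.b / 3 * (3 * u ^ 2 * e + 3 * u * e ^ 2 + e ^ 3)
          + P.c / 4 * (4 * u ^ 3 * e + 6 * u ^ 2 * e ^ 2 + 4 * u * e ^ 3 + e ^ 4)) := by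
    have hb : ∀ x : ℝ, (if d = 3 then P.B / 3 * x else 0) = β * x := fun x => by
      rw [hβ]; split_ifs <;> simp
    simp only [energyDensity, fbn, fs, hexp, hexp3, Matrix.trace_add, mTensor_add, ← hM, ← hE',
      hVexp, hb, ← hc1, ← hc2]
    simp only [frob_add_left, frob_add_right, frob_comm V (u • M)]
    ring
  have t1 : |c1 * (frob G (u • M) + frob G V + frob H V)|
      ≤ |c1| * ((R * ρ + ν + R * ν) * (2 * S)) := by
    rw [abs_mul]
    gcongr
    have a1 : |frob G (u • M)| ≤ γ * (R * ρ) := (abs_frob_le _ _).trans (by gcongr)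
    have a2 : |frob G V| ≤ γ * (ν * (W + W ^ 2)) := (abs_frob_le _ _).trans (by gcongr)
    have a3 : |frob H V| ≤ R * (ν * (2 * S)) :=
      (abs_frob_le _ _).trans (mul_le_mul hH hV1 (absSum_nonneg _) hR)
    have b1 := mul_le_mul_of_nonneg_left gS (by positivity : 0 ≤ R * ρ)
    have b2 := mul_le_mul_of_nonneg_left gwS ν0
    have S0 : 0 ≤ R * ρ * S := by have : 0 ≤ S := W0.trans W1; positivity
    refine (abs_add_le _ _).trans ?_
    refine (add_le_add_left (abs_add_le _ _) _).trans ?_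
    linarith only [a1, a2, a3, b1, b2, S0]
  have t2 : |c2 * (2 * frob (u • M) V + frob V V)|
      ≤ |c2| * ((2 * R * ρ * ν + 4 * ν ^ 2) * (2 * S)) := by
    rw [abs_mul]
    gcongr
    have a1 : |frob (u • M) V| ≤ R * ρ * (ν * (2 * S)) :=
      (abs_frob_le _ _).trans (mul_le_mul huM hV1 (absSum_nonneg _) (by positivity))
    have a2 : |frob V V| ≤ ν ^ 2 * (4 * S) := by
      refine (abs_frob_le _ _).trans ?_
      calc _ ≤ ν * (W + W ^ 2) * (ν * (W + W ^ 2)) :=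
            mul_le_mul hVb hVb (absSum_nonneg _) (by positivity)
        _ = ν ^ 2 * (W + W ^ 2) ^ 2 := by ring
        _ ≤ _ := by gcongr
    have S0 : 0 ≤ ν ^ 2 * S := by have : 0 ≤ S := W0.trans W1; positivity
    refine (abs_add_le _ _).trans ?_
    rw [abs_mul, abs_two]
    linarith only [a1, a2, S0]
  have hDS : |D.trace| ≤ (2 * R + 1) * S := by
    have := mul_le_mul_of_nonneg_left W1 (by positivity : 0 ≤ 2 * R)
    linarith
  have t3 : |P.A / 2 * D.trace| ≤ |P.A / 2| * ((2 * R + 1) * S) := by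
    rw [abs_mul]; gcongr
  have t4 : |β * T.trace| ≤ |β| * ((3 * R ^ 2 + 3 * R + 1) * S) := by
    rw [abs_mul]; gcongr
  have t5 : |P.C / 4 * (2 * (Q * Q).trace * D.trace + D.trace ^ 2)|
      ≤ |P.C / 4| * ((2 * R ^ 2 * (2 * R + 1) + 4 * (2 * R + 1) ^ 2) * S) := by
    rw [abs_mul]
    gcongr
    have a1 : |D.trace| ≤ (2 * R + 1) * (W + W ^ 2) := by
      have : 0 ≤ 2 * R * W ^ 2 := by positivity
      linarith only [hDt, this, W0]
    have a2 : |D.trace| ^ 2 ≤ (2 * R + 1) ^ 2 * (4 * S) := by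
      calc |D.trace| ^ 2 ≤ ((2 * R + 1) * (W + W ^ 2)) ^ 2 := by gcongr
        _ = (2 * R + 1) ^ 2 * (W + W ^ 2) ^ 2 := by ring
        _ ≤ _ := by gcongr
    refine (abs_add_le _ _).trans ?_
    rw [abs_mul, abs_mul, abs_two, abs_pow]
    calc _ ≤ 2 * R ^ 2 * ((2 * R + 1) * S) + (2 * R + 1) ^ 2 * (4 * S) := by gcongr
      _ = _ := by ring
  have t6 := quartic_increment_le (k0 := P.a / 2) (k1 := P.b / 3) (k2 := P.c / 4) hR hu eW W1
    W2 W3 W4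
  rw [id1]
  refine (abs_add_le _ _).trans ?_
  refine (add_le_add_left (abs_add_le _ _) _).trans ?_
  refine (add_le_add_left (add_le_add_left (abs_sub _ _) _) _).trans ?_
  refine (add_le_add_left (add_le_add_left (add_le_add_left (abs_add_le _ _) _) _) _).trans ?_
  refine (add_le_add_left (add_le_add_left (add_le_add_left (add_le_add_left
    (abs_add_le _ _) _) _) _) _).trans ?_
  refine (add_le_add (add_le_add (add_le_add (add_le_add (add_le_add t1 t2) t3) t4) t5)
    t6).trans (le_of_eq ?_)
  ring

end Pointwise

/-! ### Products of grid functions in discrete Sobolev spaces -/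

section Products

variable {d J : ℕ} {h : ℝ}

/-- The average of the two neighbours in direction `k`. -/
noncomputable def avg (k : Fin d) (U : GridFn d J) : GridFn d J :=
  fun p => (U (p + Pi.single k 1) + U (p - Pi.single k 1)) / 2

/-- An exact Leibniz rule: central differences produce neighbour averages of the other factor, with
no remainder. -/
theorem dCtr_mul (k : Fin d) (V W : GridFn d J) :
    dCtr h k (V * W) = dCtr h k V * avg k W + avg k V * dCtr h k W := by
  funext p
  simp only [dCtr, avg, LinearMap.coe_mk, AddHom.coe_mk, Pi.mul_apply, Pi.add_apply]
  ring

theorem dCtr_avg (k l : Fin d) (U : GridFn d J) : dCtr h k (avg l U) = avg l (dCtr h k U) := by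
  funext p
  simp only [dCtr, avg, LinearMap.coe_mk, AddHom.coe_mk, add_sub_right_comm p, add_right_comm p,
    sub_right_comm p]
  ring

theorem dFwd_avg (k l : Fin d) (U : GridFn d J) : dFwd h k (avg l U) = avg l (dFwd h k U) := by
  funext p
  simp only [dFwd, avg, LinearMap.coe_mk, AddHom.coe_mk, add_sub_right_comm p, add_right_comm p]
  ring

theorem abs_avg_le {U : GridFn d J} {r : ℝ} (H : ∀ p, |U p| ≤ r) (k : Fin d) (p : Grid d J) :
    |avg k U p| ≤ r := by
  rw [avg, abs_div, abs_two, div_le_iff₀ two_pos]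
  have := abs_add_le (U (p + Pi.single k 1)) (U (p - Pi.single k 1))
  linarith [H (p + Pi.single k 1), H (p - Pi.single k 1)]

/-- The pointwise size of a pair of a tensor and a scalar grid function. -/
def sizeFn (E : GridTensor d J) (e : GridFn d J) : GridFn d J := fun p => absSum (E p) + |e p|

theorem sizeFn_nonneg (E : GridTensor d J) (e : GridFn d J) (p : Grid d J) : 0 ≤ sizeFn E e p :=
  add_nonneg (absSum_nonneg _) (abs_nonneg _)

variable [NeZero J]

theorem normL2_avg_le (hh : 0 ≤ h) (k : Fin d) (U : GridFn d J) :
    normL2 h (avg k U) ≤ normL2 h U := by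
  have e : avg k U = (1 / 2 : ℝ) • ((fun p => U (p + Pi.single k 1))
      + fun p => U (p + -Pi.single k 1)) := by
    funext p
    simp [avg, sub_eq_add_neg]
    ring
  rw [e, normL2_smul hh]
  have := normL2_add_le hh (fun p => U (p + Pi.single k 1)) fun p => U (p + -Pi.single k 1)
  rw [normL2_translate, normL2_translate] at this
  rw [abs_of_pos (by norm_num)]
  linarith

theorem normH1_avg_le (hh : 0 ≤ h) (k : Fin d) (U : GridFn d J) :
    normH1 h (avg k U) ≤ normH1 h U :=
  normH1_le_of_l2 hh (normL2_avg_le hh k U) fun l => by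
    rw [dFwd_avg]; exact normL2_avg_le hh k _

theorem normL2_dCtr_le (hh : 0 ≤ h) (k : Fin d) (U : GridFn d J) :
    normL2 h (dCtr h k U) ≤ normL2 h (dFwd h k U) :=
  Real.sqrt_le_sqrt (l2Sq_dCtr_le hh k U)

theorem normH1_dCtr_le (hh : 0 ≤ h) (k : Fin d) (U : GridFn d J) :
    normH1 h (dCtr h k U) ≤ (1 + d) * normH2 h U := by
  have h1 : normL2 h (dCtr h k U) ≤ normH2 h U :=
    (normL2_dCtr_le hh k U).trans ((normL2_dFwd_le_normH1 hh k U).trans (normH1_le_normH2 hh U))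
  have h2 : ∀ l, normL2 h (dFwd h l (dCtr h k U)) ≤ normH2 h U := fun l => by
    rw [dFwd_dCtr_comm]
    exact (normL2_dCtr_le hh k _).trans ((Real.sqrt_le_sqrt (l2Sq_dFwd_dFwd_le hh k l U)).trans
      (normL2_lapH_le_normH2 hh U))
  calc _ ≤ normL2 h (dCtr h k U) + ∑ l, normL2 h (dFwd h l (dCtr h k U)) := normH1_le_sum hh _
    _ ≤ normH2 h U + ∑ _l : Fin d, normH2 h U := add_le_add h1 (Finset.sum_le_sum fun l _ => h2 l)
    _ = _ := by simp; ring

theorem normL2_mul_sq_le (hh : 0 ≤ h) (U V : GridFn d J) :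
    normL2 h (U * V) ^ 2 ≤ normL2 h (U ^ 2) * normL2 h (V ^ 2) := by
  refine le_trans (le_of_eq ?_) ((le_abs_self _).trans (abs_innerH_le hh (U ^ 2) (V ^ 2)))
  rw [normL2_sq hh, l2Sq, innerH, innerH]
  congr 1
  exact Finset.sum_congr rfl fun p _ => by simp only [Pi.pow_apply, Pi.mul_apply]; ring

end Products

/-- The constants of the discrete Sobolev inequalities on a fixed box. -/
structure IsSobolevConst (d : ℕ) (L C : ℝ) : Prop where
  nonneg : 0 ≤ C
  cube_le : ∀ (J : ℕ) [NeZero J] (U : GridFn d J),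
    normL2 (mesh L J) (U ^ 3) ≤ C * normH1 (mesh L J) U ^ 3
  abs_le : ∀ (J : ℕ) [NeZero J] (U : GridFn d J) (p : Grid d J),
    |U p| ≤ C * normH2 (mesh L J) U

theorem exists_isSobolevConst (d : ℕ) (hd : d = 2 ∨ d = 3) (L : ℝ) (hL : 0 < L) :
    ∃ C, IsSobolevConst d L C := by
  obtain ⟨C1, h1, H1⟩ := exists_normL2_cube_le d hd L hL
  obtain ⟨C2, h2, H2⟩ := exists_abs_le_normH2 d (by omega) L hL
  refine ⟨C1 + C2, by positivity, fun J _ U => (H1 J U).trans ?_, fun J _ U p => (H2 J U p).trans ?_⟩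
  · have := normH1_nonneg (h := mesh L J) U
    gcongr; linarith
  · have := normH2_nonneg (h := mesh L J) U
    gcongr; linarith

/-! ### Hölder and Leibniz estimates for products on the grid -/

section Algebra

variable {d J : ℕ} {L C : ℝ} [NeZero J]

/-- The embedding `H¹ ⊂ L⁴`, obtained by interpolating between `L²` and `L⁶`, followed by
Cauchy–Schwarz. -/
theorem normL2_mul_le_normH1 (hL : 0 < L) (hC : IsSobolevConst d L C) (U V : GridFn d J) :
    normL2 (mesh L J) (U * V)
      ≤ (1 + C) * normH1 (mesh L J) U * normH1 (mesh L J) V := by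
  have hh : 0 < mesh L J := mesh_pos hL
  have C0 := hC.nonneg
  have sq : ∀ U : GridFn d J, normL2 (mesh L J) (U ^ 2) ≤ (1 + C) * normH1 (mesh L J) U ^ 2 :=
    fun U => by
      have n0 := normH1_nonneg (h := mesh L J) U
      refine abs_le_of_sq_le_sq' ?_ (by positivity) |>.2
      calc normL2 (mesh L J) (U ^ 2) ^ 2 ≤ normL2 (mesh L J) U * normL2 (mesh L J) (U ^ 3) :=
            normL2_sq_sq_le hh.le U
        _ ≤ normH1 (mesh L J) U * (C * normH1 (mesh L J) U ^ 3) :=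
            mul_le_mul (normL2_le_normH1 hh.le U) (hC.cube_le J U) (normL2_nonneg _) n0
        _ = C * normH1 (mesh L J) U ^ 4 := by ring
        _ ≤ (1 + C) ^ 2 * normH1 (mesh L J) U ^ 4 := by gcongr; nlinarith
        _ = _ := by ring
  have n1 := normH1_nonneg (h := mesh L J) U
  have n2 := normH1_nonneg (h := mesh L J) V
  refine abs_le_of_sq_le_sq' ?_ (by positivity) |>.2
  calc _ ≤ normL2 (mesh L J) (U ^ 2) * normL2 (mesh L J) (V ^ 2) := normL2_mul_sq_le hh.le U V
    _ ≤ ((1 + C) * normH1 (mesh L J) U ^ 2) * ((1 + C) * normH1 (mesh L J) V ^ 2) :=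
        mul_le_mul (sq U) (sq V) (normL2_nonneg _) (by positivity)
    _ = _ := by ring

/-- The mixed central second differences of a product are bounded in `l²` by the product of the
`H²` norms. -/
theorem normL2_dCtr_dCtr_mul_le (hL : 0 < L) (hC : IsSobolevConst d L C) (k l : Fin d)
    (V W : GridFn d J) :
    normL2 (mesh L J) (dCtr (mesh L J) k (dCtr (mesh L J) l (V * W)))
      ≤ (2 * C + 2 * ((1 + C) * (1 + d) ^ 2)) * normH2 (mesh L J) V * normH2 (mesh L J) W := by
  have hh : 0 < mesh L J := mesh_pos hL
  have C0 := hC.nonneg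
  set h := mesh L J with hdef
  have n1 := normH2_nonneg (h := h) V
  have n2 := normH2_nonneg (h := h) W
  -- Leibniz applied twice. In the two outer terms one factor is undifferentiated and bounded in the
  -- maximum norm; the two cross terms are products of first differences, estimated in `H¹ × H¹`.
  have e : dCtr h k (dCtr h l (V * W))
      = (avg k (avg l W) * dCtr h k (dCtr h l V) + avg k (dCtr h l V) * avg l (dCtr h k W))
        + (avg l (dCtr h k V) * avg k (dCtr h l W)
          + avg k (avg l V) * dCtr h k (dCtr h l W)) := by
    rw [dCtr_mul, map_add, dCtr_mul, dCtr_mul, dCtr_avg, dCtr_avg, mul_comm (avg k (avg l W))]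
  have cross : ∀ (U U' : GridFn d J) (i j i' j' : Fin d),
      normL2 h (avg i (dCtr h j U) * avg i' (dCtr h j' U'))
        ≤ (1 + C) * (1 + d) ^ 2 * normH2 h U * normH2 h U' := fun U U' i j i' j' => by
    have m1 := normH2_nonneg (h := h) U
    have a1 := (normH1_avg_le hh.le i (dCtr h j U)).trans (normH1_dCtr_le hh.le j U)
    have a2 := (normH1_avg_le hh.le i' (dCtr h j' U')).trans (normH1_dCtr_le hh.le j' U')
    have a3 := normH1_nonneg (h := h) (avg i' (dCtr h j' U'))
    refine (normL2_mul_le_normH1 hL hC _ _).trans ?_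
    calc _ ≤ (1 + C) * ((1 + d) * normH2 h U) * ((1 + d) * normH2 h U') := by gcongr
      _ = _ := by ring
  have b1 : normL2 h (avg k (avg l W) * dCtr h k (dCtr h l V)) ≤ C * normH2 h W * normH2 h V :=
    (normL2_mul_le hh.le fun p => abs_avg_le (abs_avg_le (hC.abs_le J W) l) k p).trans
      (by gcongr; exact normL2_dCtr_dCtr_le_normH2 hh.le k l V)
  have b2 : normL2 h (avg k (avg l V) * dCtr h k (dCtr h l W)) ≤ C * normH2 h V * normH2 h W :=
    (normL2_mul_le hh.le fun p => abs_avg_le (abs_avg_le (hC.abs_le J V) l) k p).trans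
      (by gcongr; exact normL2_dCtr_dCtr_le_normH2 hh.le k l W)
  rw [e]
  refine (normL2_add_le hh.le _ _).trans ?_
  refine (add_le_add (normL2_add_le hh.le _ _) (normL2_add_le hh.le _ _)).trans ?_
  have c1 := cross V W k l l k
  have c2 := cross V W l k k l
  linarith

/-! ### Size of the pointwise errors -/

theorem normL2_absSum_le {h : ℝ} (hh : 0 ≤ h) {Φ : GridTensor d J} {r : ℝ}
    (H : ∀ i j, normL2 h (entry Φ i j) ≤ r) :
    normL2 h (fun p => absSum (Φ p)) ≤ d ^ 2 * r := by
  have e : (fun p => absSum (Φ p)) = ∑ i, ∑ j, fun p => |entry Φ i j p| := by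
    funext p; simp [absSum, entry, Finset.sum_apply]
  rw [e]
  calc _ ≤ ∑ i, ∑ j, normL2 h (fun p => |entry Φ i j p|) :=
        (normL2_sum_le hh _ _).trans (Finset.sum_le_sum fun i _ => normL2_sum_le hh _ _)
    _ ≤ ∑ _i : Fin d, ∑ _j : Fin d, r := by
        gcongr with i _ j _
        rw [normL2_abs]
        exact H i j
    _ = _ := by simp; ring

theorem normL2_pow_abs {h : ℝ} (U : GridFn d J) (n : ℕ) :
    normL2 h (fun p => |U p| ^ n) = normL2 h (U ^ n) := by
  rw [← normL2_abs (U ^ n)]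
  simp [abs_pow]

theorem normL2_add_cube_le {h : ℝ} (hh : 0 ≤ h) {V W : GridFn d J} (hV : ∀ p, 0 ≤ V p)
    (hW : ∀ p, 0 ≤ W p) : normL2 h ((V + W) ^ 3) ≤ 4 * (normL2 h (V ^ 3) + normL2 h (W ^ 3)) := by
  have : normL2 h ((V + W) ^ 3) ≤ normL2 h ((4 : ℝ) • (V ^ 3 + W ^ 3)) := by
    refine normL2_mono hh fun p => ?_
    have h1 := hV p
    have h2 := hW p
    simp only [Pi.pow_apply, Pi.add_apply, Pi.smul_apply, smul_eq_mul]
    rw [abs_of_nonneg (by positivity)]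
    nlinarith [mul_nonneg (add_nonneg h1 h2) (sq_nonneg (V p - W p))]
  refine this.trans ?_
  rw [normL2_smul hh, abs_of_pos (by norm_num)]
  gcongr
  exact normL2_add_le hh _ _

theorem normL2_absSum_cube_le {h : ℝ} (hh : 0 ≤ h) {Φ : GridTensor d J} {r : ℝ}
    (H : ∀ i j, normL2 h (entry Φ i j ^ 3) ≤ r) :
    normL2 h ((fun p => absSum (Φ p)) ^ 3) ≤ (d ^ 2) ^ 3 * r := by
  have e : normL2 h ((fun p => absSum (Φ p)) ^ 3)
      ≤ normL2 h (((d : ℝ) ^ 2) ^ 2 • ∑ q : Fin d × Fin d, fun p => |entry Φ q.1 q.2 p| ^ 3) := by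
    refine normL2_mono hh fun p => ?_
    have := pow_sum_le_card_mul_sum_pow (s := (Finset.univ : Finset (Fin d × Fin d)))
      (f := fun q => |entry Φ q.1 q.2 p|) (fun q _ => abs_nonneg _) 2
    simp only [Pi.pow_apply, Pi.smul_apply, smul_eq_mul, Finset.sum_apply]
    rw [abs_of_nonneg (pow_nonneg (absSum_nonneg _) 3)]
    rw [Finset.card_univ, Fintype.card_prod, Fintype.card_fin, Fintype.sum_prod_type] at this
    push_cast at this
    rw [sq (d : ℝ)]
    exact this
  refine e.trans ?_
  rw [normL2_smul hh, abs_of_nonneg (by positivity)]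
  calc _ ≤ ((d : ℝ) ^ 2) ^ 2 * ∑ q : Fin d × Fin d, normL2 h (fun p => |entry Φ q.1 q.2 p| ^ 3) := by
        gcongr
        exact normL2_sum_le hh _ _
    _ ≤ ((d : ℝ) ^ 2) ^ 2 * ∑ _q : Fin d × Fin d, r := by
        gcongr with q
        rw [normL2_pow_abs]
        exact H q.1 q.2
    _ = _ := by simp; ring

theorem normL2_sizeFn_le (hL : 0 < L) (E : GridTensor d J) (e : GridFn d J) :
    normL2 (mesh L J) (sizeFn E e)
      ≤ (d ^ 2 + 1) * (normH1T (mesh L J) E + normH2 (mesh L J) e) := by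
  have hh := (mesh_pos (J := J) hL).le
  have h1 := normL2_absSum_le hh fun i j =>
    (normL2_le_normH1 hh _).trans (normH1_entry_le hh E i j)
  have h2 := (normL2_le_normH1 hh e).trans (normH1_le_normH2 hh e)
  have h3 : 0 ≤ normH1T (mesh L J) E := Real.sqrt_nonneg _
  have h4 := normH2_nonneg (h := mesh L J) e
  refine (normL2_add_le hh (fun p => absSum (E p)) fun p => |e p|).trans ?_
  rw [normL2_abs]
  nlinarith [mul_nonneg (sq_nonneg (d : ℝ)) h4]

theorem normL2_sizeFn_cube_le (hL : 0 < L) (hC : IsSobolevConst d L C) (E : GridTensor d J)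
    (e : GridFn d J) :
    normL2 (mesh L J) (sizeFn E e ^ 3)
      ≤ 4 * ((d ^ 2) ^ 3 * C + C) * (normH1T (mesh L J) E + normH2 (mesh L J) e) ^ 3 := by
  have hh := (mesh_pos (J := J) hL).le
  have C0 := hC.nonneg
  have h3 : 0 ≤ normH1T (mesh L J) E := Real.sqrt_nonneg _
  have h4 := normH2_nonneg (h := mesh L J) e
  set N := normH1T (mesh L J) E + normH2 (mesh L J) e with hN
  have h1 := normL2_absSum_cube_le hh (Φ := E) (r := C * N ^ 3) fun i j => by
    refine (hC.cube_le J _).trans ?_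
    have := normH1_nonneg (h := mesh L J) (entry E i j)
    gcongr
    exact (normH1_entry_le hh E i j).trans (by linarith)
  have h2 : normL2 (mesh L J) ((fun p => |e p|) ^ 3) ≤ C * N ^ 3 := by
    have e1 : ((fun p => |e p|) ^ 3 : GridFn d J) = fun p => |e p| ^ 3 := rfl
    rw [e1, normL2_pow_abs]
    refine (hC.cube_le J _).trans ?_
    have := normH1_nonneg (h := mesh L J) e
    gcongr
    exact (normH1_le_normH2 hh e).trans (by linarith)
  refine (normL2_add_cube_le hh (fun p => absSum_nonneg (E p)) fun p => abs_nonneg (e p)).trans ?_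
  linarith

theorem absSum_le_normH2T (hL : 0 < L) (hC : IsSobolevConst d L C) (E : GridTensor d J)
    (p : Grid d J) : absSum (E p) ≤ d ^ 2 * (C * normH2T (mesh L J) E) := by
  have hh := (mesh_pos (J := J) hL).le
  calc absSum (E p) ≤ ∑ _i : Fin d, ∑ _j : Fin d, C * normH2T (mesh L J) E := by
        refine Finset.sum_le_sum fun i _ => Finset.sum_le_sum fun j _ => ?_
        refine (hC.abs_le J (entry E i j) p).trans ?_
        have := hC.nonneg
        gcongr
        exact normH2_entry_le hh E i j
    _ = _ := by simp; ring

theorem normL2_hessH_le (hL : 0 < L) (e : GridFn d J) (k l : Fin d) :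
    normL2 (mesh L J) (entry (hessH (mesh L J) e) k l) ≤ normH2 (mesh L J) e :=
  normL2_dCtr_dCtr_le_normH2 (mesh_pos hL).le k l e

end Algebra

/-! ### Coercivity of the energy -/

section Coercivity

/-- For `y ≤ |k|/ε` the cubic term is bounded by a constant, beyond that the quartic term dominates.
-/
theorem exists_cube_le_quartic (k ε : ℝ) (hε : 0 < ε) :
    ∃ C : ℝ, 0 ≤ C ∧ ∀ y : ℝ, 0 ≤ y → k * y ^ 3 ≤ ε * y ^ 4 + C := by
  refine ⟨|k| * (|k| / ε) ^ 3, by positivity, fun y hy => ?_⟩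
  have hk : k * y ^ 3 ≤ |k| * y ^ 3 := by gcongr; exact le_abs_self k
  refine hk.trans ?_
  rcases le_total y (|k| / ε) with h | h
  · have : |k| * y ^ 3 ≤ |k| * (|k| / ε) ^ 3 := by gcongr
    have : 0 ≤ ε * y ^ 4 := by positivity
    linarith
  · rw [div_le_iff₀ hε] at h
    have h1 : |k| * y ^ 3 ≤ y * ε * y ^ 3 := by gcongr
    have h2 : 0 ≤ |k| * (|k| / ε) ^ 3 := by positivity
    calc |k| * y ^ 3 ≤ y * ε * y ^ 3 := h1
      _ = ε * y ^ 4 := by ring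
      _ ≤ _ := by linarith

theorem exists_le_sq (k ε : ℝ) (hε : 0 < ε) :
    ∃ C : ℝ, 0 ≤ C ∧ ∀ x : ℝ, k * x ≤ ε * x ^ 2 + C := by
  refine ⟨k ^ 2 / (4 * ε), by positivity, fun x => ?_⟩
  have : ε * x ^ 2 + k ^ 2 / (4 * ε) - k * x = (2 * ε * x - k) ^ 2 / (4 * ε) := by
    field_simp; ring
  have h2 : 0 ≤ (2 * ε * x - k) ^ 2 / (4 * ε) := by positivity
  linarith

variable {d : ℕ}

theorem frob_self_nonneg (X : Matrix (Fin d) (Fin d) ℝ) : 0 ≤ frob X X :=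
  Finset.sum_nonneg fun _ _ => Finset.sum_nonneg fun _ _ => mul_self_nonneg _

theorem absSum_sq_le (X : Matrix (Fin d) (Fin d) ℝ) : absSum X ^ 2 ≤ d ^ 2 * frob X X := by
  have := sq_sum_le_card_mul_sum_sq (s := (Finset.univ : Finset (Fin d × Fin d)))
    (f := fun q => |X q.1 q.2|)
  rw [Finset.card_univ, Fintype.card_prod, Fintype.card_fin, Fintype.sum_prod_type,
    Fintype.sum_prod_type] at this
  push_cast at this
  simp only [sq_abs] at this
  simpa only [absSum, frob, sq] using this

theorem exists_fbn_ge (P : Params) (hC : 0 < P.C) (d : ℕ) : ∃ C : ℝ, 0 ≤ C ∧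
    ∀ Q : Matrix (Fin d) (Fin d) ℝ, Q.IsSymm → P.C / 8 * frob Q Q ^ 2 - C ≤ fbn P Q := by
  obtain ⟨C1, h1, H1⟩ := exists_le_sq (-(P.A / 2)) (P.C / 16) (by positivity)
  -- Because `absSum⁴ ≤ (d⁴ + 1) frob²`, this weight makes the cubic term cost at most another
  -- `C/16` of `frob²`. Together with the quadratic term `C/8` of the available `C/4` is spent.
  obtain ⟨C2, h2, H2⟩ := exists_cube_le_quartic |P.B / 3| (P.C / (16 * ((d : ℝ) ^ 4 + 1)))
    (by positivity)
  refine ⟨C1 + C2, by positivity, fun Q hQ => ?_⟩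
  have e1 : (Q * Q).trace = frob Q Q := by
    simp only [Matrix.trace, Matrix.diag, Matrix.mul_apply, frob]
    exact Finset.sum_congr rfl fun i _ => Finset.sum_congr rfl fun j _ => by rw [hQ.apply]
  set x := frob Q Q with hx
  set y := absSum Q with hy
  have y0 : 0 ≤ y := absSum_nonneg Q
  have hy4 : y ^ 4 ≤ ((d : ℝ) ^ 4 + 1) * x ^ 2 := by
    calc y ^ 4 = (y ^ 2) ^ 2 := by ring
      _ ≤ (d ^ 2 * x) ^ 2 := by gcongr; exact absSum_sq_le Q
      _ ≤ _ := by nlinarith [sq_nonneg x]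
  have cub : (if d = 3 then P.B / 3 * (Q * Q * Q).trace else 0) ≤ |P.B / 3| * y ^ 3 := by
    split_ifs
    · refine (le_abs_self _).trans ?_
      rw [abs_mul]
      gcongr
      refine (abs_trace_le _).trans ((absSum_mul_le _ _).trans ?_)
      calc _ ≤ y * y * y := by gcongr; exact absSum_mul_le _ _
        _ = _ := by ring
    · positivity
  have b1 := H1 x
  have b2 := H2 y y0
  have b3 : P.C / (16 * ((d : ℝ) ^ 4 + 1)) * y ^ 4 ≤ P.C / 16 * x ^ 2 := by
    calc _ ≤ P.C / (16 * ((d : ℝ) ^ 4 + 1)) * (((d : ℝ) ^ 4 + 1) * x ^ 2) := by gcongr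
      _ = _ := by field_simp
  rw [fbn, e1]
  linarith

theorem exists_fs_ge (P : Params) (hc : 0 < P.c) : ∃ C : ℝ, 0 ≤ C ∧
    ∀ u : ℝ, P.c / 8 * u ^ 4 - C ≤ fs P u := by
  obtain ⟨C1, h1, H1⟩ := exists_le_sq (-(P.a / 2)) (P.c / 16) (by positivity)
  obtain ⟨C2, h2, H2⟩ := exists_cube_le_quartic |P.b / 3| (P.c / 16) (by positivity)
  refine ⟨C1 + C2, by positivity, fun u => ?_⟩
  have b1 := H1 (u ^ 2)
  have b2 := H2 |u| (abs_nonneg u)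
  have b3 : -(P.b / 3 * u ^ 3) ≤ |P.b / 3| * |u| ^ 3 := by
    rw [← abs_pow, ← abs_mul]; exact neg_le_abs _
  have e4 : |u| ^ 4 = u ^ 4 := Even.pow_abs (by decide) u
  rw [e4] at b2
  rw [fs]
  linarith [show (u ^ 2) ^ 2 = u ^ 4 by ring]

/-- Coercivity of the energy density: only a fraction of the Hessian is lost. -/
theorem exists_energyDensity_ge (P : Params) (hP : P.Admissible d) : ∃ θ δ C : ℝ,
    0 < θ ∧ θ < 1 ∧ 0 < δ ∧ 0 ≤ C ∧ ∀ (Q H : Matrix (Fin d) (Fin d) ℝ) (u : ℝ), IsQTensor Q →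
      -(θ * P.B0 * frob H H) + δ * (frob Q Q + u ^ 2) - C ≤ energyDensity P Q u H := by
  obtain ⟨C1, h1, H1⟩ := exists_fbn_ge P hP.C_pos d
  obtain ⟨C2, h2, H2⟩ := exists_fs_ge P hP.c_pos
  have hB0 := hP.B0_pos
  set σ := 1 / sPlus P d with hσ
  set K0 := P.B0 * P.q ^ 4 with hK0
  have K00 : 0 ≤ K0 := by positivity
  set m0 := min P.C P.c with hm0
  have m00 : 0 < m0 := lt_min hP.C_pos hP.c_pos
  -- The loss `ε K₀ |M u|²` is quartic in `(Q, u)` at most; this `ε` fits it into the quartic bulk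
  -- terms. Using `K0 + 1` keeps the denominator positive when `q = 0`.
  set ε := m0 / (16 * ((K0 + 1) * (σ ^ 2 + 1))) with hε
  have ε0 : 0 < ε := by positivity
  have hεK : ε * K0 * (σ ^ 2 + 1) ≤ m0 / 16 := by
    calc ε * K0 * (σ ^ 2 + 1) ≤ ε * (K0 + 1) * (σ ^ 2 + 1) := by gcongr; linarith
      _ = m0 / 16 := by rw [hε]; field_simp
  refine ⟨1 / (1 + ε), m0 / 32, C1 + C2 + m0, by positivity, ?_, by positivity, by positivity,
    fun Q H u hQ => ?_⟩
  · rw [div_lt_one (by positivity)]; linarith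
  set x := frob Q Q with hx
  have x0 : 0 ≤ x := frob_self_nonneg Q
  set V := u • mTensor P Q with hV
  -- `Q` is traceless, so it is orthogonal to the identity and the mixed term of `|M|²` disappears.
  have hN : frob V V ≤ u ^ 2 * (σ ^ 2 * x + 1) := by
    have e1 : frob Q (1 : Matrix (Fin d) (Fin d) ℝ) = 0 := by
      have := hQ.2
      simpa [frob, Matrix.one_apply, Matrix.trace] using this
    have e2 : frob (1 : Matrix (Fin d) (Fin d) ℝ) 1 = d := by
      simp [frob, Matrix.one_apply]
    have e3 : frob (mTensor P Q) (mTensor P Q) = σ ^ 2 * x + 1 / d * (1 / d * d) := by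
      simp only [mTensor, frob_add_left, frob_add_right, frob_smul_right,
        frob_comm ((1 / sPlus P d) • Q), frob_comm ((1 / (d : ℝ)) • (1 : Matrix (Fin d) (Fin d) ℝ)),
        frob_comm (1 : Matrix (Fin d) (Fin d) ℝ) Q, e1, e2]
      rw [← hσ, ← hx]; ring
    have e4 : frob V V = u ^ 2 * frob (mTensor P Q) (mTensor P Q) := by
      rw [hV, frob_smul_right, frob_comm, frob_smul_right]; ring
    have e5 : 1 / (d : ℝ) * (1 / d * d) ≤ 1 := by
      rcases Nat.eq_zero_or_pos d with rfl | hd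
      · simp
      · have : (1 : ℝ) ≤ d := by exact_mod_cast hd
        rw [one_div, inv_mul_cancel₀ (by positivity), mul_one]
        exact inv_le_one_of_one_le₀ this
    rw [e4, e3]
    gcongr
  have hN0 : 0 ≤ frob V V := frob_self_nonneg V
  -- Expand `B₀ (1 + ε) |H/(1 + ε) + q² V|² ≥ 0`. With `ε = 0` the full `B₀ |H|²` would be lost; the
  -- small extra multiple of `|V|²` buys `θ = 1/(1 + ε) < 1`.
  have step1 : -(1 / (1 + ε) * P.B0 * frob H H) - ε * (K0 * frob V V)
      ≤ 2 * P.B0 * P.q ^ 2 * frob H V + K0 * frob V V := by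
    have h3 := frob_self_nonneg ((1 / (1 + ε)) • H + P.q ^ 2 • V)
    simp only [frob_add_left, frob_add_right, frob_smul_right,
      frob_comm ((1 / (1 + ε)) • H), frob_comm (P.q ^ 2 • V), frob_comm V H] at h3
    have h4 : 0 ≤ P.B0 * (1 + ε) * (1 / (1 + ε) * (1 / (1 + ε) * frob H H)
        + P.q ^ 2 * (1 / (1 + ε) * frob H V)
        + (1 / (1 + ε) * (P.q ^ 2 * frob H V) + P.q ^ 2 * (P.q ^ 2 * frob V V))) :=
      mul_nonneg (by positivity) (by linarith)
    have h5 : (1 + ε) * (1 / (1 + ε)) = 1 := by field_simp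
    have h6 : P.B0 * (1 + ε) * (1 / (1 + ε) * (1 / (1 + ε) * frob H H)
        + P.q ^ 2 * (1 / (1 + ε) * frob H V)
        + (1 / (1 + ε) * (P.q ^ 2 * frob H V) + P.q ^ 2 * (P.q ^ 2 * frob V V)))
        = 1 / (1 + ε) * P.B0 * frob H H + 2 * P.B0 * P.q ^ 2 * frob H V
          + (1 + ε) * (K0 * frob V V) := by
      rw [hK0]
      linear_combination (P.B0 * (1 / (1 + ε) * frob H H) + 2 * P.B0 * P.q ^ 2 * frob H V) * h5
    linarith
  have step2 : ε * (K0 * frob V V) ≤ m0 / 16 * (u ^ 4 + x ^ 2 / 2 + 1 / 2) := by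
    calc ε * (K0 * frob V V) ≤ ε * (K0 * (u ^ 2 * (σ ^ 2 * x + 1))) := by gcongr
      _ ≤ ε * K0 * (σ ^ 2 + 1) * (u ^ 4 + x ^ 2 / 2 + 1 / 2) := by
        have a1 : u ^ 2 * (σ ^ 2 * x + 1) ≤ (σ ^ 2 + 1) * (u ^ 4 + x ^ 2 / 2 + 1 / 2) := by
          nlinarith [mul_nonneg (sq_nonneg σ) (sq_nonneg (u ^ 2 - x)), sq_nonneg (u ^ 2 - 1),
            mul_nonneg (sq_nonneg σ) (sq_nonneg (u ^ 2)), sq_nonneg x, sq_nonneg (u ^ 2),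
            sq_nonneg σ]
        calc _ = ε * K0 * (u ^ 2 * (σ ^ 2 * x + 1)) := by ring
          _ ≤ ε * K0 * ((σ ^ 2 + 1) * (u ^ 4 + x ^ 2 / 2 + 1 / 2)) := by gcongr
          _ = _ := by ring
      _ ≤ _ := by gcongr
  have b1 := H1 Q hQ.1
  have b2 := H2 u
  have b3 : m0 * x ^ 2 ≤ P.C * x ^ 2 := by gcongr; exact min_le_left _ _
  have b4 : m0 * u ^ 4 ≤ P.c * u ^ 4 := by gcongr; exact min_le_right _ _
  have b5 : x ≤ x ^ 2 + 1 := by nlinarith [sq_nonneg (x - 1)]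
  have b6 : u ^ 2 ≤ u ^ 4 + 1 := by nlinarith [sq_nonneg (u ^ 2 - 1)]
  have b7 := mul_le_mul_of_nonneg_left b5 m00.le
  have b8 := mul_le_mul_of_nonneg_left b6 m00.le
  have p1 : 0 ≤ m0 * x ^ 2 := by positivity
  have p2 : 0 ≤ m0 * u ^ 4 := by positivity
  rw [energyDensity, ← hV]
  change _ ≤ 2 * P.B0 * P.q ^ 2 * frob H V + K0 * frob V V + fbn P Q + fs P u
  linarith

variable {J : ℕ} [NeZero J]

/-- The part of the modified energy without the auxiliary variable. -/
noncomputable def linEnergy (P : Params) (h : ℝ) (Q : GridTensor d J) (u : GridFn d J) : ℝ :=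
  P.K / 2 * ∑ i, ∑ j, ∑ k, l2Sq h (dFwd h k (entry Q i j)) + P.B0 * l2Sq h (lapH h u)

theorem sum_frob_self (h : ℝ) (Φ : GridTensor d J) :
    h ^ d * ∑ p, frob (Φ p) (Φ p) = ∑ i, ∑ j, l2Sq h (entry Φ i j) := by
  simp only [frob, l2Sq, innerH, entry, Finset.mul_sum]
  rw [Finset.sum_comm]
  exact Finset.sum_congr rfl fun i _ => Finset.sum_comm

/-- Summation of the pointwise bound, after which the central Hessian is exchanged for the discrete
Laplacian at no cost in the constant. -/
theorem exists_energyH_ge (P : Params) (hP : P.Admissible d) (L : ℝ) (hL : 0 < L) :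
    ∃ θ δ C : ℝ, 0 < θ ∧ θ < 1 ∧ 0 < δ ∧ 0 ≤ C ∧
      ∀ (J : ℕ) [NeZero J] (Q : GridTensor d J) (u : GridFn d J), (∀ p, IsQTensor (Q p)) →
      -(θ * P.B0 * l2Sq (mesh L J) (lapH (mesh L J) u))
        + δ * (∑ i, ∑ j, l2Sq (mesh L J) (entry Q i j) + l2Sq (mesh L J) u) - C
        ≤ energyH P (mesh L J) Q u := by
  obtain ⟨θ, δ, C, θ0, θ1, δ0, C0, H⟩ := exists_energyDensity_ge P hP
  refine ⟨θ, δ, L ^ d * C, θ0, θ1, δ0, by positivity, fun J _ Q u hQ => ?_⟩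
  have hh : 0 < mesh L J := mesh_pos hL
  set h := mesh L J with hdef
  have hB0 := hP.B0_pos
  have key : h ^ d * ∑ p, (-(θ * P.B0 * frob (hessH h u p) (hessH h u p))
      + δ * (frob (Q p) (Q p) + u p ^ 2) - C) ≤ energyH P h Q u := by
    rw [energyH, innerH]
    gcongr with p
    rw [Pi.one_apply, mul_one]
    exact H _ _ _ (hQ p)
  have e : h ^ d * ∑ p, (-(θ * P.B0 * frob (hessH h u p) (hessH h u p))
      + δ * (frob (Q p) (Q p) + u p ^ 2) - C)
      = -(θ * P.B0 * (h ^ d * ∑ p, frob (hessH h u p) (hessH h u p)))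
        + δ * (h ^ d * ∑ p, frob (Q p) (Q p) + h ^ d * ∑ p, u p * u p)
        - innerH h (fun _ : Grid d J => C) 1 := by
    simp only [innerH, Pi.one_apply, mul_one, Finset.sum_sub_distrib, Finset.sum_add_distrib,
      Finset.sum_neg_distrib, ← Finset.mul_sum, sq]
    ring
  rw [e, sum_frob_self, sum_frob_self, innerH_const_one card_mul_mesh] at key
  have hl : ∑ i, ∑ j, l2Sq h (entry (hessH h u) i j) ≤ l2Sq h (lapH h u) :=
    sum_l2Sq_dCtr_dCtr_le hh.le u
  have := mul_le_mul_of_nonneg_left hl (by positivity : 0 ≤ θ * P.B0)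
  change _ + δ * (_ + l2Sq h u) - _ ≤ _ at key
  linarith

theorem normH1T_sq {h : ℝ} (hh : 0 ≤ h) (Φ : GridTensor d J) :
    normH1T h Φ ^ 2 = ∑ i, ∑ j, l2Sq h (entry Φ i j)
      + ∑ i, ∑ j, ∑ k, l2Sq h (dFwd h k (entry Φ i j)) := by
  rw [normH1T, Real.sq_sqrt (Finset.sum_nonneg fun i _ => Finset.sum_nonneg fun j _ =>
    h1Sq_nonneg hh _)]
  simp only [h1Sq, Finset.sum_add_distrib]

theorem normH2_sq_le {h : ℝ} (hh : 0 ≤ h) (U : GridFn d J) :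
    normH2 h U ^ 2 ≤ 2 * (l2Sq h U + l2Sq h (lapH h U)) := by
  rw [normH2, Real.sq_sqrt (h2Sq_nonneg hh _), h2Sq, h1Sq]
  have h1 := sum_l2Sq_dFwd_le hh U
  have h2 := l2Sq_nonneg hh U
  have h3 := l2Sq_nonneg hh (lapH h U)
  linarith

/-- `y² ≤ 2 e^y` with `y = δ X²` already beats the fourth power. Later steps use only the zeroth and
second powers. -/
theorem exists_exp_mul_pow_le (δ : ℝ) (hδ : 0 < δ) : ∃ C : ℝ, 0 ≤ C ∧ ∀ X : ℝ, 0 ≤ X →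
    Real.exp (-(δ * X ^ 2)) * (1 + X) ^ 4 ≤ C := by
  refine ⟨8 + 16 / δ ^ 2, by positivity, fun X hX => ?_⟩
  have h1 : (1 + X) ^ 4 ≤ 8 + 8 * X ^ 4 := by
    nlinarith [sq_nonneg (X - 1), sq_nonneg (X ^ 2 - 1), mul_nonneg hX (sq_nonneg (X - 1))]
  have h2 := Real.quadratic_le_exp_of_nonneg (by positivity : 0 ≤ δ * X ^ 2)
  have h3 : X ^ 4 ≤ 2 / δ ^ 2 * Real.exp (δ * X ^ 2) := by
    rw [div_mul_eq_mul_div, le_div_iff₀ (by positivity)]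
    nlinarith [mul_nonneg hδ.le (sq_nonneg X)]
  have h4 : 1 ≤ Real.exp (δ * X ^ 2) := Real.one_le_exp (by positivity)
  rw [Real.exp_neg, inv_mul_le_iff₀ (Real.exp_pos _)]
  calc (1 + X) ^ 4 ≤ 8 + 8 * X ^ 4 := h1
    _ ≤ 8 * Real.exp (δ * X ^ 2) + 8 * (2 / δ ^ 2 * Real.exp (δ * X ^ 2)) := by
      gcongr; linarith
    _ = _ := by ring

theorem multH_eq_exp (P : Params) (h : ℝ) (Q : GridTensor d J) (u : GridFn d J) (s : ℝ) :
    multH P h Q u s = Real.exp (s - energyH P h Q u) := by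
  rw [multH, Real.exp_sub]

/-- A bound of the modified energy makes the multiplier decay faster than any power of the norms
of the state. -/
theorem exists_multH_mul_pow_le (P : Params) (hP : P.Admissible d) (L : ℝ) (hL : 0 < L)
    (F : ℝ) : ∃ C : ℝ, 0 ≤ C ∧ ∀ (J : ℕ) [NeZero J] (Q : GridTensor d J) (u : GridFn d J)
      (s : ℝ), (∀ p, IsQTensor (Q p)) → linEnergy P (mesh L J) Q u + s ≤ F →
      multH P (mesh L J) Q u s * (1 + (normH1T (mesh L J) Q + normH2 (mesh L J) u)) ^ 4 ≤ C := by
  obtain ⟨θ, δ, C1, θ0, θ1, δ0, C10, H⟩ := exists_energyH_ge P hP L hL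
  have hB0 := hP.B0_pos
  have hK := hP.K_pos
  -- The three margins left in the sum of linear and nonlinear energy: `δ` for the `l²` norms, `K/2`
  -- for the gradient of `Q`, `(1 - θ) B₀` for the Laplacian of `u`.
  obtain ⟨δ', δ'0, m1, m2, m3⟩ : ∃ δ' : ℝ, 0 < δ' ∧ δ' ≤ δ ∧ δ' ≤ P.K / 2 ∧
      δ' ≤ (1 - θ) * P.B0 :=
    ⟨min (min δ (P.K / 2)) ((1 - θ) * P.B0),
      lt_min (lt_min δ0 (by positivity)) (mul_pos (by linarith) hB0),
      (min_le_left _ _).trans (min_le_left _ _), (min_le_left _ _).trans (min_le_right _ _),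
      min_le_right _ _⟩
  obtain ⟨C2, C20, H2⟩ := exists_exp_mul_pow_le (δ' / 4) (by positivity)
  refine ⟨Real.exp (F + C1) * C2, by positivity, fun J _ Q u s hQ hF => ?_⟩
  have hh : 0 < mesh L J := mesh_pos hL
  have key := H J Q u hQ
  have hsq := normH1T_sq hh.le Q
  have hsq2 := normH2_sq_le hh.le u
  rw [linEnergy] at hF
  have q00 : 0 ≤ ∑ i, ∑ j, l2Sq (mesh L J) (entry Q i j) :=
    Finset.sum_nonneg fun _ _ => Finset.sum_nonneg fun _ _ => l2Sq_nonneg hh.le _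
  have q10 : 0 ≤ ∑ i, ∑ j, ∑ k, l2Sq (mesh L J) (dFwd (mesh L J) k (entry Q i j)) :=
    Finset.sum_nonneg fun _ _ => Finset.sum_nonneg fun _ _ =>
      Finset.sum_nonneg fun _ _ => l2Sq_nonneg hh.le _
  have u0 := l2Sq_nonneg hh.le u
  have u2 := l2Sq_nonneg hh.le (lapH (mesh L J) u)
  have a0 : 0 ≤ normH1T (mesh L J) Q := Real.sqrt_nonneg _
  have b0 : 0 ≤ normH2 (mesh L J) u := Real.sqrt_nonneg _
  rw [multH_eq_exp]
  generalize normH1T (mesh L J) Q = a at *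
  generalize normH2 (mesh L J) u = b at *
  generalize ∑ i, ∑ j, l2Sq (mesh L J) (entry Q i j) = q0 at *
  generalize ∑ i, ∑ j, ∑ k, l2Sq (mesh L J) (dFwd (mesh L J) k (entry Q i j)) = q1 at *
  generalize l2Sq (mesh L J) (lapH (mesh L J) u) = v2 at *
  generalize l2Sq (mesh L J) u = v0 at *
  generalize energyH P (mesh L J) Q u = E at *
  have d1 := mul_le_mul_of_nonneg_right m1 q00
  have d2 := mul_le_mul_of_nonneg_right m2 q10
  have d3 := mul_le_mul_of_nonneg_right m1 u0
  have d4 := mul_le_mul_of_nonneg_right m3 u2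
  have hexp : s - E ≤ (F + C1) + -(δ' / 4 * (a + b) ^ 2) := by
    have e1 : δ' / 4 * (a + b) ^ 2 ≤ δ' / 4 * (2 * a ^ 2 + 2 * b ^ 2) :=
      mul_le_mul_of_nonneg_left (by linarith only [sq_nonneg (a - b)]) (by positivity)
    have e2 := mul_le_mul_of_nonneg_left hsq2 δ'0.le
    have e3 : δ' * a ^ 2 = δ' * (q0 + q1) := by rw [hsq]
    have e4 : 0 ≤ δ' * (q0 + q1) := by positivity
    linarith only [e1, e2, e3, e4, d1, d2, d3, d4, hF, key]
  calc _ ≤ Real.exp ((F + C1) + -(δ' / 4 * (a + b) ^ 2)) * (1 + (a + b)) ^ 4 := by gcongr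
    _ = Real.exp (F + C1) * (Real.exp (-(δ' / 4 * (a + b) ^ 2)) * (1 + (a + b)) ^ 4) := by
      rw [Real.exp_add]; ring
    _ ≤ _ := by gcongr; exact H2 _ (by positivity)

end Coercivity

/-! ### Energy stability -/

section Stability

variable {d J : ℕ} [NeZero J] {h τ η0 g : ℝ} {P : Params}

theorem l2Sq_sub_l2Sq (V V' : GridFn d J) :
    l2Sq h V' - l2Sq h V = 2 * innerH h V (V' - V) + l2Sq h (V' - V) := by
  simp only [l2Sq, innerH_sub_left, innerH_sub_right, innerH_comm V' V]; ring

theorem l2Sq_add_le (hh : 0 ≤ h) (U V : GridFn d J) :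
    l2Sq h (U + V) ≤ 2 * l2Sq h U + 2 * l2Sq h V := by
  have := l2Sq_nonneg hh (U - V)
  simp only [l2Sq, innerH_sub_left, innerH_sub_right, innerH_add_left, innerH_add_right,
    innerH_comm V U] at this ⊢
  linarith

theorem h1Sq_add_le (hh : 0 ≤ h) (U V : GridFn d J) :
    h1Sq h (U + V) ≤ 2 * h1Sq h U + 2 * h1Sq h V := by
  simp only [h1Sq, map_add, mul_add, Finset.mul_sum]
  have h1 := l2Sq_add_le hh U V
  have h2 : ∑ k, l2Sq h (dFwd h k U + dFwd h k V)
      ≤ ∑ k, 2 * l2Sq h (dFwd h k U) + ∑ k, 2 * l2Sq h (dFwd h k V) := by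
    rw [← Finset.sum_add_distrib]
    exact Finset.sum_le_sum fun k _ => l2Sq_add_le hh _ _
  linarith

theorem normH1T_add_le (hh : 0 ≤ h) (Φ Ψ : GridTensor d J) :
    normH1T h (Φ + Ψ) ≤ 2 * (normH1T h Φ + normH1T h Ψ) := by
  have a0 : 0 ≤ normH1T h Φ := Real.sqrt_nonneg _
  have b0 : 0 ≤ normH1T h Ψ := Real.sqrt_nonneg _
  have sq : ∀ X : GridTensor d J, normH1T h X ^ 2 = ∑ i, ∑ j, h1Sq h (entry X i j) := fun X =>
    Real.sq_sqrt (Finset.sum_nonneg fun _ _ => Finset.sum_nonneg fun _ _ => h1Sq_nonneg hh _)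
  refine le_of_sq_le_sq (?_ : _ ^ 2 ≤ _ ^ 2) (by positivity)
  have h1 : normH1T h (Φ + Ψ) ^ 2 ≤ 2 * normH1T h Φ ^ 2 + 2 * normH1T h Ψ ^ 2 := by
    rw [sq, sq, sq]
    simp only [Finset.mul_sum, ← Finset.sum_add_distrib]
    exact Finset.sum_le_sum fun i _ => Finset.sum_le_sum fun j _ => h1Sq_add_le hh _ _
  nlinarith

theorem normH2_add_le (hh : 0 ≤ h) (U V : GridFn d J) :
    normH2 h (U + V) ≤ 2 * (normH2 h U + normH2 h V) := by
  have a0 := normH2_nonneg (h := h) U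
  have b0 := normH2_nonneg (h := h) V
  have sq : ∀ X : GridFn d J, normH2 h X ^ 2 = h2Sq h X := fun X => Real.sq_sqrt (h2Sq_nonneg hh X)
  refine le_of_sq_le_sq (?_ : _ ^ 2 ≤ _ ^ 2) (by positivity)
  have h1 : normH2 h (U + V) ^ 2 ≤ 2 * normH2 h U ^ 2 + 2 * normH2 h V ^ 2 := by
    rw [sq, sq, sq, h2Sq, h2Sq, h2Sq, map_add]
    linarith [h1Sq_add_le hh U V, l2Sq_add_le hh (lapH h U) (lapH h V)]
  nlinarith

/-- The term `(τ/2) S (U' - U)` evaluates the operator at the midpoint of `U` and `U'`, so the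
quadratic gradient energy telescopes exactly. -/
theorem innerH_step_opL_add_energy (hh : 0 < h) (hτ : 0 < τ) {U H U' : GridFn d J}
    (hU' : U' = opFun (fun z => Real.exp (-τ * z)) (opL P h g) U
      + τ • opFun (fun z => phi1 (-τ * z)) (opL P h g) (-(g • H) + (g * P.κ1) • U)) :
    g * innerH h H (U' - U)
      + 1 / τ * innerH h (opFun (fun z => calQ1 (τ * z)) (opL P h g) (U' - U)) (U' - U)
      + g * P.κ1 / 2 * l2Sq h (U' - U)
      + (P.K / 2 * ∑ k, l2Sq h (dFwd h k U') - P.K / 2 * ∑ k, l2Sq h (dFwd h k U)) = 0 := by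
  have e : ∑ k, l2Sq h (dFwd h k U') - ∑ k, l2Sq h (dFwd h k U)
      = 2 * ∑ k, innerH h (dFwd h k U) (dFwd h k (U' - U))
        + ∑ k, l2Sq h (dFwd h k (U' - U)) := by
    simp only [← Finset.sum_sub_distrib, Finset.mul_sum, ← Finset.sum_add_distrib, map_sub,
      l2Sq_sub_l2Sq]
  rw [innerH_step_opL hh hτ hU']
  linear_combination P.K / 2 * e

theorem innerH_step_opD_add_energy (hh : 0 < h) (hτ : 0 < τ) {U H U' : GridFn d J}
    (hU' : U' = opFun (fun z => Real.exp (-τ * z)) (opD P h g) U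
      + τ • opFun (fun z => phi1 (-τ * z)) (opD P h g) (-(g • H) + (g * P.κ2) • U)) :
    g * innerH h H (U' - U)
      + 1 / τ * innerH h (opFun (fun z => calQ1 (τ * z)) (opD P h g) (U' - U)) (U' - U)
      + g * P.κ2 / 2 * l2Sq h (U' - U)
      + (P.B0 * l2Sq h (lapH h U') - P.B0 * l2Sq h (lapH h U)) = 0 := by
  have e := l2Sq_sub_l2Sq (h := h) (lapH h U) (lapH h U')
  rw [← map_sub] at e
  rw [innerH_step_opD hh hτ hU']
  linear_combination P.B0 * e

variable {Q : ℕ → GridTensor d J} {u : ℕ → GridFn d J} {s sTil ξ : ℕ → ℝ}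

/-- The discrete energy identity. -/
theorem IsSchemeSolution.energy_identity (hS : IsSchemeSolution P h τ η0 Q u s sTil ξ)
    (hh : 0 < h) (hτ : 0 < τ) (n : ℕ) :
    linEnergy P h (Q (n + 1)) (u (n + 1)) - linEnergy P h (Q n) (u n) + (sTil (n + 1) - s n)
      + dissRate P h τ (multH P h (Q n) (u n) (s n)) (Q (n + 1) - Q n) (u (n + 1) - u n)
      + multH P h (Q n) (u n) (s n) * (P.κ1 / 2 * ∑ i, ∑ j, l2Sq h (entry (Q (n + 1) - Q n) i j)
        + P.κ2 / 2 * l2Sq h (u (n + 1) - u n)) = 0 := by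
  rw [hS.step_sTil n, dissRate, innerHT, innerHT, linEnergy, linEnergy]
  have hu := hS.step_u n
  have hQ := hS.step_Q n
  set g := multH P h (Q n) (u n) (s n) with hg
  have h2 := innerH_step_opD_add_energy hh hτ (H := muH P h (Q n) (u n)) (U := u n)
    (U' := u (n + 1)) (g := g) (P := P) (hu.trans (by
      congr 3))
  have h1 : ∀ i j, _ := fun i j => innerH_step_opL_add_energy hh hτ
    (H := entry (hH P h (Q n) (u n)) i j) (U := entry (Q n) i j) (U' := entry (Q (n + 1)) i j)
    (g := g) (P := P) (by
      have e : entry (nonlinQH P h (Q n) (u n) (s n)) i j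
          = -(g • entry (hH P h (Q n) (u n)) i j) + (g * P.κ1) • entry (Q n) i j := by
        funext p; simp [entry, nonlinQH, ← hg]
      rw [← e, hQ]; rfl)
  -- The operator acts componentwise, so the scalar identity is summed over the entries of `Q`.
  have h3 := Finset.sum_eq_zero fun i (_ : i ∈ Finset.univ) =>
    Finset.sum_eq_zero fun j (_ : j ∈ Finset.univ) => h1 i j
  simp only [Finset.sum_add_distrib, Finset.sum_sub_distrib, ← Finset.mul_sum] at h3
  have e1 : ∀ i j, entry (Q (n + 1) - Q n) i j = entry (Q (n + 1)) i j - entry (Q n) i j :=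
    fun _ _ => rfl
  have e2 : ∀ (f : ℝ → ℝ) (Φ : GridTensor d J) (i j : Fin d),
    entry (opFunT f (opL P h g) Φ) i j = opFun f (opL P h g) (entry Φ i j) := fun _ _ _ _ => rfl
  simp only [e1, e2]
  linear_combination h2 + h3

/-- Because `𝒬₁ ≥ 1`, the dissipation dominates the squared `l²` increment, with a constant free of
`h`, `τ` and `g`. This supplies the low order part of the norms of the increment. -/
theorem le_dissRate (hh : 0 < h) (hτ : 0 < τ) (g : ℝ) (dQ : GridTensor d J) (du : GridFn d J) :
    ∑ i, ∑ j, l2Sq h (entry dQ i j) + l2Sq h du ≤ τ * dissRate P h τ g dQ du := by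
  rw [dissRate, ← mul_assoc, mul_one_div_cancel hτ.ne', one_mul, innerHT]
  exact add_le_add (Finset.sum_le_sum fun i _ => Finset.sum_le_sum fun j _ =>
    l2Sq_le_innerH_opFun hh (opL_selfAdjoint P hh g) (fun _ => one_le_calQ1 _) _)
    (l2Sq_le_innerH_opFun hh (opD_selfAdjoint P hh g) (fun _ => one_le_calQ1 _) _)

theorem dissRate_nonneg (hh : 0 < h) (hτ : 0 < τ) (g : ℝ) (dQ : GridTensor d J)
    (du : GridFn d J) : 0 ≤ dissRate P h τ g dQ du := by
  refine nonneg_of_mul_nonneg_right (le_trans ?_ (le_dissRate hh hτ g dQ du)) hτ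
  exact add_nonneg (Finset.sum_nonneg fun _ _ => Finset.sum_nonneg fun _ _ => l2Sq_nonneg hh.le _)
    (l2Sq_nonneg hh.le _)

/-- For time steps up to one the modified energy decreases. -/
theorem IsSchemeSolution.energy_antitone (hP : P.Admissible d)
    (hS : IsSchemeSolution P h τ η0 Q u s sTil ξ) (hh : 0 < h) (hτ : 0 < τ) (hτ1 : τ ≤ 1)
    (hη : η0 ∈ Icc (0 : ℝ) 1) (n : ℕ) :
    linEnergy P h (Q (n + 1)) (u (n + 1)) + s (n + 1) ≤ linEnergy P h (Q n) (u n) + s n := by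
  have h1 := hS.energy_identity hh hτ n
  have h2 := hS.relax_le n
  have g0 : 0 < multH P h (Q n) (u n) (s n) := by rw [multH]; positivity
  set g := multH P h (Q n) (u n) (s n)
  have R0 := dissRate_nonneg (P := P) hh hτ g (Q (n + 1) - Q n) (u (n + 1) - u n)
  have κ1 := hP.κ1_pos
  have κ2 := hP.κ2_pos
  have q0 : 0 ≤ ∑ i, ∑ j, l2Sq h (entry (Q (n + 1) - Q n) i j) :=
    Finset.sum_nonneg fun _ _ => Finset.sum_nonneg fun _ _ => l2Sq_nonneg hh.le _
  have u0 := l2Sq_nonneg hh.le (u (n + 1) - u n)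
  have h3 : 0 ≤ g * (P.κ1 / 2 * ∑ i, ∑ j, l2Sq h (entry (Q (n + 1) - Q n) i j)
        + P.κ2 / 2 * l2Sq h (u (n + 1) - u n)) := by positivity
  -- The relaxation may raise `s` by `η₀ τ` times the dissipation rate, while the identity has lost
  -- the full rate; this is why `τ ≤ 1` is needed here.
  have h4 : η0 * τ ≤ 1 := mul_le_one₀ hη.2 hτ.le hτ1
  have h5 := mul_le_mul_of_nonneg_right h4 R0
  linarith only [h1, h2, h3, h5]

end Stability

/-! ### Bounds for the discrete variations -/

section VariationBounds

/-- The Lipschitz estimate based at the zero state, where `H` vanishes. -/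
theorem exists_abs_hVar_le (P : Params) (d : ℕ) : ∃ C : ℝ, 0 ≤ C ∧
    ∀ (Q H : Matrix (Fin d) (Fin d) ℝ) (u : ℝ) (i j : Fin d),
      |hVar P Q u H i j|
        ≤ C * ((absSum Q + |u|) + (absSum Q + |u|) ^ 3 + absSum H * (1 + |u|)) := by
  obtain ⟨C, C0, H⟩ := abs_hVar_sub_le P d 0 le_rfl
  have z : absSum (0 : Matrix (Fin d) (Fin d) ℝ) ≤ 0 := by simp [absSum]
  refine ⟨C, C0, fun Q G u i j => ?_⟩
  have := H 0 Q 0 G 0 u i j z z (by simp)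
  have e : hVar P (0 : Matrix (Fin d) (Fin d) ℝ) 0 0 = 0 := by simp [hVar]
  simpa [e] using this

theorem exists_abs_muVar_le (P : Params) (d : ℕ) : ∃ C : ℝ, 0 ≤ C ∧
    ∀ (Q H : Matrix (Fin d) (Fin d) ℝ) (u v : ℝ),
      |muVar P Q u H v|
        ≤ C * ((absSum Q + |u|) + (absSum Q + |u|) ^ 3 + absSum H * (1 + absSum Q) + |v|) := by
  obtain ⟨C, C0, H⟩ := abs_muVar_sub_le P d 0 le_rfl
  have z : absSum (0 : Matrix (Fin d) (Fin d) ℝ) ≤ 0 := by simp [absSum]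
  refine ⟨C, C0, fun Q G u v => ?_⟩
  have := H 0 Q 0 G 0 u 0 v z z (by simp)
  have e : muVar P (0 : Matrix (Fin d) (Fin d) ℝ) 0 0 0 = 0 := by simp [muVar, frob]
  simpa [e] using this

variable {d : ℕ} {L : ℝ}

/-- The variation `H` is cubic in `(Q, u)` up to the term `u D²u`. The cubic part is controlled
through `L⁶`, and in `u D²u` the factor `u` is bounded pointwise by its `H²` norm. -/
theorem exists_normL2_hH_le (hd : d = 2 ∨ d = 3) (P : Params) (hL : 0 < L) (ρ : ℝ)
    (hρ : 0 ≤ ρ) : ∃ C : ℝ, 0 ≤ C ∧ ∀ (J : ℕ) [NeZero J] (Q : GridTensor d J) (u : GridFn d J)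
      (i j : Fin d), normH1T (mesh L J) Q + normH2 (mesh L J) u ≤ ρ →
      normL2 (mesh L J) (entry (hH P (mesh L J) Q u) i j) ≤ C := by
  obtain ⟨C, C0, H⟩ := exists_abs_hVar_le P d
  obtain ⟨S, hS⟩ := exists_isSobolevConst d hd L hL
  have S0 := hS.nonneg
  refine ⟨C * ((d ^ 2 + 1) * ρ + 4 * ((d ^ 2) ^ 3 * S + S) * ρ ^ 3
    + (1 + S * ρ) * (d ^ 2 * ρ)), by positivity, fun J _ Q u i j hN => ?_⟩
  have hh := (mesh_pos (J := J) hL).le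
  set h := mesh L J with hdef
  have a0 : 0 ≤ normH1T h Q := Real.sqrt_nonneg _
  have b0 := normH2_nonneg (h := h) u
  have hu : ∀ p, |u p| ≤ S * ρ := fun p => (hS.abs_le J u p).trans (by gcongr; linarith)
  have n1 : normL2 h (sizeFn Q u) ≤ (d ^ 2 + 1) * ρ :=
    (normL2_sizeFn_le hL Q u).trans (by gcongr)
  have n2 : normL2 h (sizeFn Q u ^ 3) ≤ 4 * ((d ^ 2) ^ 3 * S + S) * ρ ^ 3 :=
    (normL2_sizeFn_cube_le hL hS Q u).trans (by gcongr)
  have n3 : normL2 h (fun p => absSum (hessH h u p)) ≤ d ^ 2 * ρ :=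
    normL2_absSum_le hh fun k l => (normL2_hessH_le hL u k l).trans (by linarith)
  calc _ ≤ normL2 h (C • ((sizeFn Q u + sizeFn Q u ^ 3)
          + (1 + S * ρ) • fun p => absSum (hessH h u p))) := by
        refine normL2_mono hh fun p => (H _ _ _ i j).trans ?_
        change C * (sizeFn Q u p + sizeFn Q u p ^ 3 + _) ≤ C * (_ + (1 + S * ρ) * _)
        rw [mul_comm (1 + S * ρ)]
        have := absSum_nonneg (hessH h u p)
        gcongr
        exacts [le_rfl, hu p]
    _ ≤ _ := by
        rw [normL2_smul hh, abs_of_nonneg C0]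
        gcongr
        refine (normL2_add_le hh _ _).trans (add_le_add ((normL2_add_le hh _ _).trans ?_) ?_)
        · exact add_le_add n1 n2
        · rw [normL2_smul hh, abs_of_nonneg (by positivity)]
          gcongr

/-- With `Q` controlled only in `H¹`, two terms of `μₕ` are not estimated in `l²`, but they act on
`H²` functions. In `M : D²u` the test function is taken in the maximum norm, and the double
divergence is moved onto the test function by summation by parts. -/
theorem exists_abs_innerH_muH_le (hd : d = 2 ∨ d = 3) (P : Params) (hL : 0 < L) (ρ : ℝ)
    (hρ : 0 ≤ ρ) : ∃ C : ℝ, 0 ≤ C ∧ ∀ (J : ℕ) [NeZero J] (Q : GridTensor d J)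
      (u v : GridFn d J), normH1T (mesh L J) Q + normH2 (mesh L J) u ≤ ρ →
      |innerH (mesh L J) (muH P (mesh L J) Q u) v| ≤ C * normH2 (mesh L J) v := by
  obtain ⟨C, C0, H⟩ := exists_abs_muVar_le P d
  obtain ⟨S, hS⟩ := exists_isSobolevConst d hd L hL
  have S0 := hS.nonneg
  set A1 := (d ^ 2 + 1) * ρ with hA1
  set A3 := 4 * ((d ^ 2) ^ 3 * S + S) * ρ ^ 3 with hA3
  set m := |1 / sPlus P d| with hm
  have A10 : 0 ≤ A1 := by positivity
  have A30 : 0 ≤ A3 := by positivity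
  have m0 : 0 ≤ m := abs_nonneg _
  set D := |2 * P.B0 * P.q ^ 2| with hD
  refine ⟨C * (A1 + A3 + S * (d ^ 2 * ρ * (√(L ^ d) + A1)))
    + D * (d ^ 2 * ((m + 1) * (2 * A1 + A3))), by positivity, fun J _ Q u v hN => ?_⟩
  have hh := (mesh_pos (J := J) hL).le
  have hJ : (J : ℝ) * mesh L J = L := card_mul_mesh
  set h := mesh L J with hdef
  have a0 : 0 ≤ normH1T h Q := Real.sqrt_nonneg _
  have b0 := normH2_nonneg (h := h) u
  set r := normH2 h v with hr
  have r0 : 0 ≤ r := normH2_nonneg _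
  have n1 : normL2 h (sizeFn Q u) ≤ A1 := (normL2_sizeFn_le hL Q u).trans (by rw [hA1]; gcongr)
  have n2 : normL2 h (sizeFn Q u ^ 3) ≤ A3 :=
    (normL2_sizeFn_cube_le hL hS Q u).trans (by rw [hA3]; gcongr)
  have n3 : normL2 h (fun p => absSum (hessH h u p)) ≤ d ^ 2 * ρ :=
    normL2_absSum_le hh fun k l => (normL2_hessH_le hL u k l).trans (by linarith)
  have nv : normL2 h v ≤ r := (normL2_le_normH1 hh v).trans (normH1_le_normH2 hh v)
  have none' : normL2 h (1 : GridFn d J) ≤ √(L ^ d) := by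
    simpa using normL2_le_of_abs_le (U := (1 : GridFn d J)) (r := 1) hh hJ (by simp)
  have W0 := sizeFn_nonneg Q u
  have split : innerH h (muH P h Q u) v
      = innerH h (fun p => muVar P (Q p) (u p) (hessH h u p) 0) v
        + (2 * P.B0 * P.q ^ 2) * innerH h (divDivH P h Q u) v := by
    rw [← innerH_smul_left, ← innerH_add_left]
    congr 1
    funext p
    simp only [muH, muVar, Pi.add_apply, Pi.smul_apply, smul_eq_mul]
    ring
  have b1 : |innerH h (fun p => muVar P (Q p) (u p) (hessH h u p) 0) v|
      ≤ C * (A1 + A3 + S * (d ^ 2 * ρ * (√(L ^ d) + A1))) * r := by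
    have key : |innerH h (fun p => muVar P (Q p) (u p) (hessH h u p) 0) v|
        ≤ C * (innerH h (sizeFn Q u + sizeFn Q u ^ 3) (fun p => |v p|)
          + S * r * innerH h (fun p => absSum (hessH h u p)) (1 + sizeFn Q u)) := by
      rw [← innerH_smul_left]
      simp only [innerH, abs_mul, ← mul_add, ← Finset.sum_add_distrib,
        abs_of_nonneg (pow_nonneg hh d)]
      rw [mul_left_comm]
      gcongr
      rw [Finset.mul_sum]
      refine (Finset.abs_sum_le_sum_abs _ _).trans (Finset.sum_le_sum fun p _ => ?_)
      have hp := H (Q p) (hessH h u p) (u p) 0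
      have g0 := absSum_nonneg (hessH h u p)
      have hv : |v p| ≤ S * r := hS.abs_le J v p
      have hq : absSum (Q p) ≤ sizeFn Q u p := le_add_of_nonneg_right (abs_nonneg _)
      have q0 := absSum_nonneg (Q p)
      have w0 := W0 p
      rw [abs_mul]
      calc _ ≤ C * (sizeFn Q u p + sizeFn Q u p ^ 3
            + absSum (hessH h u p) * (1 + absSum (Q p)) + |(0 : ℝ)|) * |v p| :=
            mul_le_mul_of_nonneg_right hp (abs_nonneg _)
        _ = C * ((sizeFn Q u p + sizeFn Q u p ^ 3) * |v p|
            + |v p| * absSum (hessH h u p) * (1 + absSum (Q p))) := by rw [abs_zero]; ring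
        _ ≤ C * ((sizeFn Q u p + sizeFn Q u p ^ 3) * |v p|
            + S * r * absSum (hessH h u p) * (1 + sizeFn Q u p)) := by gcongr
        _ = _ := by simp only [Pi.add_apply, Pi.pow_apply, Pi.one_apply, Pi.smul_apply, smul_eq_mul]
    refine key.trans ?_
    have k1 : innerH h (sizeFn Q u + sizeFn Q u ^ 3) (fun p => |v p|) ≤ (A1 + A3) * r := by
      refine (le_abs_self _).trans ((abs_innerH_le hh _ _).trans ?_)
      rw [normL2_abs]
      exact mul_le_mul ((normL2_add_le hh _ _).trans (add_le_add n1 n2)) nv (normL2_nonneg _)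
        (by positivity)
    have k2 : innerH h (fun p => absSum (hessH h u p)) (1 + sizeFn Q u)
        ≤ d ^ 2 * ρ * (√(L ^ d) + A1) := by
      refine (le_abs_self _).trans ((abs_innerH_le hh _ _).trans ?_)
      exact mul_le_mul n3 ((normL2_add_le hh _ _).trans (add_le_add none' n1)) (normL2_nonneg _)
        (by positivity)
    calc _ ≤ C * ((A1 + A3) * r + S * r * (d ^ 2 * ρ * (√(L ^ d) + A1))) := by gcongr
      _ = _ := by ring
  have b2 : |innerH h (divDivH P h Q u) v| ≤ d ^ 2 * ((m + 1) * (2 * A1 + A3)) * r := by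
    have e : divDivH P h Q u
        = ∑ k, ∑ l, dCtr h k (dCtr h l fun r => mTensor P (Q r) k l * u r) := by
      funext p; simp [divDivH, Finset.sum_apply]
    have e2 : ∀ k l, |innerH h (dCtr h k (dCtr h l fun r => mTensor P (Q r) k l * u r)) v|
        ≤ (m + 1) * (2 * A1 + A3) * r := fun k l => by
      -- Both central differences pass to `v`, so no derivative of `Q` is needed.
      rw [innerH_dCtr, innerH_dCtr, neg_neg]
      refine (abs_innerH_le hh _ _).trans ?_
      have e3 : normL2 h (fun r => mTensor P (Q r) k l * u r) ≤ (m + 1) * (2 * A1 + A3) := by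
        calc _ ≤ normL2 h ((m + 1) • (sizeFn Q u + (sizeFn Q u + sizeFn Q u ^ 3))) := by
              refine normL2_mono hh fun p => ?_
              have f1 := (abs_entry_le_absSum _ k l).trans (absSum_mTensor_le P (Q p))
              have w0 := W0 p
              have hq : absSum (Q p) ≤ sizeFn Q u p := le_add_of_nonneg_right (abs_nonneg _)
              have hu : |u p| ≤ sizeFn Q u p := le_add_of_nonneg_left (absSum_nonneg _)
              have q0 := absSum_nonneg (Q p)
              have f2 := sq_le_add_cube w0
              rw [abs_mul]
              change _ ≤ (m + 1) * (sizeFn Q u p + (sizeFn Q u p + sizeFn Q u p ^ 3))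
              calc _ ≤ (m * sizeFn Q u p + 1) * sizeFn Q u p := by
                    refine mul_le_mul (f1.trans ?_) hu (abs_nonneg _) (by positivity)
                    gcongr
                _ ≤ _ := by
                    have f3 := mul_le_mul_of_nonneg_left f2 m0
                    have f4 := mul_nonneg m0 w0
                    have f5 : 0 ≤ sizeFn Q u p ^ 3 := by positivity
                    linarith only [f3, f4, f5, w0]
          _ ≤ _ := by
              rw [normL2_smul hh, abs_of_nonneg (by positivity)]
              gcongr
              have := (normL2_add_le hh (sizeFn Q u) (sizeFn Q u ^ 3)).trans (add_le_add n1 n2)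
              linarith [normL2_add_le hh (sizeFn Q u) (sizeFn Q u + sizeFn Q u ^ 3)]
      exact mul_le_mul e3 (normL2_dCtr_dCtr_le_normH2 hh l k v) (normL2_nonneg _) (by positivity)
    rw [e, innerH_sum_left]
    calc _ ≤ ∑ _k : Fin d, ∑ _l : Fin d, (m + 1) * (2 * A1 + A3) * r := by
          refine (Finset.abs_sum_le_sum_abs _ _).trans (Finset.sum_le_sum fun k _ => ?_)
          rw [innerH_sum_left]
          exact (Finset.abs_sum_le_sum_abs _ _).trans (Finset.sum_le_sum fun l _ => e2 k l)
      _ = _ := by simp; ring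
  rw [split]
  refine (abs_add_le _ _).trans ?_
  rw [abs_mul, ← hD, add_mul]
  refine add_le_add b1 ?_
  calc D * _ ≤ D * (d ^ 2 * ((m + 1) * (2 * A1 + A3)) * r) := by gcongr
    _ = _ := by ring

end VariationBounds

/-! ### Boundedness of the numerical solution -/

section Boundedness

variable {d J : ℕ} [NeZero J] {h : ℝ} {P : Params}

theorem l2Sq_sub_le (hh : 0 ≤ h) (U V : GridFn d J) :
    l2Sq h (U - V) ≤ 2 * l2Sq h U + 2 * l2Sq h V := by
  have := l2Sq_nonneg hh (U + V)
  simp only [l2Sq, innerH_sub_left, innerH_sub_right, innerH_add_left, innerH_add_right,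
    innerH_comm V U] at this ⊢
  linarith

theorem linEnergy_sub_le (hP : P.Admissible d) (hh : 0 ≤ h) (Q Q' : GridTensor d J)
    (u u' : GridFn d J) :
    linEnergy P h (Q' - Q) (u' - u) ≤ 2 * linEnergy P h Q' u' + 2 * linEnergy P h Q u := by
  have hK := hP.K_pos
  have hB0 := hP.B0_pos
  have h1 : ∑ i, ∑ j, ∑ k, l2Sq h (dFwd h k (entry (Q' - Q) i j))
      ≤ 2 * ∑ i, ∑ j, ∑ k, l2Sq h (dFwd h k (entry Q' i j))
        + 2 * ∑ i, ∑ j, ∑ k, l2Sq h (dFwd h k (entry Q i j)) := by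
    simp only [Finset.mul_sum, ← Finset.sum_add_distrib]
    refine Finset.sum_le_sum fun i _ => Finset.sum_le_sum fun j _ => Finset.sum_le_sum fun k _ => ?_
    have e : dFwd h k (entry (Q' - Q) i j) = dFwd h k (entry Q' i j) - dFwd h k (entry Q i j) :=
      map_sub (dFwd h k) (entry Q' i j) (entry Q i j)
    rw [e]
    exact l2Sq_sub_le hh _ _
  have h2 : l2Sq h (lapH h (u' - u)) ≤ 2 * l2Sq h (lapH h u') + 2 * l2Sq h (lapH h u) := by
    rw [map_sub]; exact l2Sq_sub_le hh _ _
  have h3 := mul_le_mul_of_nonneg_left h1 (by positivity : 0 ≤ P.K / 2)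
  have h4 := mul_le_mul_of_nonneg_left h2 hB0.le
  simp only [linEnergy]
  linarith only [h3, h4]

theorem linEnergy_le (hP : P.Admissible d) (hh : 0 ≤ h) (Q : GridTensor d J) (u : GridFn d J) :
    linEnergy P h Q u ≤ (P.K + P.B0) * (normH1T h Q + normH2 h u) ^ 2 := by
  have hK := hP.K_pos
  have hB0 := hP.B0_pos
  have a0 : 0 ≤ normH1T h Q := Real.sqrt_nonneg _
  have b0 := normH2_nonneg (h := h) u
  have h1 : ∑ i, ∑ j, ∑ k, l2Sq h (dFwd h k (entry Q i j)) ≤ (normH1T h Q + normH2 h u) ^ 2 := by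
    have := normH1T_sq hh Q
    have h0 : 0 ≤ ∑ i, ∑ j, l2Sq h (entry Q i j) :=
      Finset.sum_nonneg fun _ _ => Finset.sum_nonneg fun _ _ => l2Sq_nonneg hh _
    nlinarith
  have h2 : l2Sq h (lapH h u) ≤ (normH1T h Q + normH2 h u) ^ 2 := by
    rw [← normL2_sq hh]
    exact pow_le_pow_left₀ (normL2_nonneg _)
      ((normL2_lapH_le_normH2 hh u).trans (le_add_of_nonneg_left a0)) 2
  have h3 := mul_le_mul_of_nonneg_left h1 (by positivity : 0 ≤ P.K / 2)
  have h4 := mul_le_mul_of_nonneg_left h2 hB0.le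
  have h5 : 0 ≤ P.K / 2 * (normH1T h Q + normH2 h u) ^ 2 := by positivity
  simp only [linEnergy]
  linarith only [h3, h4, h5]

theorem linEnergy_nonneg (hP : P.Admissible d) (hh : 0 ≤ h) (Q : GridTensor d J)
    (u : GridFn d J) : 0 ≤ linEnergy P h Q u := by
  have hK := hP.K_pos
  have hB0 := hP.B0_pos
  exact add_nonneg (mul_nonneg (by positivity) (Finset.sum_nonneg fun _ _ =>
    Finset.sum_nonneg fun _ _ => Finset.sum_nonneg fun _ _ => l2Sq_nonneg hh _))
    (mul_nonneg hB0.le (l2Sq_nonneg hh _))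

/-- The linear energy sees only the top order parts. The `l²` parts are kept separate because, for
increments, they are controlled by the dissipation instead. -/
theorem sq_norms_le (hP : P.Admissible d) (hh : 0 ≤ h) (Q : GridTensor d J) (u : GridFn d J) :
    (normH1T h Q + normH2 h u) ^ 2 ≤ 4 * (∑ i, ∑ j, l2Sq h (entry Q i j) + l2Sq h u)
      + (4 / P.K + 4 / P.B0) * linEnergy P h Q u := by
  have hK := hP.K_pos
  have hB0 := hP.B0_pos
  have h1 := normH1T_sq hh Q
  have h2 := normH2_sq_le hh u
  have q0 : 0 ≤ ∑ i, ∑ j, l2Sq h (entry Q i j) :=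
    Finset.sum_nonneg fun _ _ => Finset.sum_nonneg fun _ _ => l2Sq_nonneg hh _
  have q1 : 0 ≤ ∑ i, ∑ j, ∑ k, l2Sq h (dFwd h k (entry Q i j)) :=
    Finset.sum_nonneg fun _ _ => Finset.sum_nonneg fun _ _ =>
      Finset.sum_nonneg fun _ _ => l2Sq_nonneg hh _
  have v2 := l2Sq_nonneg hh (lapH h u)
  rw [linEnergy]
  generalize ∑ i, ∑ j, ∑ k, l2Sq h (dFwd h k (entry Q i j)) = x1 at *
  generalize ∑ i, ∑ j, l2Sq h (entry Q i j) = x0 at *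
  generalize l2Sq h (lapH h u) = y2 at *
  generalize normH1T h Q = a at *
  generalize normH2 h u = b at *
  have e : (4 / P.K + 4 / P.B0) * (P.K / 2 * x1 + P.B0 * y2)
      = 2 * x1 + 4 * y2 + (4 / P.K * (P.B0 * y2) + 4 / P.B0 * (P.K / 2 * x1)) := by
    field_simp; ring
  have e0 : 0 ≤ 4 / P.K * (P.B0 * y2) + 4 / P.B0 * (P.K / 2 * x1) := by positivity
  rw [e]
  linarith only [h1, h2, q0, e0, sq_nonneg (a - b)]

end Boundedness

variable {d : ℕ} {L : ℝ}

/-- A quadratic quantity bounded by an affine function of its root: where `N ≥ 1` the affine bound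
is at most a multiple of `N`, and one factor `N` cancels. -/
theorem le_of_sq_le_of_le {N R D CE CP T W : ℝ} (hR : 0 ≤ R) (hD : 0 ≤ D) (hCE : 0 ≤ CE)
    (hCP : 0 ≤ CP) (hT : 0 ≤ T) (hW : 0 ≤ W) (h1 : D / 2 + R ≤ 2 * CE + CP * N)
    (h2 : N ^ 2 ≤ 4 * (T * R) + W * D) : N ≤ 1 + (4 * T + 2 * W) * (2 * CE + CP) := by
  by_contra! hcon
  have h3 : 0 ≤ (4 * T + 2 * W) * (2 * CE + CP) := by positivity
  have hN : 1 ≤ N := by linarith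
  have h4 : 2 * CE + CP * N ≤ (2 * CE + CP) * N := by nlinarith
  have h5 : T * R ≤ T * ((2 * CE + CP) * N) := by gcongr; linarith
  have h6 : W * D ≤ W * (2 * ((2 * CE + CP) * N)) := by gcongr; linarith
  have h7 : N * N ≤ ((4 * T + 2 * W) * (2 * CE + CP)) * N := by linarith
  have := le_of_mul_le_mul_right h7 (by linarith)
  linarith

/-- One step of the scheme, with a step size that is only bounded above, maps bounded states to
bounded states. -/
theorem exists_step_bound (hd : d = 2 ∨ d = 3) {P : Params} (hP : P.Admissible d) (hL : 0 < L)
    (T : ℝ) (hT : 0 < T) (ρ : ℝ) (hρ : 0 ≤ ρ) :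
    ∃ ρ' : ℝ, 0 ≤ ρ' ∧ ∀ (J : ℕ) [NeZero J] (τ η0 : ℝ), 0 < τ → τ ≤ T → η0 ∈ Icc (0 : ℝ) 1 →
      ∀ (Q : ℕ → GridTensor d J) (u : ℕ → GridFn d J) (s sTil ξ : ℕ → ℝ),
      IsSchemeSolution P (mesh L J) τ η0 Q u s sTil ξ → ∀ n,
      normH1T (mesh L J) (Q n) + normH2 (mesh L J) (u n) ≤ ρ → s n ≤ ρ →
      normH1T (mesh L J) (Q (n + 1)) + normH2 (mesh L J) (u (n + 1)) ≤ ρ' ∧ s (n + 1) ≤ ρ' := by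
  have hK := hP.K_pos
  have hB0 := hP.B0_pos
  obtain ⟨CH, CH0, HH⟩ := exists_normL2_hH_le hd P hL ρ hρ
  obtain ⟨Cm, Cm0, Hm⟩ := exists_abs_innerH_muH_le hd P hL ρ hρ
  set CE := (P.K + P.B0) * ρ ^ 2 with hCE
  have CE0 : 0 ≤ CE := by positivity
  obtain ⟨Cg, Cg0, Hg⟩ := exists_multH_mul_pow_le P hP L hL (CE + ρ)
  set CP := Cg * (d ^ 2 * CH + Cm) with hCP
  have CP0 : 0 ≤ CP := by positivity
  set C5 := 4 * T + 2 * (4 / P.K + 4 / P.B0) with hC5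
  have C50 : 0 ≤ C5 := by positivity
  set X := 1 + C5 * (2 * CE + CP) with hX
  have X0 : 0 ≤ X := by positivity
  refine ⟨2 * (ρ + X) + CP * X + T * (2 * CE + CP * X), by positivity,
    fun J _ τ η0 hτ hτT hη Q u s sTil ξ hS n hN hs => ?_⟩
  have hh : 0 < mesh L J := mesh_pos hL
  set h := mesh L J with hdef
  have id1 := hS.energy_identity hh hτ n
  have rel := hS.relax_le n
  have hsT := hS.step_sTil n
  have lE : linEnergy P h (Q n) (u n) ≤ CE :=
    (linEnergy_le hP hh.le _ _).trans (by
      rw [hCE]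
      have : 0 ≤ normH1T h (Q n) := Real.sqrt_nonneg _
      have := normH2_nonneg (h := h) (u n)
      gcongr)
  have gpos : 0 < multH P h (Q n) (u n) (s n) := by rw [multH]; positivity
  have gle : multH P h (Q n) (u n) (s n) ≤ Cg := by
    refine le_trans ?_ (Hg J (Q n) (u n) (s n) (hS.tensor n) (add_le_add lE hs))
    have : 0 ≤ normH1T h (Q n) := Real.sqrt_nonneg _
    have := normH2_nonneg (h := h) (u n)
    exact le_mul_of_one_le_right gpos.le (one_le_pow₀ (by linarith))
  generalize multH P h (Q n) (u n) (s n) = g at *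
  obtain ⟨dQ, hdQ⟩ : ∃ dQ, dQ = Q (n + 1) - Q n := ⟨_, rfl⟩
  obtain ⟨du, hdu⟩ : ∃ du, du = u (n + 1) - u n := ⟨_, rfl⟩
  have hsub := linEnergy_sub_le hP hh.le (Q n) (Q (n + 1)) (u n) (u (n + 1))
  rw [← hdQ, ← hdu] at id1 rel hsT hsub
  have hR := le_dissRate (P := P) hh hτ g dQ du
  have R0 := dissRate_nonneg (P := P) hh hτ g dQ du
  generalize dissRate P h τ g dQ du = R at *
  have hsq := sq_norms_le hP hh.le dQ du
  have q0 : 0 ≤ ∑ i, ∑ j, l2Sq h (entry dQ i j) :=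
    Finset.sum_nonneg fun _ _ => Finset.sum_nonneg fun _ _ => l2Sq_nonneg hh.le _
  have u0 := l2Sq_nonneg hh.le du
  have a0 : 0 ≤ normH1T h dQ := Real.sqrt_nonneg _
  have b0 := normH2_nonneg (h := h) du
  have hPle : |sTil (n + 1) - s n| ≤ CP * (normH1T h dQ + normH2 h du) := by
    have e1 : |innerHT h (hH P h (Q n) (u n)) dQ| ≤ d ^ 2 * CH * normH1T h dQ := by
      calc _ ≤ ∑ _i : Fin d, ∑ _j : Fin d, CH * normH1T h dQ := by
            refine (Finset.abs_sum_le_sum_abs _ _).trans (Finset.sum_le_sum fun i _ =>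
              (Finset.abs_sum_le_sum_abs _ _).trans (Finset.sum_le_sum fun j _ => ?_))
            refine (abs_innerH_le hh.le _ _).trans ?_
            exact mul_le_mul (HH J _ _ i j hN)
              ((normL2_le_normH1 hh.le _).trans (normH1_entry_le hh.le dQ i j))
              (normL2_nonneg _) CH0
        _ = _ := by simp; ring
    have e2 := Hm J (Q n) (u n) du hN
    have e3 : sTil (n + 1) - s n = g * (innerHT h (hH P h (Q n) (u n)) dQ
        + innerH h (muH P h (Q n) (u n)) du) := by rw [hsT]; ring
    rw [e3, abs_mul, abs_of_pos gpos, hCP, mul_assoc]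
    refine mul_le_mul gle ((abs_add_le _ _).trans ((add_le_add e1 e2).trans ?_)) (abs_nonneg _) Cg0
    have : 0 ≤ d ^ 2 * CH * normH2 h du := by positivity
    have : 0 ≤ Cm * normH1T h dQ := by positivity
    linarith
  have tri : normH1T h (Q (n + 1)) + normH2 h (u (n + 1))
      ≤ 2 * (normH1T h (Q n) + normH2 h (u n)) + 2 * (normH1T h dQ + normH2 h du) := by
    have e1 := normH1T_add_le hh.le (Q n) dQ
    have e2 := normH2_add_le hh.le (u n) du
    rw [show Q n + dQ = Q (n + 1) by rw [hdQ]; abel] at e1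
    rw [show u n + du = u (n + 1) by rw [hdu]; abel] at e2
    linarith
  have pos : 0 ≤ g * (P.κ1 / 2 * ∑ i, ∑ j, l2Sq h (entry dQ i j) + P.κ2 / 2 * l2Sq h du) := by
    have := hP.κ1_pos
    have := hP.κ2_pos
    positivity
  have pa := abs_le.1 hPle
  generalize normH1T h dQ + normH2 h du = N1 at *
  have N10 : 0 ≤ CP * N1 := (abs_nonneg _).trans hPle
  have Ed0 := linEnergy_nonneg hP hh.le dQ du
  generalize linEnergy P h dQ du = Ed at *
  -- The energy of the increment is at most twice the sum of the old and new energies. Inserting the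
  -- energy identity bounds it together with the dissipation by old data and a pairing linear in the
  -- increment norm `N1`.
  have s1 : Ed / 2 + R ≤ 2 * CE + CP * N1 := by linarith only [id1, pos, hsub, lE, pa.1]
  have s2 : τ * R ≤ T * R := by gcongr
  -- The hypothesis on `N1 ^ 2` combines `sq_norms_le` with `le_dissRate`; the factor `τ` of the
  -- latter is replaced by its upper bound `T`.
  have s3 : N1 ≤ X := le_of_sq_le_of_le R0 Ed0 CE0 CP0 hT.le (by positivity) s1
    (by linarith only [hsq, hR, s2])
  have s4 : CP * N1 ≤ CP * X := by gcongr
  have s5 : T * R ≤ T * (2 * CE + CP * X) := by gcongr; linarith only [s1, Ed0, s4]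
  have s6 : η0 * τ * R ≤ T * R := by
    calc η0 * τ * R ≤ 1 * T * R := by gcongr; exact hη.2
      _ = _ := by ring
  have s7 : 0 ≤ CP * X := by positivity
  have s8 : 0 ≤ T * (2 * CE + CP * X) := by positivity
  exact ⟨by linarith only [tri, hN, s3, s7, s8],
    by linarith only [rel, pa.2, s4, s5, s6, hs, X0, hρ]⟩

/-- A priori bound for the modified energy, on a finite time interval and without restriction of
the time step. -/
theorem exists_energy_bound (hd : d = 2 ∨ d = 3) {P : Params} (hP : P.Admissible d) (hL : 0 < L)
    (T : ℝ) (hT : 0 < T) (M : ℝ) :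
    ∃ F : ℝ, ∀ (J : ℕ) [NeZero J] (τ η0 : ℝ), 0 < τ → η0 ∈ Icc (0 : ℝ) 1 →
      ∀ (Q : ℕ → GridTensor d J) (u : ℕ → GridFn d J) (s sTil ξ : ℕ → ℝ),
      IsSchemeSolution P (mesh L J) τ η0 Q u s sTil ξ →
      normH1T (mesh L J) (Q 0) ≤ M → normH2 (mesh L J) (u 0) ≤ M → |s 0| ≤ M →
      ∀ n : ℕ, n * τ ≤ T → linEnergy P (mesh L J) (Q n) (u n) + s n ≤ F := by
  -- The bound `ρ` may grow with the number of steps `m`; it is used only for the fixed number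
  -- `⌊T⌋₊`.
  have steps : ∀ m : ℕ, ∃ ρ : ℝ, 0 ≤ ρ ∧ 2 * M ≤ ρ ∧ ∀ (J : ℕ) [NeZero J] (τ η0 : ℝ), 0 < τ →
      η0 ∈ Icc (0 : ℝ) 1 →
      ∀ (Q : ℕ → GridTensor d J) (u : ℕ → GridFn d J) (s sTil ξ : ℕ → ℝ),
      IsSchemeSolution P (mesh L J) τ η0 Q u s sTil ξ →
      normH1T (mesh L J) (Q 0) ≤ M → normH2 (mesh L J) (u 0) ≤ M → |s 0| ≤ M →
      ∀ n ≤ m, n * τ ≤ T →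
        normH1T (mesh L J) (Q n) + normH2 (mesh L J) (u n) ≤ ρ ∧ s n ≤ ρ := by
    intro m
    induction m with
    | zero =>
      refine ⟨2 * |M|, by positivity, by linarith [le_abs_self M],
        fun J _ τ η0 _ _ Q u s sTil ξ _ h1 h2 h3 n hn _ => ?_⟩
      obtain rfl : n = 0 := by omega
      have := le_abs_self M
      exact ⟨by linarith, by linarith [le_abs_self (s 0), abs_nonneg M]⟩
    | succ m ih =>
      obtain ⟨ρ, ρ0, hMρ, H⟩ := ih
      obtain ⟨ρ', ρ'0, H'⟩ := exists_step_bound hd hP hL T hT ρ ρ0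
      refine ⟨ρ + ρ', by positivity, by linarith,
        fun J _ τ η0 hτ hη Q u s sTil ξ hS h1 h2 h3 n hn hnT => ?_⟩
      rcases Nat.lt_or_ge m n with hmn | hmn
      · obtain rfl : n = m + 1 := by omega
        push_cast at hnT
        have hm : (0 : ℝ) ≤ m * τ := by positivity
        have := H J τ η0 hτ hη Q u s sTil ξ hS h1 h2 h3 m le_rfl (by linarith)
        have := H' J τ η0 hτ (by linarith) hη Q u s sTil ξ hS m this.1 this.2
        exact ⟨by linarith, by linarith⟩
      · have := H J τ η0 hτ hη Q u s sTil ξ hS h1 h2 h3 n hmn hnT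
        exact ⟨by linarith, by linarith⟩
  obtain ⟨ρ, ρ0, hMρ, H⟩ := steps ⌊T⌋₊
  have hK := hP.K_pos
  have hB0 := hP.B0_pos
  have start : ∀ (J : ℕ) [NeZero J] (Q : GridTensor d J) (u : GridFn d J) (s : ℝ),
      normH1T (mesh L J) Q + normH2 (mesh L J) u ≤ ρ → s ≤ ρ →
      linEnergy P (mesh L J) Q u + s ≤ (P.K + P.B0) * ρ ^ 2 + ρ := by
    intro J _ Q u s h1 h2
    refine add_le_add ((linEnergy_le hP (mesh_pos hL).le _ _).trans ?_) h2
    have : 0 ≤ normH1T (mesh L J) Q := Real.sqrt_nonneg _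
    have := normH2_nonneg (h := mesh L J) u
    gcongr
  refine ⟨(P.K + P.B0) * ρ ^ 2 + ρ, fun J _ τ η0 hτ hη Q u s sTil ξ hS h1 h2 h3 n hnT => ?_⟩
  -- Small steps: arbitrarily many, but the modified energy decreases from its initial value. Large
  -- steps: at most `⌊T⌋₊` of them, each with a controlled loss.
  rcases le_total τ 1 with hτ1 | hτ1
  · have anti : Antitone fun n => linEnergy P (mesh L J) (Q n) (u n) + s n :=
      antitone_nat_of_succ_le fun n => hS.energy_antitone hP (mesh_pos hL) hτ hτ1 hη n
    have h0 := H J τ η0 hτ hη Q u s sTil ξ hS h1 h2 h3 0 (Nat.zero_le _) (by simpa using hT.le)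
    exact (anti (Nat.zero_le n)).trans (start J _ _ _ h0.1 h0.2)
  · have hn : n ≤ ⌊T⌋₊ := Nat.le_floor (by nlinarith [(Nat.cast_nonneg n : (0 : ℝ) ≤ n)])
    have h0 := H J τ η0 hτ hη Q u s sTil ξ hS h1 h2 h3 n hn hnT
    exact start J _ _ _ h0.1 h0.2

/-! ### Bounds for the exact solution and consistency of the discretization -/

section Consistency

open MeasureTheory

variable {d : ℕ} {ι : Type*} {L : ℝ} {n : ℕ}

theorem IsSmoothPeriodic.smoothFam {T : ℝ} {f : ℝ → (Fin d → ℝ) → ℝ}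
    (hf : IsSmoothPeriodic L T f) : SmoothFam L 4 fun t : Icc 0 T => f t where
  periodic t := hf.periodic t t.2
  contDiff t := hf.contDiff t t.2
  bounded := hf.bounded.imp fun _ h t => h t t.2

/-- A matrix valued family all of whose entries are smooth families. -/
def SmoothMatFam (L : ℝ) (n : ℕ) (F : ι → (Fin d → ℝ) → Matrix (Fin d) (Fin d) ℝ) : Prop :=
  ∀ i j, SmoothFam L n fun t x => F t x i j

namespace SmoothMatFam

variable {F G : ι → (Fin d → ℝ) → Matrix (Fin d) (Fin d) ℝ} {f : ι → (Fin d → ℝ) → ℝ}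

theorem of_le (hF : SmoothMatFam L n F) {m : ℕ} (hm : m ≤ n) : SmoothMatFam L m F :=
  fun i j => (hF i j).of_le hm

theorem frob (hF : SmoothMatFam L n F) (hG : SmoothMatFam L n G) :
    SmoothFam L n fun t x => frob (F t x) (G t x) :=
  SmoothFam.sum _ fun i _ => SmoothFam.sum _ fun j _ => (hF i j).mul (hG i j)

theorem smul (hf : SmoothFam L n f) (hF : SmoothMatFam L n F) :
    SmoothMatFam L n fun t x => f t x • F t x :=
  fun i j => hf.mul (hF i j)

theorem mul (hF : SmoothMatFam L n F) (hG : SmoothMatFam L n G) :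
    SmoothMatFam L n fun t x => F t x * G t x := fun i j => by
  simp only [Matrix.mul_apply]
  exact SmoothFam.sum _ fun k _ => (hF i k).mul (hG k j)

theorem trace (hF : SmoothMatFam L n F) : SmoothFam L n fun t x => (F t x).trace :=
  SmoothFam.sum _ fun i _ => hF i i

theorem mTensor (P : Params) (hF : SmoothMatFam L n F) :
    SmoothMatFam L n fun t x => mTensor P (F t x) :=
  fun i j => ((hF i j).const_mul (1 / sPlus P d)).add
    (SmoothFam.const (1 / (d : ℝ) * (1 : Matrix (Fin d) (Fin d) ℝ) i j))

theorem exists_absSum_le (hF : SmoothMatFam L n F) :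
    ∃ R : ℝ, 0 ≤ R ∧ ∀ t x, absSum (F t x) ≤ R := by
  choose R h0 hR using fun i j => (hF i j).exists_abs_le
  exact ⟨∑ i, ∑ j, R i j, Finset.sum_nonneg fun i _ => Finset.sum_nonneg fun j _ => h0 i j,
    fun t x => Finset.sum_le_sum fun i _ => Finset.sum_le_sum fun j _ => hR i j t x⟩

theorem energyDensity (P : Params) {H : ι → (Fin d → ℝ) → Matrix (Fin d) (Fin d) ℝ}
    (hF : SmoothMatFam L n F) (hf : SmoothFam L n f) (hH : SmoothMatFam L n H) :
    SmoothFam L n fun t x => energyDensity P (F t x) (f t x) (H t x) := by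
  have hM := smul hf (hF.mTensor P)
  have hb : SmoothFam L n fun t x => fbn P (F t x) := by
    refine (((hF.mul hF).trace.const_mul _).sub ?_).add (((hF.mul hF).trace.pow 2).const_mul _)
    split_ifs
    · exact ((hF.mul hF).mul hF).trace.const_mul _
    · exact SmoothFam.const 0
  have hs : SmoothFam L n fun t x => fs P (f t x) :=
    (((hf.pow 2).const_mul _).add ((hf.pow 3).const_mul _)).add ((hf.pow 4).const_mul _)
  exact ((((hH.frob hM).const_mul _).add ((hM.frob hM).const_mul _)).add hb).add hs

end SmoothMatFam

theorem SmoothFam.hessC {f : ι → (Fin d → ℝ) → ℝ} (hf : SmoothFam L (n + 2) f) :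
    SmoothMatFam L n fun t => hessC (f t) :=
  fun k l => (SmoothFam.pd (n := n + 1) l hf).pd k

/-- Bounds for a pair of smooth fields and for the consistency errors on all grids. -/
structure FieldBounds (P : Params) (L R : ℝ) (Q : (Fin d → ℝ) → Matrix (Fin d) (Fin d) ℝ)
    (u : (Fin d → ℝ) → ℝ) : Prop where
  absSum_Q_le : ∀ x, absSum (Q x) ≤ R
  abs_u_le : ∀ x, |u x| ≤ R
  absSum_hess_le : ∀ x, absSum (hessC u x) ≤ R
  abs_divDiv_le : ∀ x, |divDivC P Q u x| ≤ R
  normH1T_le : ∀ (J : ℕ) [NeZero J], normH1T (mesh L J) (gridRestrict L Q : GridTensor d J) ≤ R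
  normH2_u_le : ∀ (J : ℕ) [NeZero J], normH2 (mesh L J) (gridRestrict L u : GridFn d J) ≤ R
  normH2_mTensor_le : ∀ (J : ℕ) [NeZero J] (k l : Fin d),
    normH2 (mesh L J) (gridRestrict L fun x => mTensor P (Q x) k l : GridFn d J) ≤ R
  hess_consistent : ∀ (J : ℕ) [NeZero J] (p : Grid d J),
    absSum (hessH (mesh L J) (gridRestrict L u) p - hessC u (gridPt L p)) ≤ R * mesh L J ^ 2
  divDiv_consistent : ∀ (J : ℕ) [NeZero J] (p : Grid d J),
    |divDivH P (mesh L J) (gridRestrict L Q) (gridRestrict L u) p - divDivC P Q u (gridPt L p)|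
      ≤ R * mesh L J ^ 2
  energy_consistent : ∀ (J : ℕ) [NeZero J],
    |innerH (mesh L J) (fun p : Grid d J => energyDensity P (Q (gridPt L p)) (u (gridPt L p))
      (hessC u (gridPt L p))) 1 - energyC P L Q u| ≤ R * mesh L J ^ 2

theorem exists_dCtr_dCtr_consistent (hL : 0 < L) {F : Fin d → Fin d → ι → (Fin d → ℝ) → ℝ}
    (hF : ∀ k l, SmoothFam L 4 (F k l)) : ∃ C : ℝ, 0 ≤ C ∧ ∀ (J : ℕ) [NeZero J] (t : ι)
      (p : Grid d J), ∑ k, ∑ l, |dCtr (mesh L J) k (dCtr (mesh L J) l (gridRestrict L (F k l t))) p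
        - pd k (pd l (F k l t)) (gridPt L p)| ≤ C * mesh L J ^ 2 := by
  choose R h0 hR using fun k l => (hF k l).exists_bound
  refine ⟨∑ k, ∑ l, 16 * R k l, Finset.sum_nonneg fun k _ => Finset.sum_nonneg fun l _ =>
    mul_nonneg (by norm_num) (h0 k l), fun J _ t p => ?_⟩
  simp only [Finset.sum_mul]
  exact Finset.sum_le_sum fun k _ => Finset.sum_le_sum fun l _ =>
    abs_dCtr_dCtr_sub_le hL ((hF k l).contDiff t) ((hF k l).periodic t)
      (hR k l t 4 le_rfl) k l p

/-- One constant for all times and all meshes, the sum of the constants of the single bounds. Fourth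
derivatives enter through the consistency of the two difference stencils. The energy density
contains the Hessian and retains two derivatives, which is what the quadrature estimate needs. -/
theorem exists_fieldBounds (P : Params) (hL : 0 < L)
    {Q : ι → (Fin d → ℝ) → Matrix (Fin d) (Fin d) ℝ} {u : ι → (Fin d → ℝ) → ℝ}
    (hQ : SmoothMatFam L 4 Q) (hu : SmoothFam L 4 u) :
    ∃ R : ℝ, 0 ≤ R ∧ ∀ t, FieldBounds P L R (Q t) (u t) := by
  have hhess := SmoothFam.hessC (n := 2) hu
  have hMu : ∀ k l, SmoothFam L 4 fun t x => mTensor P (Q t x) k l * u t x :=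
    fun k l => (hQ.mTensor P k l).mul hu
  have hdd : SmoothFam L 2 fun t => divDivC P (Q t) (u t) :=
    SmoothFam.sum _ fun k _ => SmoothFam.sum _ fun l _ =>
      (SmoothFam.pd (n := 3) l (hMu k l)).pd k
  have hen := SmoothMatFam.energyDensity P (hQ.of_le (by norm_num : 2 ≤ 4))
    (hu.of_le (by norm_num : 2 ≤ 4)) hhess
  obtain ⟨R1, n1, H1⟩ := hQ.exists_absSum_le
  obtain ⟨R2, n2, H2⟩ := hu.exists_abs_le
  obtain ⟨R3, n3, H3⟩ := hhess.exists_absSum_le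
  obtain ⟨R4, n4, H4⟩ := hdd.exists_abs_le
  choose R5 n5 H5 using fun i j => SmoothFam.exists_normH2_le hL ((hQ i j).of_le (by norm_num : 2 ≤ 4))
  obtain ⟨R6, n6, H6⟩ := SmoothFam.exists_normH2_le hL (hu.of_le (by norm_num : 2 ≤ 4))
  choose R7 n7 H7 using fun i j =>
    SmoothFam.exists_normH2_le hL ((hQ.mTensor P i j).of_le (by norm_num : 2 ≤ 4))
  obtain ⟨R8, n8, H8⟩ := exists_dCtr_dCtr_consistent hL (fun _ _ => hu)
  obtain ⟨R9, n9, H9⟩ := exists_dCtr_dCtr_consistent hL hMu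
  obtain ⟨R10, n10, H10⟩ := hen.exists_bound
  have s5 : 0 ≤ √(∑ i, ∑ j, R5 i j ^ 2) := Real.sqrt_nonneg _
  have s7 : 0 ≤ ∑ i, ∑ j, R7 i j := Finset.sum_nonneg fun i _ => Finset.sum_nonneg fun j _ => n7 i j
  have s10 : 0 ≤ L ^ d * R10 := by positivity
  obtain ⟨R, hR⟩ : ∃ R, R = R1 + R2 + R3 + R4 + √(∑ i, ∑ j, R5 i j ^ 2) + R6
    + ∑ i, ∑ j, R7 i j + R8 + R9 + L ^ d * R10 := ⟨_, rfl⟩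
  have mono : ∀ {r c x : ℝ}, x ≤ r * c ^ 2 → r ≤ R → x ≤ R * c ^ 2 := fun h1 h2 =>
    h1.trans (by gcongr)
  refine ⟨R, by rw [hR]; positivity, fun t => ?_⟩
  constructor
  · exact fun x => (H1 t x).trans (by linarith)
  · exact fun x => (H2 t x).trans (by linarith)
  · exact fun x => (H3 t x).trans (by linarith)
  · exact fun x => (H4 t x).trans (by linarith)
  · intro J _
    have hh := (mesh_pos (J := J) hL).le
    refine le_trans (Real.sqrt_le_sqrt (Finset.sum_le_sum fun i _ => Finset.sum_le_sum fun j _ => ?_))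
      (by linarith : √(∑ i, ∑ j, R5 i j ^ 2) ≤ R)
    have h1 := (normH1_le_normH2 hh _).trans (H5 i j J t)
    have h2 := pow_le_pow_left₀ (normH1_nonneg _) h1 2
    rwa [normH1, Real.sq_sqrt (h1Sq_nonneg hh _)] at h2
  · exact fun J _ => (H6 J t).trans (by linarith)
  · intro J _ k l
    refine (H7 k l J t).trans (le_trans ?_ (by linarith : ∑ i, ∑ j, R7 i j ≤ R))
    exact (Finset.single_le_sum (fun j _ => n7 k j) (Finset.mem_univ l)).trans
      (Finset.single_le_sum (f := fun i => ∑ j, R7 i j)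
        (fun i _ => Finset.sum_nonneg fun j _ => n7 i j) (Finset.mem_univ k))
  · exact fun J _ p => mono (H8 J t p) (by linarith)
  · intro J _ p
    refine mono (le_trans ?_ (H9 J t p)) (by linarith)
    simp only [divDivH, divDivC, ← Finset.sum_sub_distrib]
    exact (Finset.abs_sum_le_sum_abs _ _).trans (Finset.sum_le_sum fun k _ =>
      Finset.abs_sum_le_sum_abs _ _)
  · intro J _
    refine mono (r := L ^ d * R10) ?_ (by linarith)
    have := abs_riemann_sum_sub_integral_le (J := J) hL (hen.contDiff t) (hen.periodic t)
      (H10 t 2 le_rfl)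
    simpa only [innerH, Pi.one_apply, mul_one, energyC] using this

end Consistency

/-! ### Error estimates for the nonlinear terms -/

section ErrorEstimates

variable {d J : ℕ} {L : ℝ} {Q : (Fin d → ℝ) → Matrix (Fin d) (Fin d) ℝ}
  {u : (Fin d → ℝ) → ℝ}

/-- The difference of the discrete Hessian of `u + e` and the exact Hessian of `u`. -/
noncomputable def hessErr (L : ℝ) (u : (Fin d → ℝ) → ℝ) (e : GridFn d J) : GridTensor d J :=
  fun p => hessH (mesh L J) (gridRestrict L u + e) p - hessC u (gridPt L p)

theorem gridTensor_eq_add (Qh : GridTensor d J) (p : Grid d J) :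
    Qh p = Q (gridPt L p) + (Qh - gridRestrict L Q : GridTensor d J) p := by
  simp [gridRestrict]

theorem gridFn_eq_add (uh : GridFn d J) (p : Grid d J) :
    uh p = u (gridPt L p) + (uh - gridRestrict L u : GridFn d J) p := by
  simp [gridRestrict]

theorem hessH_eq_add (uh : GridFn d J) (p : Grid d J) :
    hessH (mesh L J) uh p = hessC u (gridPt L p) + hessErr L u (uh - gridRestrict L u) p := by
  simp [hessErr]

variable [NeZero J]

/-- Size of the errors of `Q` (in `H¹`) and `u` (in `H²`), plus the consistency error. -/
noncomputable def errSize (L : ℝ) (E : GridTensor d J) (e : GridFn d J) : ℝ :=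
  normH1T (mesh L J) E + normH2 (mesh L J) e + mesh L J ^ 2

theorem errSize_nonneg (E : GridTensor d J) (e : GridFn d J) : 0 ≤ errSize L E e :=
  add_nonneg (add_nonneg (Real.sqrt_nonneg _) (Real.sqrt_nonneg _)) (sq_nonneg _)

theorem normH1T_add_normH2_le_errSize (E : GridTensor d J) (e : GridFn d J) :
    normH1T (mesh L J) E + normH2 (mesh L J) e ≤ errSize L E e :=
  le_add_of_nonneg_right (sq_nonneg _)

theorem sq_mesh_le_errSize (E : GridTensor d J) (e : GridFn d J) :
    mesh L J ^ 2 ≤ errSize L E e :=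
  le_add_of_nonneg_left (add_nonneg (Real.sqrt_nonneg _) (Real.sqrt_nonneg _))

theorem normH2_le_errSize (E : GridTensor d J) (e : GridFn d J) :
    normH2 (mesh L J) e ≤ errSize L E e :=
  (le_add_of_nonneg_left (Real.sqrt_nonneg _)).trans (normH1T_add_normH2_le_errSize E e)

theorem normH1T_le_errSize (E : GridTensor d J) (e : GridFn d J) :
    normH1T (mesh L J) E ≤ errSize L E e :=
  (le_add_of_nonneg_right (Real.sqrt_nonneg _)).trans (normH1T_add_normH2_le_errSize E e)

variable {P : Params} {R : ℝ}

theorem normL2_hessErr_le (hL : 0 < L) (hR : 0 ≤ R) (hB : FieldBounds P L R Q u)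
    (E : GridTensor d J) (e : GridFn d J) :
    normL2 (mesh L J) (fun p => absSum (hessErr L u e p))
      ≤ (d ^ 2 + R * √(L ^ d)) * errSize L E e := by
  have hh := (mesh_pos (J := J) hL).le
  have hJ : (J : ℝ) * mesh L J = L := card_mul_mesh
  have e1 : normL2 (mesh L J) (fun p => absSum (hessH (mesh L J) e p))
      ≤ d ^ 2 * normH2 (mesh L J) e := normL2_absSum_le hh fun k l => normL2_hessH_le hL e k l
  have e2 := normL2_le_of_abs_le (U := fun _ : Grid d J => R * mesh L J ^ 2)
    (r := R * mesh L J ^ 2) hh hJ fun p => (abs_of_nonneg (by positivity)).le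
  have e3 : normL2 (mesh L J) (fun p => absSum (hessErr L u e p))
      ≤ normL2 (mesh L J) ((fun p => absSum (hessH (mesh L J) e p))
        + fun _ : Grid d J => R * mesh L J ^ 2) := by
    refine normL2_mono hh fun p => ?_
    rw [abs_of_nonneg (absSum_nonneg _)]
    have : hessErr L u e p = hessH (mesh L J) e p
        + (hessH (mesh L J) (gridRestrict L u) p - hessC u (gridPt L p)) := by
      ext k l
      simp only [hessErr, hessH, map_add, Matrix.sub_apply, Matrix.add_apply, Matrix.of_apply,
        Pi.add_apply]
      ring
    rw [this]
    exact (absSum_add_le _ _).trans (by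
      change _ ≤ absSum (hessH (mesh L J) e p) + R * mesh L J ^ 2
      gcongr; exact hB.hess_consistent J p)
  have e4 : (d : ℝ) ^ 2 * normH2 (mesh L J) e ≤ d ^ 2 * errSize L E e := by
    gcongr; exact normH2_le_errSize E e
  have e5 : R * mesh L J ^ 2 * √(L ^ d) ≤ R * errSize L E e * √(L ^ d) := by
    gcongr; exact sq_mesh_le_errSize E e
  linarith [normL2_add_le hh (fun p => absSum (hessH (mesh L J) e p))
    fun _ : Grid d J => R * mesh L J ^ 2]

end ErrorEstimates

variable {d : ℕ} {L : ℝ}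

/-- The energy error splits into the nonlinear increment at the nodes and the quadrature error. In
the first, each summand is a product of two functions bounded in `l²`, the highest ones being `W³ ·
W` and `W³` times the Hessian error. -/
theorem exists_abs_energy_sub_le (hd : d = 2 ∨ d = 3) (P : Params) (hL : 0 < L) (R : ℝ)
    (hR : 0 ≤ R) : ∃ C : ℝ, 0 ≤ C ∧ ∀ (Q : (Fin d → ℝ) → Matrix (Fin d) (Fin d) ℝ)
      (u : (Fin d → ℝ) → ℝ), FieldBounds P L R Q u → ∀ (J : ℕ) [NeZero J] (Qh : GridTensor d J)
      (uh : GridFn d J), |energyH P (mesh L J) Qh uh - energyC P L Q u|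
        ≤ C * (errSize L (Qh - gridRestrict L Q) (uh - gridRestrict L u)
          * (1 + errSize L (Qh - gridRestrict L Q) (uh - gridRestrict L u)) ^ 3) := by
  obtain ⟨C, C0, H⟩ := abs_energyDensity_sub_le P d R hR
  obtain ⟨S, hS⟩ := exists_isSobolevConst d hd L hL
  have S0 := hS.nonneg
  obtain ⟨a1, ha1⟩ : ∃ a : ℝ, a = (d : ℝ) ^ 2 + 1 := ⟨_, rfl⟩
  obtain ⟨a3, ha3⟩ : ∃ a : ℝ, a = 4 * (((d : ℝ) ^ 2) ^ 3 * S + S) := ⟨_, rfl⟩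
  obtain ⟨aG, haG⟩ : ∃ a : ℝ, a = (d : ℝ) ^ 2 + R * √(L ^ d) := ⟨_, rfl⟩
  obtain ⟨v, hv⟩ : ∃ a : ℝ, a = √(L ^ d) := ⟨_, rfl⟩
  have a10 : 0 ≤ a1 := by rw [ha1]; positivity
  have a30 : 0 ≤ a3 := by rw [ha3]; positivity
  have aG0 : 0 ≤ aG := by rw [haG]; positivity
  have v0 : 0 ≤ v := by rw [hv]; positivity
  refine ⟨C * (a1 * v + a3 * a1 + aG * (v + a1 + a3)) + R, by positivity,
    fun Q u hB J _ Qh uh => ?_⟩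
  have hh := (mesh_pos (J := J) hL).le
  have hJ : (J : ℝ) * mesh L J = L := card_mul_mesh
  obtain ⟨E, hE⟩ : ∃ E, E = Qh - gridRestrict L Q := ⟨_, rfl⟩
  obtain ⟨e, he⟩ : ∃ e, e = uh - gridRestrict L u := ⟨_, rfl⟩
  have n1 := normL2_sizeFn_le hL E e
  have n2 := normL2_sizeFn_cube_le hL hS E e
  have n3 := normL2_hessErr_le hL hR hB E e
  have ε0 := errSize_nonneg (L := L) E e
  have m0 := normH1T_add_normH2_le_errSize (L := L) E e
  have sm := sq_mesh_le_errSize (L := L) E e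
  have k0 : 0 ≤ normH1T (mesh L J) E + normH2 (mesh L J) e :=
    add_nonneg (Real.sqrt_nonneg _) (Real.sqrt_nonneg _)
  rw [← ha1] at n1
  rw [← ha3] at n2
  rw [← haG] at n3
  have none' : normL2 (mesh L J) (1 : GridFn d J) ≤ v := by
    simpa [hv] using normL2_le_of_abs_le (U := (1 : GridFn d J)) (r := 1) hh hJ (by simp)
  rw [← hE, ← he]
  generalize hεdef : errSize L E e = ε at *
  have n1' : normL2 (mesh L J) (sizeFn E e) ≤ a1 * ε := n1.trans (by gcongr)
  have n2' : normL2 (mesh L J) (sizeFn E e ^ 3) ≤ a3 * ε ^ 3 := n2.trans (by gcongr)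
  obtain ⟨Gs, hGs⟩ : ∃ Gs : GridFn d J, Gs = fun p => absSum (hessErr L u e p) := ⟨_, rfl⟩
  rw [← hGs] at n3
  have main : |energyH P (mesh L J) Qh uh - innerH (mesh L J)
      (fun p : Grid d J => energyDensity P (Q (gridPt L p)) (u (gridPt L p))
        (hessC u (gridPt L p))) 1|
      ≤ C * (innerH (mesh L J) (sizeFn E e) 1
        + innerH (mesh L J) (sizeFn E e ^ 3) (sizeFn E e)
        + innerH (mesh L J) Gs (1 + sizeFn E e + sizeFn E e ^ 3)) := by
    rw [energyH, ← innerH_sub_left]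
    simp only [innerH, Pi.one_apply, mul_one, abs_mul, ← mul_add, ← Finset.sum_add_distrib,
      abs_of_nonneg (pow_nonneg hh d)]
    rw [mul_left_comm]
    gcongr
    rw [Finset.mul_sum]
    refine (Finset.abs_sum_le_sum_abs _ _).trans (Finset.sum_le_sum fun p _ => ?_)
    have := H (Q (gridPt L p)) (E p) (hessC u (gridPt L p)) (hessErr L u e p) (u (gridPt L p)) (e p)
      (hB.absSum_Q_le _) (hB.absSum_hess_le _) (hB.abs_u_le _)
    rw [Pi.sub_apply]
    rw [hE, he, ← gridTensor_eq_add, ← gridFn_eq_add, ← hessH_eq_add, ← hE, ← he] at this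
    refine this.trans (le_of_eq ?_)
    simp only [hGs, sizeFn, Pi.add_apply, Pi.pow_apply, Pi.one_apply]
    ring
  have i1 : innerH (mesh L J) (sizeFn E e) 1 ≤ a1 * ε * v :=
    (le_abs_self _).trans ((abs_innerH_le hh _ _).trans
      (mul_le_mul n1' none' (normL2_nonneg _) (by positivity)))
  have i2 : innerH (mesh L J) (sizeFn E e ^ 3) (sizeFn E e) ≤ a3 * ε ^ 3 * (a1 * ε) :=
    (le_abs_self _).trans ((abs_innerH_le hh _ _).trans
      (mul_le_mul n2' n1' (normL2_nonneg _) (by positivity)))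
  have i3 : innerH (mesh L J) Gs (1 + sizeFn E e + sizeFn E e ^ 3)
      ≤ aG * ε * (v + a1 * ε + a3 * ε ^ 3) := by
    refine (le_abs_self _).trans ((abs_innerH_le hh _ _).trans
      (mul_le_mul n3 ?_ (normL2_nonneg _) (by positivity)))
    exact (normL2_add_le hh _ _).trans (add_le_add ((normL2_add_le hh _ _).trans
      (add_le_add none' n1')) n2')
  have hc := hB.energy_consistent J
  have hc' : R * mesh L J ^ 2 ≤ R * ε := by gcongr
  have p1 : ε ≤ ε * (1 + ε) ^ 3 := le_mul_of_one_le_right ε0 (one_le_pow₀ (by linarith))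
  have p2 : ε * ε ≤ ε * (1 + ε) ^ 3 := by gcongr; nlinarith [pow_nonneg ε0 2, pow_nonneg ε0 3]
  have p4 : ε * ε ^ 3 ≤ ε * (1 + ε) ^ 3 := by gcongr; linarith
  calc |energyH P (mesh L J) Qh uh - energyC P L Q u|
      ≤ C * (a1 * ε * v + a3 * ε ^ 3 * (a1 * ε) + aG * ε * (v + a1 * ε + a3 * ε ^ 3)) + R * ε := by
        refine (abs_sub_le _ _ _).trans (add_le_add (main.trans ?_) (hc.trans hc'))
        gcongr
    _ = C * (a1 * v * ε + a3 * a1 * (ε * ε ^ 3) + aG * (v * ε + a1 * (ε * ε) + a3 * (ε * ε ^ 3)))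
        + R * ε := by ring
    _ ≤ C * (a1 * v * (ε * (1 + ε) ^ 3) + a3 * a1 * (ε * (1 + ε) ^ 3)
        + aG * (v * (ε * (1 + ε) ^ 3) + a1 * (ε * (1 + ε) ^ 3) + a3 * (ε * (1 + ε) ^ 3)))
        + R * (ε * (1 + ε) ^ 3) := by gcongr
    _ = _ := by ring

/-- The Hessian error is multiplied only by `1 + |e|`, and the error `e` of `u` is bounded pointwise
by its `H²` norm. Hence the `H¹` norm suffices for the error of `Q`, in contrast to the estimate for
`μ`. -/
theorem exists_normL2_hH_sub_le (hd : d = 2 ∨ d = 3) (P : Params) (hL : 0 < L) (R : ℝ)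
    (hR : 0 ≤ R) : ∃ C : ℝ, 0 ≤ C ∧ ∀ (Q : (Fin d → ℝ) → Matrix (Fin d) (Fin d) ℝ)
      (u : (Fin d → ℝ) → ℝ), FieldBounds P L R Q u → ∀ (J : ℕ) [NeZero J] (Qh : GridTensor d J)
      (uh : GridFn d J) (i j : Fin d),
      normL2 (mesh L J) (entry (hH P (mesh L J) Qh uh - gridRestrict L (hC P Q u)) i j)
        ≤ C * (errSize L (Qh - gridRestrict L Q) (uh - gridRestrict L u)
          * (1 + errSize L (Qh - gridRestrict L Q) (uh - gridRestrict L u)) ^ 2) := by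
  obtain ⟨C, C0, H⟩ := abs_hVar_sub_le P d R hR
  obtain ⟨S, hS⟩ := exists_isSobolevConst d hd L hL
  have S0 := hS.nonneg
  obtain ⟨a1, ha1⟩ : ∃ a : ℝ, a = (d : ℝ) ^ 2 + 1 := ⟨_, rfl⟩
  obtain ⟨a3, ha3⟩ : ∃ a : ℝ, a = 4 * (((d : ℝ) ^ 2) ^ 3 * S + S) := ⟨_, rfl⟩
  obtain ⟨aG, haG⟩ : ∃ a : ℝ, a = (d : ℝ) ^ 2 + R * √(L ^ d) := ⟨_, rfl⟩
  have a10 : 0 ≤ a1 := by rw [ha1]; positivity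
  have a30 : 0 ≤ a3 := by rw [ha3]; positivity
  have aG0 : 0 ≤ aG := by rw [haG]; positivity
  refine ⟨C * (a1 + a3 + (1 + S) * aG), by positivity, fun Q u hB J _ Qh uh i j => ?_⟩
  have hh := (mesh_pos (J := J) hL).le
  obtain ⟨E, hE⟩ : ∃ E, E = Qh - gridRestrict L Q := ⟨_, rfl⟩
  obtain ⟨e, he⟩ : ∃ e, e = uh - gridRestrict L u := ⟨_, rfl⟩
  have n1 := normL2_sizeFn_le hL E e
  have n2 := normL2_sizeFn_cube_le hL hS E e
  have n3 := normL2_hessErr_le hL hR hB E e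
  have ε0 := errSize_nonneg (L := L) E e
  have m0 := normH1T_add_normH2_le_errSize (L := L) E e
  have me : ∀ p, |e p| ≤ S * errSize L E e := fun p =>
    (hS.abs_le J e p).trans (by gcongr; exact normH2_le_errSize E e)
  have k0 : 0 ≤ normH1T (mesh L J) E + normH2 (mesh L J) e :=
    add_nonneg (Real.sqrt_nonneg _) (Real.sqrt_nonneg _)
  rw [← ha1] at n1
  rw [← ha3] at n2
  rw [← haG] at n3
  rw [← hE, ← he]
  generalize hεdef : errSize L E e = ε at *
  have n1' : normL2 (mesh L J) (sizeFn E e) ≤ a1 * ε := n1.trans (by gcongr)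
  have n2' : normL2 (mesh L J) (sizeFn E e ^ 3) ≤ a3 * ε ^ 3 := n2.trans (by gcongr)
  have p1 : ε ≤ ε * (1 + ε) ^ 2 := le_mul_of_one_le_right ε0 (one_le_pow₀ (by linarith))
  have p2 : (1 + S * ε) * ε ≤ (1 + S) * (ε * (1 + ε) ^ 2) := by
    have : 1 + S * ε ≤ (1 + S) * (1 + ε) ^ 2 := by
      nlinarith [mul_nonneg S0 ε0, mul_nonneg S0 (sq_nonneg ε), sq_nonneg ε]
    calc _ ≤ (1 + S) * (1 + ε) ^ 2 * ε := by gcongr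
      _ = _ := by ring
  have p3 : ε ^ 3 ≤ ε * (1 + ε) ^ 2 := by
    nlinarith [mul_nonneg ε0 ε0, mul_nonneg ε0 (sq_nonneg ε)]
  calc normL2 (mesh L J) (entry (hH P (mesh L J) Qh uh - gridRestrict L (hC P Q u)) i j)
      ≤ normL2 (mesh L J) (C • ((sizeFn E e + sizeFn E e ^ 3)
          + (1 + S * ε) • fun p => absSum (hessErr L u e p))) := by
        refine normL2_mono hh fun p => ?_
        have := H (Q (gridPt L p)) (E p) (hessC u (gridPt L p)) (hessErr L u e p)
          (u (gridPt L p)) (e p) i j (hB.absSum_Q_le _) (hB.absSum_hess_le _) (hB.abs_u_le _)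
        rw [hE, he, ← gridTensor_eq_add, ← gridFn_eq_add, ← hessH_eq_add, ← hE, ← he] at this
        refine this.trans ?_
        change C * (sizeFn E e p + sizeFn E e p ^ 3 + _) ≤ C * (_ + (1 + S * ε) * _)
        rw [mul_comm (1 + S * ε)]
        have := absSum_nonneg (hessErr L u e p)
        gcongr
        exacts [le_rfl, me p]
    _ ≤ C * (a1 * ε + a3 * ε ^ 3 + (1 + S * ε) * (aG * ε)) := by
        rw [normL2_smul hh, abs_of_nonneg C0]
        gcongr
        refine (normL2_add_le hh _ _).trans (add_le_add ((normL2_add_le hh _ _).trans ?_) ?_)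
        · exact add_le_add n1' n2'
        · rw [normL2_smul hh, abs_of_nonneg (by positivity)]
          gcongr
    _ = C * (a1 * ε + a3 * ε ^ 3 + aG * ((1 + S * ε) * ε)) := by ring
    _ ≤ C * (a1 * (ε * (1 + ε) ^ 2) + a3 * (ε * (1 + ε) ^ 2)
          + aG * ((1 + S) * (ε * (1 + ε) ^ 2))) := by gcongr
    _ = _ := by ring

variable {d : ℕ} {L : ℝ}

/-- The discrete `M u` differs from the restricted exact one by `E uₕ / s₊ + M e`, to which the
product estimate applies; the rest is the consistency error. Two differences fall on the error `E`
of `Q`, hence its `H²` norm. -/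
theorem exists_normL2_divDivH_sub_le (hd : d = 2 ∨ d = 3) (P : Params) (hL : 0 < L) (R : ℝ)
    (hR : 0 ≤ R) : ∃ C : ℝ, 0 ≤ C ∧ ∀ (Q : (Fin d → ℝ) → Matrix (Fin d) (Fin d) ℝ)
      (u : (Fin d → ℝ) → ℝ), FieldBounds P L R Q u → ∀ (J : ℕ) [NeZero J] (Qh : GridTensor d J)
      (uh : GridFn d J),
      normL2 (mesh L J) (divDivH P (mesh L J) Qh uh - gridRestrict L (divDivC P Q u))
        ≤ C * ((normH2T (mesh L J) (Qh - gridRestrict L Q)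
            + errSize L (Qh - gridRestrict L Q) (uh - gridRestrict L u))
          * (1 + errSize L (Qh - gridRestrict L Q) (uh - gridRestrict L u)) ^ 2) := by
  obtain ⟨S, hS⟩ := exists_isSobolevConst d hd L hL
  have S0 := hS.nonneg
  obtain ⟨c, hc⟩ : ∃ c : ℝ, c = 2 * S + 2 * ((1 + S) * (1 + (d : ℝ)) ^ 2) := ⟨_, rfl⟩
  have c0 : 0 ≤ c := by rw [hc]; positivity
  obtain ⟨σ, hσ⟩ : ∃ σ : ℝ, σ = |1 / sPlus P d| := ⟨_, rfl⟩
  have σ0 : 0 ≤ σ := by rw [hσ]; positivity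
  refine ⟨d ^ 2 * (σ * c * (2 * R + 2) + c * R) + R * √(L ^ d), by positivity,
    fun Q u hB J _ Qh uh => ?_⟩
  have hh := (mesh_pos (J := J) hL).le
  have hJ : (J : ℝ) * mesh L J = L := card_mul_mesh
  obtain ⟨E, hE⟩ : ∃ E, E = Qh - gridRestrict L Q := ⟨_, rfl⟩
  obtain ⟨e, he⟩ : ∃ e, e = uh - gridRestrict L u := ⟨_, rfl⟩
  rw [← hE, ← he]
  have hQh : ∀ p, Qh p = Q (gridPt L p) + E p := fun p => by rw [hE]; exact gridTensor_eq_add Qh p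
  have huh : ∀ p, uh p = u (gridPt L p) + e p := fun p => by rw [he]; exact gridFn_eq_add uh p
  have nE : ∀ k l, normH2 (mesh L J) (entry E k l) ≤ normH2T (mesh L J) E :=
    fun k l => normH2_entry_le hh E k l
  have b0 : 0 ≤ normH2T (mesh L J) E := Real.sqrt_nonneg _
  have ne := normH2_le_errSize (L := L) E e
  have ε0 := errSize_nonneg (L := L) E e
  have sm := sq_mesh_le_errSize (L := L) E e
  have nu : normH2 (mesh L J) uh ≤ 2 * (R + errSize L E e) := by
    have h1 : uh = gridRestrict L u + e := by rw [he]; abel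
    rw [h1]
    exact (normH2_add_le hh _ _).trans (by gcongr; exact hB.normH2_u_le J)
  generalize errSize L E e = ε at *
  generalize normH2T (mesh L J) E = b at *
  have split : divDivH P (mesh L J) Qh uh - gridRestrict L (divDivC P Q u)
      = (∑ k, ∑ l, ((1 / sPlus P d) • dCtr (mesh L J) k (dCtr (mesh L J) l (entry E k l * uh))
          + dCtr (mesh L J) k (dCtr (mesh L J) l
            ((gridRestrict L fun x => mTensor P (Q x) k l) * e))))
        + (divDivH P (mesh L J) (gridRestrict L Q) (gridRestrict L u)
            - gridRestrict L (divDivC P Q u)) := by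
    rw [← add_sub_assoc]
    congr 1
    funext p
    simp only [Pi.add_apply, Finset.sum_apply, divDivH, ← Finset.sum_add_distrib]
    refine Finset.sum_congr rfl fun k _ => Finset.sum_congr rfl fun l _ => ?_
    -- The numerical `uₕ` is kept in the term with `E`, so no product of two errors arises; its norm
    -- is bounded by `2 (R + ε)`.
    have fe : (fun r => mTensor P (Qh r) k l * uh r) = (1 / sPlus P d) • (entry E k l * uh)
        + (gridRestrict L fun x => mTensor P (Q x) k l) * e
        + fun r => mTensor P (gridRestrict L Q r) k l * gridRestrict L u r := by
      funext r
      simp only [Pi.add_apply, Pi.smul_apply, Pi.mul_apply, smul_eq_mul, entry, gridRestrict,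
        hQh r, mTensor_add, Matrix.add_apply, Matrix.smul_apply]
      rw [huh r]
      ring
    simp only [fe, map_add, map_smul, Pi.add_apply]
  have t1 : ∀ k l, normL2 (mesh L J)
      ((1 / sPlus P d) • dCtr (mesh L J) k (dCtr (mesh L J) l (entry E k l * uh))
        + dCtr (mesh L J) k (dCtr (mesh L J) l
          ((gridRestrict L fun x => mTensor P (Q x) k l) * e)))
      ≤ σ * (c * b * (2 * (R + ε))) + c * R * ε := fun k l => by
    refine (normL2_add_le hh _ _).trans (add_le_add ?_ ?_)
    · rw [normL2_smul hh, ← hσ]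
      refine mul_le_mul_of_nonneg_left ((normL2_dCtr_dCtr_mul_le hL hS k l _ _).trans ?_) σ0
      rw [← hc]
      have := normH2_nonneg (h := mesh L J) uh
      gcongr
      exact nE k l
    · refine (normL2_dCtr_dCtr_mul_le hL hS k l _ _).trans ?_
      rw [← hc]
      have := normH2_nonneg (h := mesh L J) e
      gcongr
      exact hB.normH2_mTensor_le J k l
  have t2 : normL2 (mesh L J) (divDivH P (mesh L J) (gridRestrict L Q) (gridRestrict L u)
      - gridRestrict L (divDivC P Q u)) ≤ R * ε * √(L ^ d) :=
    (normL2_le_of_abs_le hh hJ fun p => hB.divDiv_consistent J p).trans (by gcongr)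
  have q1 : b * (2 * (R + ε)) ≤ (2 * R + 2) * ((b + ε) * (1 + ε) ^ 2) := by
    have : 2 * (R + ε) ≤ (2 * R + 2) * (1 + ε) ^ 2 := by
      nlinarith [mul_nonneg hR ε0, mul_nonneg hR (sq_nonneg ε), sq_nonneg ε]
    calc _ ≤ (b + ε) * ((2 * R + 2) * (1 + ε) ^ 2) := by gcongr; linarith
      _ = _ := by ring
  have q2 : ε ≤ (b + ε) * (1 + ε) ^ 2 :=
    (le_add_of_nonneg_left b0).trans
      (le_mul_of_one_le_right (by positivity) (one_le_pow₀ (by linarith)))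
  rw [split]
  calc _ ≤ (∑ _k : Fin d, ∑ _l : Fin d, (σ * (c * b * (2 * (R + ε))) + c * R * ε))
          + R * ε * √(L ^ d) := by
        refine (normL2_add_le hh _ _).trans (add_le_add ?_ t2)
        exact (normL2_sum_le hh _ _).trans (Finset.sum_le_sum fun k _ =>
          (normL2_sum_le hh _ _).trans (Finset.sum_le_sum fun l _ => t1 k l))
    _ = d ^ 2 * (σ * c * (b * (2 * (R + ε))) + c * R * ε) + R * √(L ^ d) * ε := by simp; ring
    _ ≤ d ^ 2 * (σ * c * ((2 * R + 2) * ((b + ε) * (1 + ε) ^ 2))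
          + c * R * ((b + ε) * (1 + ε) ^ 2)) + R * √(L ^ d) * ((b + ε) * (1 + ε) ^ 2) := by gcongr
    _ = _ := by ring

/-- In `M : D²u` the error `E` of `Q` multiplies the Hessian error, which is only in `l²`; so `E` is
needed pointwise, through its `H²` norm `b`. The bound remains linear in `b`: a product `b ε` is
charged to the polynomial factor in `ε`. -/
theorem exists_normL2_muH_sub_le (hd : d = 2 ∨ d = 3) (P : Params) (hL : 0 < L) (R : ℝ)
    (hR : 0 ≤ R) : ∃ C : ℝ, 0 ≤ C ∧ ∀ (Q : (Fin d → ℝ) → Matrix (Fin d) (Fin d) ℝ)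
      (u : (Fin d → ℝ) → ℝ), FieldBounds P L R Q u → ∀ (J : ℕ) [NeZero J] (Qh : GridTensor d J)
      (uh : GridFn d J),
      normL2 (mesh L J) (muH P (mesh L J) Qh uh - gridRestrict L (muC P Q u))
        ≤ C * ((normH2T (mesh L J) (Qh - gridRestrict L Q)
            + errSize L (Qh - gridRestrict L Q) (uh - gridRestrict L u))
          * (1 + errSize L (Qh - gridRestrict L Q) (uh - gridRestrict L u)) ^ 2) := by
  obtain ⟨C, C0, H⟩ := abs_muVar_sub_le P d R hR
  obtain ⟨S, hS⟩ := exists_isSobolevConst d hd L hL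
  obtain ⟨D, D0, HD⟩ := exists_normL2_divDivH_sub_le hd P hL R hR
  have S0 := hS.nonneg
  obtain ⟨a1, ha1⟩ : ∃ a : ℝ, a = (d : ℝ) ^ 2 + 1 := ⟨_, rfl⟩
  obtain ⟨a3, ha3⟩ : ∃ a : ℝ, a = 4 * (((d : ℝ) ^ 2) ^ 3 * S + S) := ⟨_, rfl⟩
  obtain ⟨aG, haG⟩ : ∃ a : ℝ, a = (d : ℝ) ^ 2 + R * √(L ^ d) := ⟨_, rfl⟩
  have a10 : 0 ≤ a1 := by rw [ha1]; positivity
  have a30 : 0 ≤ a3 := by rw [ha3]; positivity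
  have aG0 : 0 ≤ aG := by rw [haG]; positivity
  refine ⟨C * (a1 + a3 + (1 + d ^ 2 * S) * aG + D), by positivity, fun Q u hB J _ Qh uh => ?_⟩
  have hh := (mesh_pos (J := J) hL).le
  have hδ := HD Q u hB J Qh uh
  obtain ⟨E, hE⟩ : ∃ E, E = Qh - gridRestrict L Q := ⟨_, rfl⟩
  obtain ⟨e, he⟩ : ∃ e, e = uh - gridRestrict L u := ⟨_, rfl⟩
  rw [← hE, ← he] at hδ ⊢
  have n1 := normL2_sizeFn_le hL E e
  have n2 := normL2_sizeFn_cube_le hL hS E e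
  have n3 := normL2_hessErr_le hL hR hB E e
  have ε0 := errSize_nonneg (L := L) E e
  have m0 := normH1T_add_normH2_le_errSize (L := L) E e
  have mE := absSum_le_normH2T hL hS E
  have b0 : 0 ≤ normH2T (mesh L J) E := Real.sqrt_nonneg _
  have k0 : 0 ≤ normH1T (mesh L J) E + normH2 (mesh L J) e :=
    add_nonneg (Real.sqrt_nonneg _) (Real.sqrt_nonneg _)
  rw [← ha1] at n1
  rw [← ha3] at n2
  rw [← haG] at n3
  generalize hεdef : errSize L E e = ε at *
  generalize normH2T (mesh L J) E = b at *
  obtain ⟨δ, hδdef⟩ : ∃ δ, δ = divDivH P (mesh L J) Qh uh - gridRestrict L (divDivC P Q u) :=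
    ⟨_, rfl⟩
  rw [← hδdef] at hδ
  have hdd : ∀ p, divDivH P (mesh L J) Qh uh p = divDivC P Q u (gridPt L p) + δ p := fun p => by
    rw [hδdef]; simp [gridRestrict]
  have n1' : normL2 (mesh L J) (sizeFn E e) ≤ a1 * ε := n1.trans (by gcongr)
  have n2' : normL2 (mesh L J) (sizeFn E e ^ 3) ≤ a3 * ε ^ 3 := n2.trans (by gcongr)
  have p0 : 1 ≤ (1 + ε) ^ 2 := one_le_pow₀ (by linarith)
  have p1 : ε ≤ (b + ε) * (1 + ε) ^ 2 :=
    (le_add_of_nonneg_left b0).trans (le_mul_of_one_le_right (by positivity) p0)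
  have p2 : (1 + d ^ 2 * (S * b)) * ε ≤ (1 + d ^ 2 * S) * ((b + ε) * (1 + ε) ^ 2) := by
    have h1 : b * ε ≤ (b + ε) * (1 + ε) ^ 2 := by
      gcongr
      · linarith
      · nlinarith
    have h2 := mul_le_mul_of_nonneg_left h1 (by positivity : 0 ≤ (d : ℝ) ^ 2 * S)
    linarith only [p1, h2]
  have p3 : ε ^ 3 ≤ (b + ε) * (1 + ε) ^ 2 := by
    calc ε ^ 3 = ε * ε ^ 2 := by ring
      _ ≤ _ := by gcongr <;> linarith
  calc normL2 (mesh L J) (muH P (mesh L J) Qh uh - gridRestrict L (muC P Q u))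
      ≤ normL2 (mesh L J) (C • (((sizeFn E e + sizeFn E e ^ 3)
          + (1 + d ^ 2 * (S * b)) • fun p => absSum (hessErr L u e p)) + fun p => |δ p|)) := by
        refine normL2_mono hh fun p => ?_
        have := H (Q (gridPt L p)) (E p) (hessC u (gridPt L p)) (hessErr L u e p)
          (u (gridPt L p)) (e p) (divDivC P Q u (gridPt L p)) (δ p)
          (hB.absSum_Q_le _) (hB.absSum_hess_le _) (hB.abs_u_le _)
        rw [← hdd, hE, he, ← gridTensor_eq_add, ← gridFn_eq_add, ← hessH_eq_add, ← hE, ← he] at this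
        refine this.trans ?_
        change C * (sizeFn E e p + sizeFn E e p ^ 3 + _ + _)
          ≤ C * (_ + (1 + d ^ 2 * (S * b)) * _ + |δ p|)
        rw [mul_comm (1 + d ^ 2 * (S * b))]
        have := absSum_nonneg (hessErr L u e p)
        gcongr
        exacts [le_rfl, mE p]
    _ ≤ C * (a1 * ε + a3 * ε ^ 3 + (1 + d ^ 2 * (S * b)) * (aG * ε)
          + D * ((b + ε) * (1 + ε) ^ 2)) := by
        rw [normL2_smul hh, abs_of_nonneg C0]
        gcongr
        refine (normL2_add_le hh _ _).trans (add_le_add ((normL2_add_le hh _ _).trans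
          (add_le_add ((normL2_add_le hh _ _).trans ?_) ?_)) ?_)
        · exact add_le_add n1' n2'
        · rw [normL2_smul hh, abs_of_nonneg (by positivity)]
          gcongr
        · rw [normL2_abs]; exact hδ
    _ = C * (a1 * ε + a3 * ε ^ 3 + aG * ((1 + d ^ 2 * (S * b)) * ε)
          + D * ((b + ε) * (1 + ε) ^ 2)) := by ring
    _ ≤ C * (a1 * ((b + ε) * (1 + ε) ^ 2) + a3 * ((b + ε) * (1 + ε) ^ 2)
          + aG * ((1 + d ^ 2 * S) * ((b + ε) * (1 + ε) ^ 2))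
          + D * ((b + ε) * (1 + ε) ^ 2)) := by gcongr
    _ = _ := by ring

theorem abs_exp_sub_one_le_mul (x : ℝ) : |Real.exp x - 1| ≤ |x| * Real.exp |x| := by
  have h1 := Real.add_one_le_exp x
  have h2 := Real.add_one_le_exp (-x)
  have h3 : Real.exp x * Real.exp (-x) = 1 := by rw [← Real.exp_add]; simp
  rcases le_total 0 x with hx | hx
  · rw [abs_of_nonneg hx, abs_le]
    have := Real.exp_pos x
    constructor <;> nlinarith
  · rw [abs_of_nonpos hx, abs_le]
    have h4 := Real.one_le_exp (by linarith : 0 ≤ -x)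
    constructor <;> nlinarith [Real.exp_le_one_iff.2 hx]

/-- The exact variations multiply `g - 1` in the final splitting, so uniform bounds for them are
needed. -/
theorem exists_normL2_nonlin_bounds (P : Params) (d : ℕ) (R : ℝ) (hR : 0 ≤ R) :
    ∃ C : ℝ, 0 ≤ C ∧ ∀ (L : ℝ) (Q : (Fin d → ℝ) → Matrix (Fin d) (Fin d) ℝ)
      (u : (Fin d → ℝ) → ℝ), FieldBounds P L R Q u → ∀ x,
      (∀ i j, |hC P Q u x i j| ≤ C) ∧ |muC P Q u x| ≤ C := by
  obtain ⟨C1, n1, H1⟩ := exists_abs_hVar_le P d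
  obtain ⟨C2, n2, H2⟩ := exists_abs_muVar_le P d
  refine ⟨C1 * ((R + R) + (R + R) ^ 3 + R * (1 + R))
    + C2 * ((R + R) + (R + R) ^ 3 + R * (1 + R) + R), by positivity, fun L Q u hB x => ?_⟩
  have a1 := hB.absSum_Q_le x
  have a2 := hB.abs_u_le x
  have a3 := hB.absSum_hess_le x
  have a4 := hB.abs_divDiv_le x
  have b1 := absSum_nonneg (Q x)
  have b3 := absSum_nonneg (hessC u x)
  refine ⟨fun i j => ((H1 _ _ _ i j).trans ?_).trans
    (le_add_of_nonneg_right (by positivity)), ((H2 _ _ _ _).trans ?_).trans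
    (le_add_of_nonneg_left (by positivity))⟩
  · gcongr
  · gcongr

/-! ### From the size of the state to the size of the error -/

section Comparison

variable {d J : ℕ} [NeZero J] {h : ℝ}

theorem l2Sq_neg (U : GridFn d J) : l2Sq h (-U) = l2Sq h U := by
  simp [l2Sq, innerH]

theorem normH1T_sub_le (hh : 0 ≤ h) (Φ Ψ : GridTensor d J) :
    normH1T h (Φ - Ψ) ≤ 2 * (normH1T h Φ + normH1T h Ψ) := by
  have e : normH1T h (-Ψ) = normH1T h Ψ := by
    have e1 : ∀ i j, entry (-Ψ) i j = -entry Ψ i j := fun _ _ => rfl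
    simp only [normH1T, h1Sq, e1, map_neg, l2Sq_neg]
  rw [sub_eq_add_neg, ← e]
  exact normH1T_add_le hh _ _

theorem normH2_sub_le (hh : 0 ≤ h) (U V : GridFn d J) :
    normH2 h (U - V) ≤ 2 * (normH2 h U + normH2 h V) := by
  have e : normH2 h (-V) = normH2 h V := by
    simp only [normH2, h2Sq, h1Sq, map_neg, l2Sq_neg]
  rw [sub_eq_add_neg, ← e]
  exact normH2_add_le hh _ _

end Comparison

variable {d : ℕ} {L : ℝ}

/-- The error is controlled by the size of the numerical solution. -/
theorem one_add_errSize_le (hL : 0 < L) {P : Params} {R : ℝ} (hR : 0 ≤ R)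
    {Q : (Fin d → ℝ) → Matrix (Fin d) (Fin d) ℝ} {u : (Fin d → ℝ) → ℝ}
    (hB : FieldBounds P L R Q u) {J : ℕ} [NeZero J] (Qh : GridTensor d J) (uh : GridFn d J) :
    1 + errSize L (Qh - gridRestrict L Q) (uh - gridRestrict L u)
      ≤ (2 + 4 * R + L ^ 2) * (1 + (normH1T (mesh L J) Qh + normH2 (mesh L J) uh)) := by
  have hh : 0 < mesh L J := mesh_pos hL
  have h1 := (normH1T_sub_le hh.le Qh (gridRestrict L Q))
  have h2 := (normH2_sub_le hh.le uh (gridRestrict L u))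
  have h3 := hB.normH1T_le J
  have h4 := hB.normH2_u_le J
  have h5 : mesh L J ^ 2 ≤ L ^ 2 := pow_le_pow_left₀ hh.le (mesh_le hL) 2
  have a0 : 0 ≤ normH1T (mesh L J) Qh := Real.sqrt_nonneg _
  have b0 := normH2_nonneg (h := mesh L J) uh
  have h6 : 0 ≤ (4 * R + L ^ 2) * (normH1T (mesh L J) Qh + normH2 (mesh L J) uh) := by positivity
  rw [errSize]
  linarith only [h1, h2, h3, h4, h5, h6]

/-- The multiplier of the numerical solution is Lipschitz along the exact solution. -/
theorem exists_abs_multH_sub_one_le (hd : d = 2 ∨ d = 3) (P : Params) (hL : 0 < L) (R G : ℝ)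
    (hR : 0 ≤ R) (hG : 0 ≤ G) : ∃ C : ℝ, 0 ≤ C ∧
      ∀ (Q : (Fin d → ℝ) → Matrix (Fin d) (Fin d) ℝ) (u : (Fin d → ℝ) → ℝ),
      FieldBounds P L R Q u → ∀ (J : ℕ) [NeZero J] (Qh : GridTensor d J) (uh : GridFn d J)
      (sh : ℝ), multH P (mesh L J) Qh uh sh ≤ G →
      |multH P (mesh L J) Qh uh sh - 1| ≤ C * (|sh - energyC P L Q u|
        + errSize L (Qh - gridRestrict L Q) (uh - gridRestrict L u)) := by
  obtain ⟨C1, n1, H1⟩ := exists_abs_energy_sub_le hd P hL R hR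
  refine ⟨(1 + 8 * C1) * Real.exp (1 + 8 * C1) + (G + 1), by positivity,
    fun Q u hB J _ Qh uh sh hg => ?_⟩
  have hE := H1 Q u hB J Qh uh
  have ε0 := errSize_nonneg (L := L) (Qh - gridRestrict L Q) (uh - gridRestrict L u)
  generalize errSize L (Qh - gridRestrict L Q) (uh - gridRestrict L u) = ε at *
  rw [multH_eq_exp] at hg ⊢
  have hx : |sh - energyH P (mesh L J) Qh uh|
      ≤ |sh - energyC P L Q u| + C1 * (ε * (1 + ε) ^ 3) := by
    refine (abs_sub_le _ (energyC P L Q u) _).trans ?_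
    gcongr
    rwa [abs_sub_comm]
  generalize sh - energyH P (mesh L J) Qh uh = x at *
  have s0 := abs_nonneg (sh - energyC P L Q u)
  generalize |sh - energyC P L Q u| = σ at *
  have B0 : 0 ≤ (1 + 8 * C1) * Real.exp (1 + 8 * C1) := by positivity
  -- If the errors are small, the factor `(1 + ε)³` is at most `2³` and the exponential is Lipschitz
  -- on a bounded range. If they are large, `|g - 1| ≤ G + 1` is already at most a multiple of `σ +
  -- ε`.
  rcases le_total (σ + ε) 1 with h | h
  · have e3 : ε * (1 + ε) ^ 3 ≤ ε * 2 ^ 3 := by gcongr; linarith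
    have hx2 : |x| ≤ (1 + 8 * C1) * (σ + ε) := by
      have := mul_le_mul_of_nonneg_left e3 n1
      have := mul_nonneg n1 s0
      linarith
    have hx3 : |x| ≤ 1 + 8 * C1 := hx2.trans (mul_le_of_le_one_right (by positivity) h)
    calc |Real.exp x - 1| ≤ |x| * Real.exp |x| := abs_exp_sub_one_le_mul x
      _ ≤ (1 + 8 * C1) * (σ + ε) * Real.exp (1 + 8 * C1) := by gcongr
      _ = (1 + 8 * C1) * Real.exp (1 + 8 * C1) * (σ + ε) := by ring
      _ ≤ _ := by gcongr; linarith
  · have h1 : |Real.exp x - 1| ≤ G + 1 := by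
      have := Real.exp_pos x
      rw [abs_le]; constructor <;> linarith
    have h2 : G + 1 ≤ (G + 1) * (σ + ε) := le_mul_of_one_le_right (by positivity) h
    have h3 : 0 ≤ (1 + 8 * C1) * Real.exp (1 + 8 * C1) * (σ + ε) := by positivity
    linarith

/-- Lipschitz estimates for the multiplier and the nonlinear terms, at states where the multiplier
dominates a power of the norms. -/
theorem exists_nonlin_sub_le (hd : d = 2 ∨ d = 3) (P : Params) (hP : P.Admissible d)
    (hL : 0 < L) (R G : ℝ) (hR : 0 ≤ R) (hG : 0 ≤ G) : ∃ C : ℝ, 0 < C ∧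
      ∀ (Q : (Fin d → ℝ) → Matrix (Fin d) (Fin d) ℝ) (u : (Fin d → ℝ) → ℝ),
      FieldBounds P L R Q u → ∀ (J : ℕ) [NeZero J] (Qh : GridTensor d J) (uh : GridFn d J)
      (sh : ℝ), multH P (mesh L J) Qh uh sh
        * (1 + (normH1T (mesh L J) Qh + normH2 (mesh L J) uh)) ^ 4 ≤ G →
      |multH P (mesh L J) Qh uh sh - 1| ≤ C * (|sh - energyC P L Q u|
        + errSize L (Qh - gridRestrict L Q) (uh - gridRestrict L u)) ∧
      normL2T (mesh L J) (nonlinQH P (mesh L J) Qh uh sh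
          - gridRestrict L fun x => -hC P Q u x + P.κ1 • Q x)
        ≤ C * (|sh - energyC P L Q u|
          + errSize L (Qh - gridRestrict L Q) (uh - gridRestrict L u)) ∧
      normL2 (mesh L J) (nonlinUH P (mesh L J) Qh uh sh
          - gridRestrict L fun x => -muC P Q u x + P.κ2 * u x)
        ≤ C * (|sh - energyC P L Q u| + normH2T (mesh L J) (Qh - gridRestrict L Q)
          + errSize L (Qh - gridRestrict L Q) (uh - gridRestrict L u)) := by
  have hκ1 := hP.κ1_pos
  have hκ2 := hP.κ2_pos
  obtain ⟨K, hK⟩ : ∃ K : ℝ, K = (2 + 4 * R + L ^ 2) ^ 4 * G := ⟨_, rfl⟩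
  have K0 : 0 ≤ K := by rw [hK]; positivity
  obtain ⟨C1, n1, H1⟩ := exists_abs_multH_sub_one_le hd P hL R K hR K0
  obtain ⟨C2, n2, H2⟩ := exists_normL2_nonlin_bounds P d R hR
  obtain ⟨C3, n3, H3⟩ := exists_normL2_hH_sub_le hd P hL R hR
  obtain ⟨C4, n4, H4⟩ := exists_normL2_muH_sub_le hd P hL R hR
  obtain ⟨v, hv⟩ : ∃ v : ℝ, v = √(L ^ d) := ⟨_, rfl⟩
  have v0 : 0 ≤ v := by rw [hv]; positivity
  refine ⟨C1 + d * (C3 * K + P.κ1 * K + C1 * ((C2 + P.κ1 * R) * v))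
    + (C4 * K + P.κ2 * K + C1 * ((C2 + P.κ2 * R) * v)) + 1, by positivity,
    fun Q u hB J _ Qh uh sh hg => ?_⟩
  have hh := (mesh_pos (J := J) hL).le
  have hJ : (J : ℝ) * mesh L J = L := card_mul_mesh
  have g0 : 0 ≤ multH P (mesh L J) Qh uh sh := by rw [multH]; positivity
  have hK1 := one_add_errSize_le hL hR hB Qh uh
  have b2 := H2 L Q u hB
  have b3 := H3 Q u hB J Qh uh
  have b4 := H4 Q u hB J Qh uh
  have b1 := H1 Q u hB J Qh uh sh
  obtain ⟨E, hE⟩ : ∃ E, E = Qh - gridRestrict L Q := ⟨_, rfl⟩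
  obtain ⟨e, he⟩ : ∃ e, e = uh - gridRestrict L u := ⟨_, rfl⟩
  have hQh : ∀ p, Qh p = Q (gridPt L p) + E p := fun p => by rw [hE]; exact gridTensor_eq_add Qh p
  have huh : ∀ p, uh p = u (gridPt L p) + e p := fun p => by rw [he]; exact gridFn_eq_add uh p
  rw [← hE, ← he] at b1 b3 b4 hK1 ⊢
  have ε0 := errSize_nonneg (L := L) E e
  have nE : ∀ i j, normL2 (mesh L J) (entry E i j) ≤ errSize L E e := fun i j =>
    (normL2_le_normH1 hh _).trans ((normH1_entry_le hh E i j).trans (normH1T_le_errSize E e))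
  have ne : normL2 (mesh L J) e ≤ errSize L E e :=
    (normL2_le_normH1 hh _).trans ((normH1_le_normH2 hh e).trans (normH2_le_errSize E e))
  have c0 : 0 ≤ normH2T (mesh L J) E := Real.sqrt_nonneg _
  have s0 := abs_nonneg (sh - energyC P L Q u)
  generalize errSize L E e = ε at *
  generalize normH2T (mesh L J) E = b at *
  generalize |sh - energyC P L Q u| = σ at *
  obtain ⟨g, hgdef⟩ : ∃ g, g = multH P (mesh L J) Qh uh sh := ⟨_, rfl⟩
  rw [← hgdef] at g0 hg b1 ⊢
  -- The decay of `g` in the norms of the state becomes decay in the error; from here on `g`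
  -- swallows the polynomial factors of the variation estimates.
  have gK4 : g * (1 + ε) ^ 4 ≤ K := by
    calc g * (1 + ε) ^ 4
        ≤ g * ((2 + 4 * R + L ^ 2) * (1 + (normH1T (mesh L J) Qh + normH2 (mesh L J) uh))) ^ 4 := by
          gcongr
      _ = (2 + 4 * R + L ^ 2) ^ 4
          * (g * (1 + (normH1T (mesh L J) Qh + normH2 (mesh L J) uh)) ^ 4) := by ring
      _ ≤ K := by rw [hK]; gcongr
  have one_le : 1 ≤ 1 + ε := by linarith
  have gK2 : g * (1 + ε) ^ 2 ≤ K :=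
    (mul_le_mul_of_nonneg_left (pow_le_pow_right₀ one_le (by norm_num)) g0).trans gK4
  have gK : g ≤ K := (le_mul_of_one_le_right g0 (one_le_pow₀ one_le)).trans gK4
  have b1 := b1 gK
  have σε : ε ≤ σ + ε := by linarith
  have A1 : 0 ≤ d * (C3 * K + P.κ1 * K + C1 * ((C2 + P.κ1 * R) * v)) := by positivity
  have A2 : 0 ≤ C4 * K + P.κ2 * K + C1 * ((C2 + P.κ2 * R) * v) := by positivity
  refine ⟨b1.trans (by gcongr; linarith), ?_, ?_⟩
  · have ent : ∀ i j, normL2 (mesh L J) (entry (nonlinQH P (mesh L J) Qh uh sh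
          - gridRestrict L fun x => -hC P Q u x + P.κ1 • Q x) i j)
        ≤ (C3 * K + P.κ1 * K + C1 * ((C2 + P.κ1 * R) * v)) * (σ + ε) := fun i j => by
      -- Because the exact multiplier is one, the difference is `-g (Hₕ - H) + g κ1 E + (g - 1)(-H +
      -- κ1 Q)`: the errors carry the decaying discrete `g`, and `g - 1` meets only bounded exact
      -- data.
      have split : entry (nonlinQH P (mesh L J) Qh uh sh
          - gridRestrict L fun x => -hC P Q u x + P.κ1 • Q x) i j
          = ((-g) • entry (hH P (mesh L J) Qh uh - gridRestrict L (hC P Q u)) i j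
            + (g * P.κ1) • entry E i j)
            + (g - 1) • fun p => -hC P Q u (gridPt L p) i j + P.κ1 * Q (gridPt L p) i j := by
        funext p
        simp only [entry, nonlinQH, ← hgdef, gridRestrict, Pi.sub_apply, Pi.add_apply,
          Pi.smul_apply, smul_eq_mul, Matrix.sub_apply, Matrix.add_apply, Matrix.neg_apply,
          Matrix.smul_apply]
        rw [hQh p, Matrix.add_apply]
        ring
      have w : normL2 (mesh L J)
          (fun p => -hC P Q u (gridPt L p) i j + P.κ1 * Q (gridPt L p) i j : GridFn d J)
          ≤ (C2 + P.κ1 * R) * v := by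
        rw [hv]
        refine normL2_le_of_abs_le hh hJ fun p => (abs_add_le _ _).trans ?_
        rw [abs_neg, abs_mul, abs_of_pos hκ1]
        gcongr
        exacts [(b2 _).1 i j, (abs_entry_le_absSum _ i j).trans (hB.absSum_Q_le _)]
      rw [split]
      calc _ ≤ g * (C3 * (ε * (1 + ε) ^ 2)) + g * P.κ1 * ε
            + C1 * (σ + ε) * ((C2 + P.κ1 * R) * v) := by
            refine (normL2_add_le hh _ _).trans (add_le_add ((normL2_add_le hh _ _).trans
              (add_le_add ?_ ?_)) ?_)
            · rw [normL2_smul hh, abs_neg, abs_of_nonneg g0]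
              exact mul_le_mul_of_nonneg_left (b3 i j) g0
            · rw [normL2_smul hh, abs_of_nonneg (by positivity)]
              exact mul_le_mul_of_nonneg_left (nE i j) (by positivity)
            · rw [normL2_smul hh]
              exact mul_le_mul b1 w (normL2_nonneg _) (by positivity)
        _ = C3 * (g * (1 + ε) ^ 2) * ε + P.κ1 * g * ε
            + C1 * ((C2 + P.κ1 * R) * v) * (σ + ε) := by ring
        _ ≤ C3 * K * (σ + ε) + P.κ1 * K * (σ + ε)
            + C1 * ((C2 + P.κ1 * R) * v) * (σ + ε) := by gcongr
        _ = _ := by ring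
    refine (normL2T_le_of_entry_le hh ent).trans ?_
    rw [← mul_assoc]
    gcongr
    linarith
  · have split : nonlinUH P (mesh L J) Qh uh sh
          - (gridRestrict L fun x => -muC P Q u x + P.κ2 * u x)
        = ((-g) • (muH P (mesh L J) Qh uh - gridRestrict L (muC P Q u)) + (g * P.κ2) • e)
          + (g - 1) • fun p => -muC P Q u (gridPt L p) + P.κ2 * u (gridPt L p) := by
      funext p
      simp only [nonlinUH, ← hgdef, gridRestrict, Pi.sub_apply, Pi.add_apply, Pi.smul_apply,
        smul_eq_mul]
      rw [huh p]
      ring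
    have w : normL2 (mesh L J)
        (fun p => -muC P Q u (gridPt L p) + P.κ2 * u (gridPt L p) : GridFn d J)
        ≤ (C2 + P.κ2 * R) * v := by
      rw [hv]
      refine normL2_le_of_abs_le hh hJ fun p => (abs_add_le _ _).trans ?_
      rw [abs_neg, abs_mul, abs_of_pos hκ2]
      gcongr
      exacts [(b2 _).2, hB.abs_u_le _]
    rw [split]
    calc _ ≤ g * (C4 * ((b + ε) * (1 + ε) ^ 2)) + g * P.κ2 * ε
          + C1 * (σ + ε) * ((C2 + P.κ2 * R) * v) := by
          refine (normL2_add_le hh _ _).trans (add_le_add ((normL2_add_le hh _ _).trans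
            (add_le_add ?_ ?_)) ?_)
          · rw [normL2_smul hh, abs_neg, abs_of_nonneg g0]
            exact mul_le_mul_of_nonneg_left b4 g0
          · rw [normL2_smul hh, abs_of_nonneg (by positivity)]
            exact mul_le_mul_of_nonneg_left ne (by positivity)
          · rw [normL2_smul hh]
            exact mul_le_mul b1 w (normL2_nonneg _) (by positivity)
      _ = C4 * (g * (1 + ε) ^ 2) * (b + ε) + P.κ2 * g * ε
          + C1 * ((C2 + P.κ2 * R) * v) * (σ + ε) := by ring
      _ ≤ C4 * K * (σ + b + ε) + P.κ2 * K * (σ + b + ε)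
          + C1 * ((C2 + P.κ2 * R) * v) * (σ + b + ε) := by
          gcongr <;> linarith
      _ = (C4 * K + P.κ2 * K + C1 * ((C2 + P.κ2 * R) * v)) * (σ + b + ε) := by ring
      _ ≤ _ := mul_le_mul_of_nonneg_right (by linarith) (by positivity)

end SmA

/-! ### The three Lipschitz estimates along the numerical solution -/

open SmA
theorem theorem13 (d : ℕ) (hd : d = 2 ∨ d = 3) (P : Params) (hP : P.Admissible d)
    (L T : ℝ) (hL : 0 < L) (hT : 0 < T)
    (Q : ℝ → (Fin d → ℝ) → Matrix (Fin d) (Fin d) ℝ) (u : ℝ → (Fin d → ℝ) → ℝ) (s : ℝ → ℝ)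
    (hsol : IsExactSolution P L T Q u s) (M : ℝ) :
    ∃ C CQ Cu : ℝ, 0 < C ∧ 0 < CQ ∧ 0 < Cu ∧
      ∀ (J : ℕ) [NeZero J] (τ η0 : ℝ), 0 < τ → η0 ∈ Icc (0 : ℝ) 1 →
      ∀ (Qh : ℕ → GridTensor d J) (uh : ℕ → GridFn d J) (sh sTil ξ : ℕ → ℝ),
        IsSchemeSolution P (mesh L J) τ η0 Qh uh sh sTil ξ →
        normH1T (mesh L J) (Qh 0) ≤ M → normH2 (mesh L J) (uh 0) ≤ M → |sh 0| ≤ M →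
        ∀ n : ℕ, n * τ ≤ T →
          |multH P (mesh L J) (Qh n) (uh n) (sh n) - multC P L (Q (n * τ)) (u (n * τ)) (s (n * τ))|
            ≤ C * (|sh n - s (n * τ)|
                + normH1T (mesh L J) (Qh n - gridRestrict L (Q (n * τ)))
                + normH2 (mesh L J) (uh n - gridRestrict L (u (n * τ))) + mesh L J ^ 2) ∧
          normL2T (mesh L J) (nonlinQH P (mesh L J) (Qh n) (uh n) (sh n)
              - gridRestrict L (nonlinQC P L (Q (n * τ)) (u (n * τ)) (s (n * τ))))
            ≤ CQ * (|sh n - s (n * τ)|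
                + normH1T (mesh L J) (Qh n - gridRestrict L (Q (n * τ)))
                + normH2 (mesh L J) (uh n - gridRestrict L (u (n * τ))) + mesh L J ^ 2) ∧
          normL2 (mesh L J) (nonlinUH P (mesh L J) (Qh n) (uh n) (sh n)
              - gridRestrict L (nonlinUC P L (Q (n * τ)) (u (n * τ)) (s (n * τ))))
            ≤ Cu * (|sh n - s (n * τ)|
                + normH2T (mesh L J) (Qh n - gridRestrict L (Q (n * τ)))
                + normH2 (mesh L J) (uh n - gridRestrict L (u (n * τ))) + mesh L J ^ 2) := by
  obtain ⟨F, hF⟩ := exists_energy_bound hd hP hL T hT M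
  obtain ⟨G, G0, hG⟩ := exists_multH_mul_pow_le P hP L hL F
  obtain ⟨R, R0, hR⟩ := exists_fieldBounds (ι := Icc 0 T) P hL (Q := fun t => Q t)
    (u := fun t => u t) (fun i j => (hsol.smooth_Q i j).smoothFam) hsol.smooth_u.smoothFam
  obtain ⟨C, C0, hLip⟩ := exists_nonlin_sub_le hd P hP hL R G R0 G0
  -- In the third estimate the `H¹` norm of the error of `Q` inside `errSize` is bounded by the `H²`
  -- norm already present, hence the factor two.
  refine ⟨C, C, 2 * C, C0, C0, by positivity,
    fun J _ τ η0 hτ hη Qh uh sh sTil ξ hS h1 h2 h3 n hn => ?_⟩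
  have ht : (n : ℝ) * τ ∈ Icc 0 T := ⟨by positivity, hn⟩
  have hB := hR ⟨n * τ, ht⟩
  obtain ⟨c1, c2, c3⟩ := hLip _ _ hB J (Qh n) (uh n) (sh n)
    (hG J _ _ _ (hS.tensor n) (hF J τ η0 hτ hη Qh uh sh sTil ξ hS h1 h2 h3 n hn))
  have hs := hsol.s_eq _ ht
  -- The identity `s = E₁(Q, u)` at time `t_n` makes the exact multiplier one.
  have hg : multC P L (Q (n * τ)) (u (n * τ)) (s (n * τ)) = 1 := by
    rw [multC, ← hs, div_self (Real.exp_ne_zero _)]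
  simp only [← hs] at c1 c2 c3
  have eQ : nonlinQC P L (Q (n * τ)) (u (n * τ)) (s (n * τ))
      = fun x => -hC P (Q (n * τ)) (u (n * τ)) x + P.κ1 • Q (n * τ) x := by
    funext x; rw [nonlinQC, hg, one_smul, one_mul]
  have eu : nonlinUC P L (Q (n * τ)) (u (n * τ)) (s (n * τ))
      = fun x => -muC P (Q (n * τ)) (u (n * τ)) x + P.κ2 * u (n * τ) x := by
    funext x; rw [nonlinUC, hg, one_mul, one_mul]
  rw [hg, eQ, eu]
  have mono := normH1T_le_normH2T (mesh_pos (J := J) hL).le (Qh n - gridRestrict L (Q (n * τ)))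
  have s0 := abs_nonneg (sh n - s (n * τ))
  have b0 := normH2_nonneg (h := mesh L J) (uh n - gridRestrict L (u (n * τ)))
  have m0 := sq_nonneg (mesh L J)
  simp only [errSize, ← add_assoc] at c1 c2 c3
  refine ⟨c1, c2, c3.trans ?_⟩
  rw [mul_comm 2 C, mul_assoc]
  refine mul_le_mul_of_nonneg_left ?_ C0.le
  linarith
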